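/- Let $n\ge 1$ and let $w:\mathbb R^n\to[0,\infty)$ be a weight such that $\Sigma:=\{x: w(x)>0\}$ is non-empty and convex and $w$ is twice differentiable at every point of $\Sigma$ (so that $\Sigma$ is open). Assume that $$(\star)\qquad -\nabla^2(\log w)(x)\ \ge\ K\,\mathbb I\quad\text{for all }x\in\Sigma,\ \text{for some constant }K>-1,$$ and let $K_w$ be the largest constant $K$ for which this inequality holds. Let $$d\mu_w=\frac{w(x)e^{-|x|^2/2}\,dx}{\int_\Sigma w(x)e^{-|x|^2/2}\,dx}.$$ Let $A$ be the set of all $u\in C_0^\infty(\overline\Sigma)$ (restrictions of smooth compactly supported functions on $\mathbb R^n$) such that $\nabla u(x)\cdot\eta=0$ for every $x\in\partial\Sigma$ and every outer unit normal vector $\eta$ of $\Sigma$ at $x$ (that is, $|\eta|=1$ and $\eta\cdot(y-x)\le 0$ for all $y\in\Sigma$). Let $W^{1,2}_A(\Sigma,\mu_w)$ be the completion of $A$ with respect to the norm $\left(\int_\Sigma|u|^2d\mu_w\right)^{1/2}+\left(\int_\Sigma|\nabla u|^2d\mu_w\right)^{1/2}$, where an element $f$ of the completion and its gradient $\nabla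 f$ are the $L^2(\mu_w)$-limits of $u_k$ and $\nabla u_k$ for a sequence $u_k\in A$. Let $1\le p<2$. Then: 1. For every $f\in W^{1,2}_A(\Sigma,\mu_w)$, $$\frac1{2-p}\left(\int_\Sigma |f|^2\,d\mu_w-\Bigl(\int_\Sigma|f|^p\,d\mu_w\Bigr)^{2/p}\right)\ \le\ \frac1{1+K_w}\int_\Sigma|\nabla f|^2\,d\mu_w .$$ 2. Suppose that $w$ is partial, i.e. independent of at least one coordinate $x_i$ (as a function on $\mathbb R^n$), that $K_w\ge 0$, and that $\Sigma$ is a cone with vertex at the origin, or $\partial\Sigma$ is $C^\infty$ (possibly empty), or, more generally, the constant function $1$ (with gradient $0$) belongs to $W^{1,2}_A(\Sigma,\mu_w)$. Then the constant $\frac1{1+K_w}$ is sharp: it is the smallest constant $C$ such that the inequality in 1., with $C$ in place of $\frac1{1+K_w}$, holds for all $f\in W^{1,2}_A(\Sigma,\mu_w)$. -/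

import Mathlib

open MeasureTheory Filter Topology
open scoped ContDiff

namespace WeightedGaussian

/-- Euclidean space `ℝⁿ`. -/
abbrev E (n : ℕ) : Type := EuclideanSpace ℝ (Fin n)

variable {n : ℕ}

/-- The set `Σ = {x : w(x) > 0}`. -/
def posSet (w : E n → ℝ) : Set (E n) := {x | 0 < w x}

/-- The quadratic form `v ↦ ∇²(log w)(x)(v, v)`. -/
noncomputable def logHessian (w : E n → ℝ) (x v : E n) : ℝ :=
  fderiv ℝ (fderiv ℝ (fun y => Real.log (w y))) x v v

/-- `-∇²(log w(x)) ≥ K 𝕀` (as quadratic forms) for all `x ∈ Σ`. -/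
def CurvatureBound (w : E n → ℝ) (K : ℝ) : Prop :=
  ∀ x ∈ posSet w, ∀ v : E n, K * ‖v‖ ^ 2 ≤ -logHessian w x v

/-- The largest `K` with `-∇²(log w) ≥ K 𝕀` on `Σ`; see `isGreatest_curvature`. -/
noncomputable def curvature (w : E n → ℝ) : ℝ := sSup {K | CurvatureBound w K}

/-- For `n ≥ 1` and `Σ ≠ ∅` the supremum defining `curvature w` is a maximum as soon as
some bound holds. -/
theorem isGreatest_curvature (hn : 0 < n) {w : E n → ℝ} (hne : (posSet w).Nonempty)
    (hb : ∃ K, CurvatureBound w K) :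
    IsGreatest {K | CurvatureBound w K} (curvature w) := by
  obtain ⟨x₀, hx₀⟩ := hne
  let e : E n := EuclideanSpace.single ⟨0, hn⟩ (1 : ℝ)
  have he : ‖e‖ = 1 := by simp [e]
  have hbdd : BddAbove {K | CurvatureBound w K} := by
    refine ⟨-logHessian w x₀ e, fun K hK => ?_⟩
    have := hK x₀ hx₀ e
    rw [he] at this
    linarith
  refine ⟨fun x hx v => ?_, fun K hK => le_csSup hbdd hK⟩
  rcases eq_or_ne v 0 with rfl | hv
  · obtain ⟨K, hK⟩ := hb
    have := hK x hx 0
    simpa using this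
  · have hv2 : 0 < ‖v‖ ^ 2 := by positivity
    have : curvature w ≤ -logHessian w x v / ‖v‖ ^ 2 :=
      csSup_le hb fun K hK => (le_div_iff₀ hv2).2 (hK x hx v)
    exact (le_div_iff₀ hv2).1 this

/-- A nonnegative weight, not identically zero, which is twice differentiable and positive
on the convex set `Σ = {w > 0}`, and satisfies `-∇²(log w) ≥ K 𝕀` on `Σ` for some `K > -1`.
The set `Σ` is automatically open, since `w` is continuous at each of its points. -/
structure Star (w : E n → ℝ) : Prop where
  nonneg : ∀ x, 0 ≤ w x
  nonempty : (posSet w).Nonempty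
  convex : Convex ℝ (posSet w)
  differentiable : ∀ x ∈ posSet w, DifferentiableAt ℝ w x
  twice_differentiable : ∀ x ∈ posSet w, DifferentiableAt ℝ (fderiv ℝ w) x
  bound : ∃ K : ℝ, -1 < K ∧ CurvatureBound w K

/-- The weight does not depend on one of the coordinates. -/
def IsPartial (w : E n → ℝ) : Prop :=
  ∃ i : Fin n, ∀ (x : E n) (t : ℝ), w (x + EuclideanSpace.single i t) = w x

/-- The measure `w(x) exp(-|x|²/2) dx` on `Σ`, before normalization. -/
noncomputable def preMeasure (w : E n → ℝ) : Measure (E n) :=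
  (volume.restrict (posSet w)).withDensity
    (fun x => ENNReal.ofReal (w x * Real.exp (-‖x‖ ^ 2 / 2)))

/-- The weighted Gaussian probability measure `μ_w`. -/
noncomputable def mu (w : E n → ℝ) : Measure (E n) :=
  (preMeasure w Set.univ)⁻¹ • preMeasure w

/-- `η` is an outer unit normal vector at the boundary point `x` of the convex set `S`. At a
boundary point where `∂S` is differentiable there is exactly one. -/
def IsOuterNormal (S : Set (E n)) (x η : E n) : Prop :=
  ‖η‖ = 1 ∧ ∀ y ∈ S, inner ℝ η (y - x) ≤ 0

/-- The class `A` of functions `u ∈ C₀^∞(closure S)` (restrictions of smooth compactly supported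
functions on `ℝⁿ`) with `∇u · η = 0` on `∂S`. -/
def TestFunctions (S : Set (E n)) : Set (E n → ℝ) :=
  {u | ContDiff ℝ ∞ u ∧ HasCompactSupport u ∧
    ∀ x ∈ frontier S, ∀ η, IsOuterNormal S x η → inner ℝ (gradient u x) η = 0}

/-- The pair `(f, G)` is (a representative of) an element `f` of `W^{1,2}_A(Σ, μ_w)` together with
its gradient `G = ∇f`. The completion of `A` in the norm `‖u‖_{L²(μ_w)} + ‖∇u‖_{L²(μ_w)}` is
realized as the closure of `{(u, ∇u) : u ∈ A}` in `L²(μ_w) × L²(μ_w; ℝⁿ)`. -/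
def MemW12A (w : E n → ℝ) (f : E n → ℝ) (G : E n → E n) : Prop :=
  MemLp f 2 (mu w) ∧ MemLp G 2 (mu w) ∧
    ∃ u : ℕ → E n → ℝ, (∀ k, u k ∈ TestFunctions (posSet w)) ∧
      Tendsto (fun k => eLpNorm (fun x => u k x - f x) 2 (mu w) +
        eLpNorm (fun x => gradient (u k) x - G x) 2 (mu w)) atTop (𝓝 0)

/-- The inequality with exponent `p` and constant `C` holds for every `f ∈ W^{1,2}_A(Σ, μ_w)`. -/
def BecknerInequality (w : E n → ℝ) (p C : ℝ) : Prop :=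
  ∀ (f : E n → ℝ) (G : E n → E n), MemW12A w f G →
    1 / (2 - p) * ((∫ x, f x ^ 2 ∂(mu w)) - (∫ x, |f x| ^ p ∂(mu w)) ^ (2 / p)) ≤
      C * ∫ x, ‖G x‖ ^ 2 ∂(mu w)

/-- `S` is a cone with vertex at the origin. -/
def IsCone (S : Set (E n)) : Prop := ∀ x ∈ S, ∀ t : ℝ, 0 < t → t • x ∈ S

/-- The open set `S` has a `C^∞` boundary: near each boundary point it is a sublevel set of a
smooth function with nonvanishing differential. -/
def HasSmoothBoundary (S : Set (E n)) : Prop :=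
  ∀ x ∈ frontier S, ∃ ρ : E n → ℝ, ContDiff ℝ ∞ ρ ∧ fderiv ℝ ρ x ≠ 0 ∧
    ∀ᶠ y in 𝓝 x, (y ∈ S ↔ ρ y < 0)

end WeightedGaussian

/-!
# The Beckner inequality for weighted Gaussian measures

Put `κ = 1 + K`. On `Σ` the density `w(x) exp (-‖x‖² / 2)` equals `exp (-(W(x) + κ ‖x‖² / 2))`
with `W` convex (`convexPart`), so the first part is the Beckner inequality for a `κ`-uniformly
log-concave measure. For `g > 0` and `1 < r ≤ 2` it reads
`∫ g ^ r - (∫ g) ^ r ≤ (1 / (2κ)) ∫ r (r - 1) g ^ (r - 2) ‖∇g‖²`, and `r = 2 / p`, `g = |f| ^ p`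
turns it into the stated inequality.

The convexity criterion of Bakry and Émery is used in a discrete form which avoids existence and
regularity theory for diffusion semigroups. Let first `W` be smooth and convex on the whole space,
with bounded gradient and bounded Lipschitz Hessian (`IsConvexPotential`). One step of the Euler
scheme of the Langevin dynamics averages `u` over the points `x - h b(x) ± √(2nh) eᵢ`, where
`b = ∇(W + κ ‖·‖² / 2)`. By Jensen's inequality for the jointly convex function
`(a, v) ↦ a ^ (r - 2) ‖v‖²` and the monotonicity of `b`, the entropy density
`r (r - 1) u ^ (r - 2) ‖∇u‖²` contracts by the factor `1 - 2κh + O(h²)`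
(`IsEulerStep.entropyDensity_step_le`), while a Taylor expansion bounds the growth of the entropy
over one step by the entropy density (`exists_step_entropy_le`). The invariance of the measure up
to `o(h)` follows from moving the shifts by `±√(2nh) eᵢ` onto the density and integrating by parts
(`exists_defect_le`). Iterating the scheme over a long time interval and letting the step tend to
`0` gives `IsConvexPotential.entropy_le`. A weight that is positive only on a convex open set is
reached by mollifying finite maxima of tangents of its convex part plus multiples of the distance
to `Σ` (`Star.exists_potentials`). No boundary condition is needed for the inequality, only for
its formulation (`Star.becknerInequality`).

For the second part, the Hessian of `log w` vanishes along the coordinate `xᵢ` of which `w` is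
independent, so `K_w ≤ 0`, which leaves only `K_w = 0`, and `xᵢ` is a standard Gaussian variable
under `μ_w`. Testing with approximations of `exp (s xᵢ)`, `s → 0`, shows that no constant below
`1` is possible (`BecknerInequality.one_le`). The approximations are admissible because
multiplication by a bounded smooth function of `xᵢ` preserves the boundary condition, once `1`
lies in `W^{1,2}_A`. For cones, `1` is the limit of radial cutoffs, whose gradients are tangential
to the boundary. For smooth boundaries, a partition of unity reduces to a neighbourhood in which
`Σ = {ρ < 0}`; there the normal derivative of a function is removed by a boundary layer
`arctan (m ρ) / m` of vanishing energy (`memW12A_of_tsupport_subset`).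
-/

namespace WeightedGaussian

/-! ### Taylor estimates and a Jensen inequality -/

/-- `u` is bounded by `B`, has derivative bounded by `L`, and its derivative is `M`-Lipschitz. -/
structure C11Bound {F : Type*} [NormedAddCommGroup F] [NormedSpace ℝ F]
    (B L M : ℝ) (u : F → ℝ) : Prop where
  bound : ∀ x, |u x| ≤ B
  differentiable : Differentiable ℝ u
  norm_fderiv_le : ∀ x, ‖fderiv ℝ u x‖ ≤ L
  fderiv_lipschitz : ∀ x y, ‖fderiv ℝ u x - fderiv ℝ u y‖ ≤ M * ‖x - y‖

section Taylor

variable {F : Type*} [NormedAddCommGroup F] [NormedSpace ℝ F] {B L M : ℝ} {u : F → ℝ}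

theorem C11Bound.abs_sub_le (hu : C11Bound B L M u) (x y : F) : |u x - u y| ≤ L * ‖x - y‖ := by
  have := convex_univ.norm_image_sub_le_of_norm_fderiv_le (f := u) (𝕜 := ℝ) (C := L)
    (fun z _ => hu.differentiable z) (fun z _ => hu.norm_fderiv_le z) (Set.mem_univ y)
    (Set.mem_univ x)
  simpa using this

theorem C11Bound.nonneg_fderiv (hu : C11Bound B L M u) : 0 ≤ L :=
  (norm_nonneg _).trans (hu.norm_fderiv_le 0)

theorem C11Bound.nonneg (hu : C11Bound B L M u) : 0 ≤ B :=
  (abs_nonneg _).trans (hu.bound 0)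

theorem C11Bound.abs_taylor_le (hu : C11Bound B L M u) (hM : 0 ≤ M) (x v : F) :
    |u (x + v) - u x - fderiv ℝ u x v| ≤ M * ‖v‖ ^ 2 := by
  have := (convex_closedBall x ‖v‖).norm_image_sub_le_of_norm_fderiv_le' (f := u) (𝕜 := ℝ)
    (C := M * ‖v‖) (φ := fderiv ℝ u x) (x := x) (y := x + v)
    (fun z _ => hu.differentiable z) (fun z hz => (hu.fderiv_lipschitz z x).trans ?_)
    (by simp) (by simp)
  · simp only [add_sub_cancel_left, Real.norm_eq_abs] at this
    linarith [this]
  · gcongr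
    simpa [dist_eq_norm] using hz

/-- Second order Taylor estimate for a function on the line whose second derivative deviates at
most linearly from its value at the base point. -/
theorem abs_taylor_two_le {f f₁ f₂ : ℝ → ℝ} {c t C : ℝ} (hC : 0 ≤ C)
    (h₁ : ∀ y ∈ Set.uIcc c (c + t), HasDerivAt f (f₁ y) y)
    (h₂ : ∀ y ∈ Set.uIcc c (c + t), HasDerivAt f₁ (f₂ y) y)
    (h : ∀ y ∈ Set.uIcc c (c + t), |f₂ y - f₂ c| ≤ C * |y - c|) :
    |f (c + t) - f c - f₁ c * t - f₂ c * t ^ 2 / 2| ≤ C * |t| ^ 3 := by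
  set S := Set.uIcc c (c + t)
  have hS : Convex ℝ S := convex_uIcc _ _
  have hcS : c ∈ S := Set.left_mem_uIcc
  have htS : c + t ∈ S := Set.right_mem_uIcc
  have hle : ∀ y ∈ S, |y - c| ≤ |t| := fun y hy => by
    simpa using Set.abs_sub_left_of_mem_uIcc hy
  have hd : ∀ y ∈ S, |f₁ y - f₁ c - f₂ c * (y - c)| ≤ C * |t| * |t| := by
    intro y hy
    have := hS.norm_image_sub_le_of_norm_hasDerivWithin_le
      (f := fun y => f₁ y - f₂ c * (y - c)) (f' := fun y => f₂ y - f₂ c) (C := C * |t|)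
      (x := c) (y := y)
      (fun z hz => by
        have := (h₂ z hz).sub (((hasDerivAt_id z).sub_const c).const_mul (f₂ c))
        exact (this.congr_deriv (by simp)).hasDerivWithinAt)
      (fun z hz => (h z hz).trans (mul_le_mul_of_nonneg_left (hle z hz) hC)) hcS hy
    simp only [sub_self, mul_zero, sub_zero, Real.norm_eq_abs] at this
    calc _ = |f₁ y - f₂ c * (y - c) - f₁ c| := by congr 1; ring
      _ ≤ _ := this
      _ ≤ _ := mul_le_mul_of_nonneg_left (hle y hy) (by positivity)
  have := hS.norm_image_sub_le_of_norm_hasDerivWithin_le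
      (f := fun y => f y - f₁ c * (y - c) - f₂ c * (y - c) ^ 2 / 2)
      (f' := fun y => f₁ y - f₁ c - f₂ c * (y - c)) (C := C * |t| * |t|)
      (x := c) (y := c + t)
      (fun z hz => by
        have h3 := ((hasDerivAt_id z).sub_const c)
        have := ((h₁ z hz).sub (h3.const_mul (f₁ c))).sub
          (((h3.pow 2).const_mul (f₂ c)).div_const 2)
        refine (this.congr_deriv ?_).hasDerivWithinAt
        simp; ring)
      (fun z hz => hd z hz) hcS htS
  simp only [Real.norm_eq_abs] at this
  calc _ = |f (c + t) - f₁ c * (c + t - c) - f₂ c * (c + t - c) ^ 2 / 2 -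
        (f c - f₁ c * (c - c) - f₂ c * (c - c) ^ 2 / 2)| := by congr 1; ring
    _ ≤ _ := this
    _ = _ := by rw [add_sub_cancel_left]; ring

end Taylor

/-- Jensen's inequality for the jointly convex function `(a, b) ↦ b² / a ^ q`, `0 ≤ q ≤ 1`. -/
theorem sq_sum_mul_rpow_le {ι : Type*} [Fintype ι] {c a b : ι → ℝ} {q : ℝ} (hc : ∀ j, 0 ≤ c j)
    (hc1 : ∑ j, c j = 1) (ha : ∀ j, 0 < a j) (hq0 : 0 ≤ q) (hq1 : q ≤ 1) :
    (∑ j, c j * a j) ^ (-q) * (∑ j, c j * b j) ^ 2 ≤ ∑ j, c j * (a j ^ (-q) * b j ^ 2) := by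
  have hpos : 0 < ∑ j, c j * a j := by
    have hne : ∃ j, c j ≠ 0 := by
      by_contra! h
      simp [h] at hc1
    obtain ⟨j, hj⟩ := hne
    exact Finset.sum_pos' (fun i _ => mul_nonneg (hc i) (ha i).le)
      ⟨j, Finset.mem_univ _, mul_pos (lt_of_le_of_ne (hc j) hj.symm) (ha j)⟩
  have hCS : (∑ j, c j * b j) ^ 2 ≤
      (∑ j, c j * a j ^ q) * ∑ j, c j * (a j ^ (-q) * b j ^ 2) := by
    refine Finset.sum_sq_le_sum_mul_sum_of_sq_le_mul _ (fun j _ => ?_) (fun j _ => ?_)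
      (fun j _ => ?_)
    · exact mul_nonneg (hc j) (Real.rpow_nonneg (ha j).le _)
    · exact mul_nonneg (hc j) (mul_nonneg (Real.rpow_nonneg (ha j).le _) (sq_nonneg _))
    · rw [Real.rpow_neg (ha j).le]
      have := (Real.rpow_pos_of_pos (ha j) q).ne'
      exact le_of_eq (by field_simp)
  have hJ : ∑ j, c j * a j ^ q ≤ (∑ j, c j * a j) ^ q := by
    have := (Real.concaveOn_rpow hq0 hq1).le_map_sum (t := Finset.univ) (w := c) (p := a)
      (fun j _ => hc j) hc1 (fun j _ => (ha j).le)
    simpa using this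
  have hR : 0 ≤ ∑ j, c j * (a j ^ (-q) * b j ^ 2) :=
    Finset.sum_nonneg fun j _ =>
      mul_nonneg (hc j) (mul_nonneg (Real.rpow_nonneg (ha j).le _) (sq_nonneg _))
  rw [Real.rpow_neg hpos.le, inv_mul_le_iff₀ (Real.rpow_pos_of_pos hpos _)]
  exact hCS.trans (by gcongr)

end WeightedGaussian

namespace WeightedGaussian

/-! ### One step of a contracting Markov chain -/

section Chain

variable {F : Type*} [NormedAddCommGroup F] [NormedSpace ℝ F] {ι : Type*} [Fintype ι]

/-- The Markov operator of the chain that moves `x` to `φ x + δ j` with probability `c j`. -/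
def step (c : ι → ℝ) (δ : ι → F) (φ : F → F) (u : F → ℝ) (x : F) : ℝ :=
  ∑ j, c j * u (φ x + δ j)

/-- The data of an Euler step: the noise `δ` has size at most `s` and covariance at most `2h`, the
drift map `φ` contracts by the factor `ρ`, and its derivative is `Λ`-Lipschitz. -/
structure IsEulerStep (c : ι → ℝ) (δ : ι → F) (φ : F → F) (h s ρ Λ : ℝ) : Prop where
  nonneg : ∀ j, 0 ≤ c j
  sum_eq_one : ∑ j, c j = 1
  norm_noise_le : ∀ j, ‖δ j‖ ≤ s
  variance_le : ∀ l : F →L[ℝ] ℝ, ∑ j, c j * (l (δ j)) ^ 2 ≤ 2 * h * ‖l‖ ^ 2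
  differentiable : Differentiable ℝ φ
  norm_fderiv_le : ∀ x, ‖fderiv ℝ φ x‖ ≤ ρ
  fderiv_lipschitz : ∀ x y, ‖fderiv ℝ φ x - fderiv ℝ φ y‖ ≤ Λ * ‖x - y‖

/-- The density `Φ''(g) |∇g|²` of the Dirichlet form that controls the `Φ`-entropy of `g`, for
`Φ(x) = x ^ r`. -/
noncomputable def entropyDensity (r : ℝ) (g : F → ℝ) (x : F) : ℝ :=
  r * (r - 1) * (g x ^ (r - 2) * ‖fderiv ℝ g x‖ ^ 2)

variable {c : ι → ℝ} {δ : ι → F} {φ : F → F} {h s ρ Λ B L M : ℝ} {u v g : F → ℝ} {r a₀ : ℝ}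

theorem IsEulerStep.nonneg_contraction (H : IsEulerStep c δ φ h s ρ Λ) : 0 ≤ ρ :=
  (norm_nonneg _).trans (H.norm_fderiv_le 0)

theorem IsEulerStep.step_mono (H : IsEulerStep c δ φ h s ρ Λ) (huv : ∀ x, u x ≤ v x) (x : F) :
    step c δ φ u x ≤ step c δ φ v x :=
  Finset.sum_le_sum fun j _ => mul_le_mul_of_nonneg_left (huv _) (H.nonneg j)

theorem IsEulerStep.weighted_le (H : IsEulerStep c δ φ h s ρ Λ) {y : ι → ℝ} {a : ℝ}
    (hy : ∀ j, y j ≤ a) : ∑ j, c j * y j ≤ a := by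
  calc ∑ j, c j * y j ≤ ∑ j, c j * a :=
        Finset.sum_le_sum fun j _ => mul_le_mul_of_nonneg_left (hy j) (H.nonneg j)
    _ = a := by rw [← Finset.sum_mul, H.sum_eq_one, one_mul]

theorem IsEulerStep.le_weighted (H : IsEulerStep c δ φ h s ρ Λ) {y : ι → ℝ} {a : ℝ}
    (hy : ∀ j, a ≤ y j) : a ≤ ∑ j, c j * y j := by
  calc a = ∑ j, c j * a := by rw [← Finset.sum_mul, H.sum_eq_one, one_mul]
    _ ≤ _ := Finset.sum_le_sum fun j _ => mul_le_mul_of_nonneg_left (hy j) (H.nonneg j)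

theorem IsEulerStep.le_step (H : IsEulerStep c δ φ h s ρ Λ) {a : ℝ} (hu : ∀ x, a ≤ u x) (x : F) :
    a ≤ step c δ φ u x := H.le_weighted fun _ => hu _

theorem IsEulerStep.hasFDerivAt_step (H : IsEulerStep c δ φ h s ρ Λ) (hu : Differentiable ℝ u)
    (x : F) : HasFDerivAt (step c δ φ u)
      (∑ j, c j • (fderiv ℝ u (φ x + δ j)).comp (fderiv ℝ φ x)) x := by
  have : step c δ φ u = fun x => ∑ j, c j * u (φ x + δ j) := rfl
  rw [this]
  refine HasFDerivAt.fun_sum fun j _ => HasFDerivAt.const_mul ?_ _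
  exact (hu (φ x + δ j)).hasFDerivAt.comp x ((H.differentiable x).hasFDerivAt.add_const _)

theorem IsEulerStep.norm_fderiv_step_le (H : IsEulerStep c δ φ h s ρ Λ) (hu : Differentiable ℝ u)
    (x : F) : ‖fderiv ℝ (step c δ φ u) x‖ ≤ ρ * ∑ j, c j * ‖fderiv ℝ u (φ x + δ j)‖ := by
  rw [(H.hasFDerivAt_step hu x).fderiv, Finset.mul_sum]
  refine (norm_sum_le _ _).trans (Finset.sum_le_sum fun j _ => ?_)
  rw [norm_smul, Real.norm_of_nonneg (H.nonneg j)]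
  have h1 := (fderiv ℝ u (φ x + δ j)).opNorm_comp_le (fderiv ℝ φ x)
  have h2 : ‖fderiv ℝ u (φ x + δ j)‖ * ‖fderiv ℝ φ x‖ ≤ ‖fderiv ℝ u (φ x + δ j)‖ * ρ :=
    mul_le_mul_of_nonneg_left (H.norm_fderiv_le x) (norm_nonneg _)
  calc _ ≤ c j * (‖fderiv ℝ u (φ x + δ j)‖ * ρ) :=
        mul_le_mul_of_nonneg_left (h1.trans h2) (H.nonneg j)
    _ = _ := by ring

theorem C11Bound.markov_step (hu : C11Bound B L M u) (hM : 0 ≤ M) (H : IsEulerStep c δ φ h s ρ Λ) :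
    C11Bound B (ρ * L) (ρ ^ 2 * M + Λ * L) (step c δ φ u) where
  bound x := by
    rw [abs_le]
    exact ⟨H.le_weighted fun j => (abs_le.1 (hu.bound _)).1,
      H.weighted_le fun j => (abs_le.1 (hu.bound _)).2⟩
  differentiable x := (H.hasFDerivAt_step hu.differentiable x).differentiableAt
  norm_fderiv_le x := (H.norm_fderiv_step_le hu.differentiable x).trans
    (mul_le_mul_of_nonneg_left (H.weighted_le fun j => hu.norm_fderiv_le _) H.nonneg_contraction)
  fderiv_lipschitz x y := by
    have hρ := H.nonneg_contraction
    have hL := hu.nonneg_fderiv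
    have hφ : ‖φ x - φ y‖ ≤ ρ * ‖x - y‖ :=
      convex_univ.norm_image_sub_le_of_norm_fderiv_le (𝕜 := ℝ)
        (fun z _ => H.differentiable z) (fun z _ => H.norm_fderiv_le z) (Set.mem_univ y)
        (Set.mem_univ x)
    rw [(H.hasFDerivAt_step hu.differentiable x).fderiv,
      (H.hasFDerivAt_step hu.differentiable y).fderiv, ← Finset.sum_sub_distrib]
    refine (norm_sum_le _ _).trans ?_
    have key : ∀ j, ‖(fderiv ℝ u (φ x + δ j)).comp (fderiv ℝ φ x) -
        (fderiv ℝ u (φ y + δ j)).comp (fderiv ℝ φ y)‖ ≤ (ρ ^ 2 * M + Λ * L) * ‖x - y‖ := by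
      intro j
      have e : (fderiv ℝ u (φ x + δ j)).comp (fderiv ℝ φ x) -
          (fderiv ℝ u (φ y + δ j)).comp (fderiv ℝ φ y) =
          (fderiv ℝ u (φ x + δ j) - fderiv ℝ u (φ y + δ j)).comp (fderiv ℝ φ x) +
          (fderiv ℝ u (φ y + δ j)).comp (fderiv ℝ φ x - fderiv ℝ φ y) := by
        ext; simp
      rw [e]
      have h1 : ‖fderiv ℝ u (φ x + δ j) - fderiv ℝ u (φ y + δ j)‖ ≤ M * (ρ * ‖x - y‖) := by
        refine (hu.fderiv_lipschitz _ _).trans (mul_le_mul_of_nonneg_left ?_ hM)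
        rwa [add_sub_add_right_eq_sub]
      calc _ ≤ _ := norm_add_le _ _
        _ ≤ ‖fderiv ℝ u (φ x + δ j) - fderiv ℝ u (φ y + δ j)‖ * ‖fderiv ℝ φ x‖ +
            ‖fderiv ℝ u (φ y + δ j)‖ * ‖fderiv ℝ φ x - fderiv ℝ φ y‖ :=
          add_le_add (ContinuousLinearMap.opNorm_comp_le _ _)
            (ContinuousLinearMap.opNorm_comp_le _ _)
        _ ≤ (M * (ρ * ‖x - y‖)) * ρ + L * (Λ * ‖x - y‖) :=
          add_le_add (mul_le_mul h1 (H.norm_fderiv_le x) (norm_nonneg _) (by positivity))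
            (mul_le_mul (hu.norm_fderiv_le _) (H.fderiv_lipschitz x y) (norm_nonneg _) hL)
        _ = _ := by ring
    refine le_trans (Finset.sum_le_sum fun j _ => ?_)
      (H.weighted_le (y := fun _ => (ρ ^ 2 * M + Λ * L) * ‖x - y‖) fun _ => le_rfl)
    rw [← smul_sub, norm_smul, Real.norm_of_nonneg (H.nonneg j)]
    exact mul_le_mul_of_nonneg_left (key j) (H.nonneg j)

/-- The commutation of the Dirichlet density with the chain: joint convexity of `Φ''(a) b²` and
the contraction of gradients. -/
theorem IsEulerStep.entropyDensity_step_le (H : IsEulerStep c δ φ h s ρ Λ) (hr1 : 1 < r)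
    (hr2 : r ≤ 2) (hg : Differentiable ℝ g) (hpos : ∀ x, 0 < g x) (x : F) :
    entropyDensity r (step c δ φ g) x ≤
      ρ ^ 2 * step c δ φ (entropyDensity r g) x := by
  have hJ := sq_sum_mul_rpow_le (a := fun j => g (φ x + δ j))
    (b := fun j => ‖fderiv ℝ g (φ x + δ j)‖) (q := 2 - r) H.nonneg H.sum_eq_one
    (fun j => hpos _) (by linarith) (by linarith)
  have hD := H.norm_fderiv_step_le hg x
  have hrr : 0 ≤ r * (r - 1) := by nlinarith
  have hm : 0 ≤ step c δ φ g x := H.le_step (fun x => (hpos x).le) x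
  rw [neg_sub] at hJ
  have e : step c δ φ (entropyDensity r g) x = r * (r - 1) *
      ∑ j, c j * (g (φ x + δ j) ^ (r - 2) * ‖fderiv ℝ g (φ x + δ j)‖ ^ 2) := by
    rw [step, Finset.mul_sum]
    exact Finset.sum_congr rfl fun j _ => by rw [entropyDensity]; ring
  rw [e, entropyDensity]
  calc _ ≤ r * (r - 1) * (step c δ φ g x ^ (r - 2) *
        (ρ * ∑ j, c j * ‖fderiv ℝ g (φ x + δ j)‖) ^ 2) := by gcongr
    _ = ρ ^ 2 * (r * (r - 1) * (step c δ φ g x ^ (r - 2) *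
        (∑ j, c j * ‖fderiv ℝ g (φ x + δ j)‖) ^ 2)) := by ring
    _ ≤ _ := by gcongr; exact hJ

theorem exists_rpow_taylor_two (r : ℝ) (ha₀ : 0 < a₀) : ∃ C, 0 ≤ C ∧ ∀ x y, a₀ ≤ x → a₀ ≤ y →
    r ≤ 2 →
    |y ^ r - x ^ r - r * x ^ (r - 1) * (y - x) - r * (r - 1) * x ^ (r - 2) * (y - x) ^ 2 / 2| ≤
      C * |y - x| ^ 3 := by
  refine ⟨|r * (r - 1) * (r - 2)| * a₀ ^ (r - 3), by positivity, fun x y hx hy hr => ?_⟩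
  have hpos : ∀ z ∈ Set.uIcc x y, a₀ ≤ z := fun z hz =>
    (le_inf hx hy).trans hz.1
  have hd : ∀ (k z : ℝ), a₀ ≤ z → HasDerivAt (fun t : ℝ => t ^ k) (k * z ^ (k - 1)) z :=
    fun k z hz => Real.hasDerivAt_rpow_const (Or.inl (ha₀.trans_le hz).ne')
  have := abs_taylor_two_le (f := fun z => z ^ r) (f₁ := fun z => r * z ^ (r - 1))
    (f₂ := fun z => r * ((r - 1) * z ^ (r - 1 - 1))) (c := x) (t := y - x)
    (C := |r * (r - 1) * (r - 2)| * a₀ ^ (r - 3)) (by positivity)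
    (fun z hz => hd r z (hpos z (by simpa using hz)))
    (fun z hz => (hd (r - 1) z (hpos z (by simpa using hz))).const_mul r)
    (fun z hz => ?_)
  · rw [add_sub_cancel] at this
    convert this using 2
    rw [show r - 1 - 1 = r - 2 by ring]
    ring
  · rw [add_sub_cancel] at hz
    have hsub : ∀ t ∈ Set.uIcc x z, a₀ ≤ t := fun t ht =>
      (le_inf hx (hpos z hz)).trans ht.1
    have := (convex_uIcc x z).norm_image_sub_le_of_norm_hasDerivWithin_le
      (f := fun z => r * ((r - 1) * z ^ (r - 1 - 1)))
      (f' := fun z => r * ((r - 1) * ((r - 1 - 1) * z ^ (r - 1 - 1 - 1))))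
      (C := |r * (r - 1) * (r - 2)| * a₀ ^ (r - 3))
      (fun t ht => (((hd (r - 1 - 1) t (hsub t ht)).const_mul (r - 1)).const_mul
        r).hasDerivWithinAt) (fun t ht => ?_) Set.left_mem_uIcc Set.right_mem_uIcc
    · simpa using this
    · have e : r * ((r - 1) * ((r - 1 - 1) * t ^ (r - 1 - 1 - 1))) =
          r * (r - 1) * (r - 2) * t ^ (r - 3) := by
        rw [show r - 1 - 1 - 1 = r - 3 by ring]; ring
      have htp := ha₀.trans_le (hsub t ht)
      rw [e, norm_mul, Real.norm_eq_abs, Real.norm_of_nonneg (by positivity)]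
      gcongr ?_ * ?_
      exact Real.rpow_le_rpow_of_nonpos ha₀ (hsub t ht) (by linarith)

set_option maxHeartbeats 800000 in
/-- The local `Φ`-entropy inequality of one step, up to an error of the order of the cube of the
noise. The leading term is the second order Taylor expansion of `Φ` at the mean. -/
theorem exists_step_entropy_le (r L M : ℝ) (hr1 : 1 < r) (hr2 : r ≤ 2) (ha₀ : 0 < a₀)
    (hL : 0 ≤ L) (hM : 0 ≤ M) :
    ∃ C, 0 ≤ C ∧ ∀ {c : ι → ℝ} {δ : ι → F} {φ : F → F} {h s ρ Λ B : ℝ} {g : F → ℝ},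
      IsEulerStep c δ φ h s ρ Λ → 0 ≤ h → h ≤ s ^ 2 → 0 ≤ s → s ≤ 1 → C11Bound B L M g →
      (∀ x, a₀ ≤ g x) → ∀ x,
      step c δ φ (fun y => g y ^ r) x - step c δ φ g x ^ r ≤
        h * step c δ φ (entropyDensity r g) x + C * s ^ 3 := by
  obtain ⟨T, hT0, hT⟩ := exists_rpow_taylor_two r ha₀
  set A := r * (r - 1) * a₀ ^ (r - 2) with hA
  have hrr : 0 ≤ r * (r - 1) := by nlinarith
  have hA0 : 0 ≤ A := by positivity
  refine ⟨A * (3 * L * M + M ^ 2) + T * (2 * L) ^ 3, by positivity, ?_⟩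
  intro c δ φ h s ρ Λ B g H hh hhs hs0 hs1 hg hga x
  set y₀ := φ x
  set m := step c δ φ g x with hm
  set Y : ι → ℝ := fun j => g (y₀ + δ j) with hY
  have hmY : m = ∑ j, c j * Y j := rfl
  have hma : a₀ ≤ m := H.le_step hga x
  have hmpos : 0 < m := ha₀.trans_le hma
  set l := fderiv ℝ g y₀
  set b := ∑ j, c j * ‖fderiv ℝ g (y₀ + δ j)‖ with hb
  -- Deviation from the mean.
  have hdev : ∀ j, |Y j - m| ≤ 2 * L * s := by
    intro j
    have h1 : ∀ k, |Y j - Y k| ≤ 2 * L * s := by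
      intro k
      refine (hg.abs_sub_le _ _).trans ?_
      rw [add_sub_add_left_eq_sub]
      have : ‖δ j - δ k‖ ≤ 2 * s := by
        linarith [norm_sub_le (δ j) (δ k), H.norm_noise_le j, H.norm_noise_le k]
      nlinarith
    rw [abs_le]
    constructor
    · have := H.weighted_le (y := Y) (a := Y j + 2 * L * s)
        (fun k => by linarith [(abs_le.1 (h1 k)).1])
      linarith
    · have := H.le_weighted (y := Y) (a := Y j - 2 * L * s)
        (fun k => by linarith [(abs_le.1 (h1 k)).2])
      linarith
  have hvar0 : ∑ j, c j * (Y j - m) ^ 2 ≤ ∑ j, c j * (Y j - g y₀) ^ 2 := by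
    have e : ∑ j, c j * (Y j - g y₀) ^ 2 = ∑ j, c j * (Y j - m) ^ 2 + (m - g y₀) ^ 2 := by
      have : ∀ j, c j * (Y j - g y₀) ^ 2 = c j * (Y j - m) ^ 2 +
          2 * (m - g y₀) * (c j * Y j) - c j * (2 * (m - g y₀) * m - (m - g y₀) ^ 2) := by
        intro j; ring
      rw [Finset.sum_congr rfl fun j _ => this j, Finset.sum_sub_distrib,
        Finset.sum_add_distrib, ← Finset.mul_sum, ← Finset.sum_mul, H.sum_eq_one, ← hmY]
      ring
    nlinarith [sq_nonneg (m - g y₀)]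
  have hl : ‖l‖ ≤ L := hg.norm_fderiv_le _
  have hlb : ‖l‖ ≤ b + M * s := by
    have : ‖l‖ - M * s ≤ b := H.le_weighted fun j => by
      have h1 := hg.fderiv_lipschitz (y₀ + δ j) y₀
      rw [add_sub_cancel_left] at h1
      have h2 := norm_sub_norm_le l (fderiv ℝ g (y₀ + δ j))
      rw [norm_sub_rev] at h2
      have h3 : M * ‖δ j‖ ≤ M * s := mul_le_mul_of_nonneg_left (H.norm_noise_le j) hM
      linarith
    linarith
  have hb0 : 0 ≤ b := H.le_weighted fun j => norm_nonneg _
  have hbL : b ≤ L := H.weighted_le fun j => hg.norm_fderiv_le _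
  have hl2 : ‖l‖ ^ 2 ≤ b ^ 2 + 2 * L * M * s := by
    have hMs : 0 ≤ M * s := by positivity
    nlinarith [norm_nonneg l]
  have hvar1 : ∑ j, c j * (Y j - g y₀) ^ 2 ≤ 2 * h * ‖l‖ ^ 2 + (2 * L * M + M ^ 2) * s ^ 3 := by
    have h1 : ∀ j, (Y j - g y₀) ^ 2 ≤ (l (δ j)) ^ 2 + (2 * L * M + M ^ 2) * s ^ 3 := by
      intro j
      have ht := hg.abs_taylor_le hM y₀ (δ j)
      have hδ := H.norm_noise_le j
      have ht' : |Y j - g y₀ - l (δ j)| ≤ M * s ^ 2 := ht.trans (by gcongr)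
      have hlδ : |l (δ j)| ≤ L * s :=
        (l.le_opNorm (δ j)).trans (mul_le_mul hl hδ (norm_nonneg _) hL)
      set z := Y j - g y₀ - l (δ j)
      have e : Y j - g y₀ = l (δ j) + z := by simp [z]
      rw [e]
      have h2 : l (δ j) * z ≤ (L * s) * (M * s ^ 2) := by
        calc _ ≤ |l (δ j) * z| := le_abs_self _
          _ = |l (δ j)| * |z| := abs_mul _ _
          _ ≤ _ := mul_le_mul hlδ ht' (abs_nonneg _) (by positivity)
      have h3 : z ^ 2 ≤ (M * s ^ 2) ^ 2 := sq_le_sq' (abs_le.1 ht').1 (abs_le.1 ht').2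
      have h4 : s ^ 4 ≤ s ^ 3 := pow_le_pow_of_le_one hs0 hs1 (by norm_num)
      nlinarith [mul_le_mul_of_nonneg_left h4 (sq_nonneg M)]
    calc _ ≤ ∑ j, (c j * (l (δ j)) ^ 2 + c j * ((2 * L * M + M ^ 2) * s ^ 3)) :=
          Finset.sum_le_sum fun j _ => by
            rw [← mul_add]; exact mul_le_mul_of_nonneg_left (h1 j) (H.nonneg j)
      _ ≤ _ := by
          rw [Finset.sum_add_distrib, ← Finset.sum_mul, H.sum_eq_one, one_mul]
          exact add_le_add_left (H.variance_le l) _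
  have hTay : ∀ j, Y j ^ r ≤ m ^ r + r * m ^ (r - 1) * (Y j - m) +
      r * (r - 1) * m ^ (r - 2) / 2 * (Y j - m) ^ 2 + T * (2 * L * s) ^ 3 := by
    intro j
    have h1 := hT m (Y j) hma (hga _) hr2
    have h2 : T * |Y j - m| ^ 3 ≤ T * (2 * L * s) ^ 3 := by gcongr; exact hdev j
    linarith [(abs_le.1 h1).2]
  have hsum : ∑ j, c j * Y j ^ r ≤ m ^ r +
      r * (r - 1) * m ^ (r - 2) / 2 * ∑ j, c j * (Y j - m) ^ 2 + T * (2 * L * s) ^ 3 := by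
    calc _ ≤ ∑ j, (c j * (m ^ r + T * (2 * L * s) ^ 3 - r * m ^ (r - 1) * m) +
          r * m ^ (r - 1) * (c j * Y j) +
          r * (r - 1) * m ^ (r - 2) / 2 * (c j * (Y j - m) ^ 2)) :=
          Finset.sum_le_sum fun j _ => by
            have := mul_le_mul_of_nonneg_left (hTay j) (H.nonneg j)
            linarith
      _ = _ := by
          rw [Finset.sum_add_distrib, Finset.sum_add_distrib, ← Finset.sum_mul, H.sum_eq_one,
            ← Finset.mul_sum, ← Finset.mul_sum, ← hmY]
          ring
  have hJ := sq_sum_mul_rpow_le (a := Y)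
    (b := fun j => ‖fderiv ℝ g (y₀ + δ j)‖) (q := 2 - r) H.nonneg H.sum_eq_one
    (fun j => ha₀.trans_le (hga _)) (by linarith) (by linarith)
  rw [neg_sub] at hJ
  have eD : step c δ φ (entropyDensity r g) x = r * (r - 1) *
      ∑ j, c j * (Y j ^ (r - 2) * ‖fderiv ℝ g (y₀ + δ j)‖ ^ 2) := by
    rw [step, Finset.mul_sum]
    exact Finset.sum_congr rfl fun j _ => by rw [entropyDensity]; ring
  have hJ' : r * (r - 1) * m ^ (r - 2) * b ^ 2 ≤ step c δ φ (entropyDensity r g) x := by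
    rw [eD, mul_assoc]
    exact mul_le_mul_of_nonneg_left hJ hrr
  have hmA : r * (r - 1) * m ^ (r - 2) ≤ A :=
    mul_le_mul_of_nonneg_left (Real.rpow_le_rpow_of_nonpos ha₀ hma (by linarith)) hrr
  set D := r * (r - 1) * m ^ (r - 2) with hD
  have hD0 : 0 ≤ D := by positivity
  have hs3 : h * s ≤ s ^ 3 := by nlinarith
  have hV : ∑ j, c j * (Y j - m) ^ 2 ≤ 2 * h * b ^ 2 + 2 * (3 * L * M + M ^ 2) * s ^ 3 := by
    have h1 : 2 * h * ‖l‖ ^ 2 ≤ 2 * h * b ^ 2 + 4 * L * M * (h * s) := by nlinarith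
    have h2 : 4 * L * M * (h * s) ≤ 4 * L * M * s ^ 3 := by gcongr
    have h3 : 0 ≤ M ^ 2 * s ^ 3 := by positivity
    linarith
  change ∑ j, c j * Y j ^ r - m ^ r ≤ _
  clear_value D A m b
  generalize step c δ φ (entropyDensity r g) x = S at hJ' ⊢
  generalize ∑ j, c j * (Y j - m) ^ 2 = V at hV hsum
  generalize ∑ j, c j * Y j ^ r = U at hsum ⊢
  have hK : 0 ≤ (3 * L * M + M ^ 2) * s ^ 3 := by positivity
  have h5 : D / 2 * V ≤ D / 2 * (2 * h * b ^ 2 + 2 * (3 * L * M + M ^ 2) * s ^ 3) :=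
    mul_le_mul_of_nonneg_left hV (by positivity)
  have h6 := mul_le_mul_of_nonneg_right hmA hK
  have h7 : h * (D * b ^ 2) ≤ h * S := mul_le_mul_of_nonneg_left hJ' hh
  calc U - m ^ r ≤ D / 2 * V + T * (2 * L * s) ^ 3 := by linarith only [hsum]
    _ ≤ h * (D * b ^ 2) + D * ((3 * L * M + M ^ 2) * s ^ 3) + T * (2 * L * s) ^ 3 := by
      linarith only [h5]
    _ ≤ h * S + A * ((3 * L * M + M ^ 2) * s ^ 3) + T * (2 * L * s) ^ 3 :=
      add_le_add_left (add_le_add h7 h6) _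
    _ = _ := by ring

end Chain

end WeightedGaussian

namespace WeightedGaussian

/-! ### Iterating the chain -/

theorem step_const_mul {F ι : Type*} [NormedAddCommGroup F] [Fintype ι] {c : ι → ℝ} {δ : ι → F}
    {φ : F → F} (a : ℝ) (u : F → ℝ) (x : F) :
    step c δ φ (fun y => a * u y) x = a * step c δ φ u x := by
  simp only [step, Finset.mul_sum]
  exact Finset.sum_congr rfl fun j _ => by ring

theorem step_add {F ι : Type*} [NormedAddCommGroup F] [Fintype ι] {c : ι → ℝ} {δ : ι → F}
    {φ : F → F} (u v : F → ℝ) (x : F) :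
    step c δ φ (fun y => u y + v y) x = step c δ φ u x + step c δ φ v x := by
  simp only [step, mul_add, Finset.sum_add_distrib]

section Iterate

variable {F : Type*} [NormedAddCommGroup F] [NormedSpace ℝ F] {ι : Type*} [Fintype ι]
  {c : ι → ℝ} {δ : ι → F} {φ : F → F} {h s ρ Λ B L M L' M' : ℝ} {u v g : F → ℝ} {r a₀ : ℝ}

theorem C11Bound.mono (hu : C11Bound B L M u) (hL : L ≤ L') (hM : M ≤ M') :
    C11Bound B L' M' u where
  bound := hu.bound
  differentiable := hu.differentiable
  norm_fderiv_le x := (hu.norm_fderiv_le x).trans hL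
  fderiv_lipschitz x y := (hu.fderiv_lipschitz x y).trans (by gcongr)

/-- The contraction makes the second order bound uniform along the chain: the loss `Λ L` in each
step is absorbed by the gain `1 - ρ²`. -/
theorem C11Bound.iterate_step (H : IsEulerStep c δ φ h s ρ Λ) (hρ : ρ ≤ 1) (hΛ : 0 ≤ Λ)
    (hM : 0 ≤ M) (hu : C11Bound B L M u) (hML : Λ * L ≤ (1 - ρ ^ 2) * M) (k : ℕ) :
    C11Bound B (ρ ^ k * L) M ((step c δ φ)^[k] u) := by
  induction k with
  | zero => simpa using hu
  | succ k ih =>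
    rw [Function.iterate_succ_apply']
    refine (ih.markov_step hM H).mono (le_of_eq (by ring)) ?_
    have : Λ * (ρ ^ k * L) ≤ Λ * L := by
      have h1 : ρ ^ k ≤ 1 := pow_le_one₀ H.nonneg_contraction hρ
      have := hu.nonneg_fderiv
      exact mul_le_mul_of_nonneg_left (mul_le_of_le_one_left this h1) hΛ
    linarith

theorem IsEulerStep.le_iterate_step (H : IsEulerStep c δ φ h s ρ Λ) (hg : ∀ x, a₀ ≤ g x) (k : ℕ)
    (x : F) : a₀ ≤ (step c δ φ)^[k] g x := by
  induction k generalizing x with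
  | zero => exact hg x
  | succ k ih =>
    rw [Function.iterate_succ_apply']
    exact H.le_step ih x

theorem IsEulerStep.step_const (H : IsEulerStep c δ φ h s ρ Λ) (a : ℝ) (x : F) :
    step c δ φ (fun _ => a) x = a := by
  simp only [step, ← Finset.sum_mul, H.sum_eq_one, one_mul]

theorem IsEulerStep.entropyDensity_iterate_le (H : IsEulerStep c δ φ h s ρ Λ) (hρ : ρ ≤ 1)
    (hΛ : 0 ≤ Λ) (hM : 0 ≤ M) (hg : C11Bound B L M g) (hML : Λ * L ≤ (1 - ρ ^ 2) * M)
    (hr1 : 1 < r) (hr2 : r ≤ 2) (ha₀ : 0 < a₀) (hga : ∀ x, a₀ ≤ g x) (k : ℕ) (x : F) :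
    entropyDensity r ((step c δ φ)^[k] g) x ≤
      ρ ^ (2 * k) * (step c δ φ)^[k] (entropyDensity r g) x := by
  induction k generalizing x with
  | zero => simp
  | succ k ih =>
    rw [Function.iterate_succ_apply', Function.iterate_succ_apply']
    refine (H.entropyDensity_step_le hr1 hr2 (hg.iterate_step H hρ hΛ hM hML k).differentiable
      (fun x => ha₀.trans_le (H.le_iterate_step hga k x)) x).trans ?_
    have := H.step_mono ih x
    rw [step_const_mul] at this
    calc _ ≤ ρ ^ 2 * (ρ ^ (2 * k) * step c δ φ ((step c δ φ)^[k] (entropyDensity r g)) x) := by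
          gcongr
      _ = _ := by ring

/-- The local entropy inequality telescopes along the chain: after `N` steps the entropy is bounded
by a geometric sum of entropy densities. -/
theorem IsEulerStep.iterate_entropy_le (H : IsEulerStep c δ φ h s ρ Λ) (hρ : ρ ≤ 1)
    (hΛ : 0 ≤ Λ) (hM : 0 ≤ M) (hg : C11Bound B L M g) (hML : Λ * L ≤ (1 - ρ ^ 2) * M)
    (hr1 : 1 < r) (hr2 : r ≤ 2) (ha₀ : 0 < a₀) (hga : ∀ x, a₀ ≤ g x) (hh : 0 ≤ h) {ε : ℝ}
    (hloc : ∀ g, C11Bound B L M g → (∀ x, a₀ ≤ g x) → ∀ x,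
      step c δ φ (fun y => g y ^ r) x - step c δ φ g x ^ r ≤
        h * step c δ φ (entropyDensity r g) x + ε) (N : ℕ) (x : F) :
    (step c δ φ)^[N] (fun y => g y ^ r) x - (step c δ φ)^[N] g x ^ r ≤
      h * (∑ k ∈ Finset.range N, ρ ^ (2 * k)) * (step c δ φ)^[N] (entropyDensity r g) x +
        N * ε := by
  induction N generalizing x with
  | zero => simp
  | succ N ih =>
    have hρ0 := H.nonneg_contraction
    have hgN := hg.iterate_step H hρ hΛ hM hML N
    have h1 := hloc _ (hgN.mono (L' := L)
      (mul_le_of_le_one_left hg.nonneg_fderiv (pow_le_one₀ hρ0 hρ)) le_rfl)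
      (H.le_iterate_step hga N) x
    have h2 := H.step_mono (H.entropyDensity_iterate_le hρ hΛ hM hg hML hr1 hr2 ha₀ hga N) x
    have h3 := H.step_mono (fun y => sub_le_iff_le_add'.1 (ih y)) x
    rw [step_add, step_add, step_const_mul, H.step_const] at h3
    rw [step_const_mul] at h2
    simp only [Function.iterate_succ_apply', Finset.sum_range_succ]
    have h4 := mul_le_mul_of_nonneg_left h2 hh
    push_cast
    linarith

end Iterate

end WeightedGaussian

namespace WeightedGaussian

/-! ### Gaussian bounds for smooth strongly convex potentials -/

theorem integrable_gaussian_weight {n : ℕ} {c : ℝ} (hc : 0 < c) (k : ℕ) :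
    Integrable (fun x : E n => (1 + ‖x‖) ^ k * Real.exp (-c * ‖x‖ ^ 2)) := by
  have h0 : Integrable (fun x : E n => Real.exp (-(c / 2) * ‖x‖ ^ 2)) := by
    have := (GaussianFourier.integrable_cexp_neg_mul_sq_norm_add (V := E n) (b := ((c / 2 : ℝ) : ℂ))
      (by simpa using half_pos hc) 0 0).norm
    refine this.congr (ae_of_all _ fun x => ?_)
    simp only [Complex.norm_exp]
    congr 1
    simp [← Complex.ofReal_pow]
  refine (h0.const_mul (Real.exp (k ^ 2 / (2 * c)))).mono'
    (by fun_prop) (ae_of_all _ fun x => ?_)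
  rw [Real.norm_of_nonneg (by positivity), ← Real.exp_add]
  have h1 : (1 + ‖x‖) ^ k ≤ Real.exp (k * ‖x‖) := by
    rw [Real.exp_nat_mul]
    gcongr
    linarith [Real.add_one_le_exp ‖x‖]
  refine (mul_le_mul_of_nonneg_right h1 (Real.exp_pos _).le).trans ?_
  rw [← Real.exp_add]
  refine Real.exp_le_exp.2 ?_
  have : k * ‖x‖ ≤ k ^ 2 / (2 * c) + c / 2 * ‖x‖ ^ 2 := by
    have e : (k : ℝ) ^ 2 / (2 * c) + c / 2 * ‖x‖ ^ 2 - k * ‖x‖ =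
      (k - c * ‖x‖) ^ 2 / (2 * c) := by field_simp; ring
    have : 0 ≤ (k - c * ‖x‖) ^ 2 / (2 * c) := by positivity
    linarith
  linarith

/-- `W` is convex with gradient `b` and Hessian `H`, all of `b`, `H` and the Lipschitz constant of
`H` being bounded by `A`. Convexity is recorded as monotonicity of the gradient. -/
structure IsConvexPotential {n : ℕ} (A : ℝ) (W : E n → ℝ) (b : E n → E n)
    (H : E n → E n →L[ℝ] E n) : Prop where
  hasFDerivAt : ∀ x, HasFDerivAt W (innerSL ℝ (b x)) x
  hasFDerivAt_gradient : ∀ x, HasFDerivAt b (H x) x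
  norm_gradient_le : ∀ x, ‖b x‖ ≤ A
  norm_hessian_le : ∀ x, ‖H x‖ ≤ A
  hessian_lipschitz : ∀ x y, ‖H x - H y‖ ≤ A * ‖x - y‖
  monotone : ∀ x y, 0 ≤ inner ℝ (b x - b y) (x - y)

/-- The density `exp(-κ|x|²/2 - W(x))`. -/
noncomputable def density {n : ℕ} (κ : ℝ) (W : E n → ℝ) (x : E n) : ℝ :=
  Real.exp (-(κ / 2 * ‖x‖ ^ 2 + W x))

section Density

variable {n : ℕ} {A κ : ℝ} {W : E n → ℝ} {b : E n → E n} {H : E n → E n →L[ℝ] E n}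

theorem density_pos (x : E n) : 0 < density κ W x := Real.exp_pos _

theorem IsConvexPotential.nonneg (hW : IsConvexPotential A W b H) : 0 ≤ A :=
  (norm_nonneg _).trans (hW.norm_gradient_le 0)

theorem IsConvexPotential.hasFDerivAt_density (hW : IsConvexPotential A W b H) (x : E n) :
    HasFDerivAt (density κ W) (-density κ W x • innerSL ℝ (κ • x + b x)) x := by
  have h1 : HasFDerivAt (fun y : E n => ‖y‖ ^ 2) (2 • innerSL ℝ x) x :=
    (hasStrictFDerivAt_norm_sq x).hasFDerivAt
  have := ((h1.const_mul (κ / 2)).add (hW.hasFDerivAt x)).neg.exp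
  refine this.congr_fderiv ?_
  ext v
  simp [density]
  ring

theorem IsConvexPotential.lower_bound (hW : IsConvexPotential A W b H) (y : E n) :
    W 0 - A * ‖y‖ ≤ W y := by
  have := convex_univ.norm_image_sub_le_of_norm_hasFDerivWithin_le (f := W) (C := A) (𝕜 := ℝ)
    (fun z _ => (hW.hasFDerivAt z).hasFDerivWithinAt)
    (fun z _ => by simpa using hW.norm_gradient_le z) (Set.mem_univ (0 : E n)) (Set.mem_univ y)
  rw [sub_zero] at this
  linarith [(abs_le.1 this).1]

theorem IsConvexPotential.exists_density_le (hW : IsConvexPotential A W b H) (hκ : 0 < κ) :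
    ∃ G, 0 ≤ G ∧ ∀ x y : E n, ‖y - x‖ ≤ 1 →
      density κ W y ≤ G * Real.exp (-(κ / 8) * ‖x‖ ^ 2) := by
  refine ⟨Real.exp (-W 0 + A ^ 2 / κ + κ / 4), by positivity, fun x y hxy => ?_⟩
  rw [← Real.exp_add, density]
  gcongr
  have h1 := hW.lower_bound y
  have h2 : A * ‖y‖ ≤ κ / 4 * ‖y‖ ^ 2 + A ^ 2 / κ := by
    have e : κ / 4 * ‖y‖ ^ 2 + A ^ 2 / κ - A * ‖y‖ = (κ * ‖y‖ - 2 * A) ^ 2 / (4 * κ) := by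
      field_simp; ring
    have : 0 ≤ (κ * ‖y‖ - 2 * A) ^ 2 / (4 * κ) := by positivity
    linarith
  have h3 : ‖x‖ ≤ ‖y‖ + 1 := by
    have := norm_sub_norm_le x y
    rw [norm_sub_rev] at this
    linarith
  have h4 : ‖x‖ ^ 2 ≤ 2 * ‖y‖ ^ 2 + 2 := by nlinarith [sq_nonneg (‖y‖ - 1), norm_nonneg x]
  nlinarith

theorem IsConvexPotential.continuous_density (hW : IsConvexPotential A W b H) :
    Continuous (density κ W) :=
  continuous_iff_continuousAt.2 fun x => (hW.hasFDerivAt_density x).continuousAt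

theorem IsConvexPotential.continuous_gradient (hW : IsConvexPotential A W b H) :
    Continuous b :=
  continuous_iff_continuousAt.2 fun x => (hW.hasFDerivAt_gradient x).continuousAt

theorem IsConvexPotential.continuous_hessian (hW : IsConvexPotential A W b H) :
    Continuous H := by
  refine (LipschitzWith.of_dist_le_mul (K := A.toNNReal) fun x y => ?_).continuous
  rw [dist_eq_norm, dist_eq_norm, Real.coe_toNNReal _ hW.nonneg]
  exact hW.hessian_lipschitz x y

theorem IsConvexPotential.integrable_mul_density (hW : IsConvexPotential A W b H) (hκ : 0 < κ)
    {f : E n → ℝ} (hf : Continuous f) {K : ℝ} {k : ℕ} (hfk : ∀ x, |f x| ≤ K * (1 + ‖x‖) ^ k) :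
    Integrable (fun x => f x * density κ W x) := by
  obtain ⟨G, hG0, hG⟩ := hW.exists_density_le hκ
  refine ((integrable_gaussian_weight (n := n) (by positivity : 0 < κ / 8) k).const_mul
    (K * G)).mono' (hf.mul hW.continuous_density).aestronglyMeasurable (ae_of_all _ fun x => ?_)
  rw [norm_mul, Real.norm_eq_abs, Real.norm_of_nonneg (density_pos x).le]
  calc _ ≤ (K * (1 + ‖x‖) ^ k) * (G * Real.exp (-(κ / 8) * ‖x‖ ^ 2)) :=
        mul_le_mul (hfk x) (hG x x (by simp)) (density_pos x).le ((abs_nonneg _).trans (hfk x))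
    _ = _ := by ring

theorem IsConvexPotential.integrable_bounded_mul_density (hW : IsConvexPotential A W b H)
    (hκ : 0 < κ) {f : E n → ℝ} (hf : Continuous f) {K : ℝ} (hfk : ∀ x, |f x| ≤ K) :
    Integrable (fun x => f x * density κ W x) :=
  hW.integrable_mul_density hκ hf (k := 0) (K := K) (by simpa using hfk)

/-- The second derivative of the density in the direction `e`. -/
noncomputable def densitySecond (κ : ℝ) (W : E n → ℝ) (b : E n → E n) (H : E n → E n →L[ℝ] E n)
    (e x : E n) : ℝ :=
  ((inner ℝ (κ • x + b x) e) ^ 2 - (κ * ‖e‖ ^ 2 + inner ℝ (H x e) e)) * density κ W x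

theorem IsConvexPotential.hasFDerivAt_density_first (hW : IsConvexPotential A W b H)
    (e x : E n) : ∃ l : E n →L[ℝ] ℝ, l e = densitySecond κ W b H e x ∧
      HasFDerivAt (fun y => -(inner ℝ (κ • y + b y) e * density κ W y)) l x := by
  have h1 : HasFDerivAt (fun y : E n => κ • y + b y) (κ • ContinuousLinearMap.id ℝ (E n) + H x) x :=
    ((hasFDerivAt_id x).const_smul κ).add (hW.hasFDerivAt_gradient x)
  have h2 := ((h1.inner ℝ (hasFDerivAt_const e x)).mul (hW.hasFDerivAt_density (κ := κ) x)).neg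
  refine ⟨_, ?_, h2⟩
  simp [densitySecond, inner_add_left, inner_smul_left]
  ring

theorem IsConvexPotential.norm_drift_le (hW : IsConvexPotential A W b H) (hκ : 0 < κ) (x : E n) :
    ‖κ • x + b x‖ ≤ (κ + A) * (1 + ‖x‖) := by
  have h2 : ‖κ • x‖ = κ * ‖x‖ := by rw [norm_smul, Real.norm_of_nonneg hκ.le]
  have h3 := hW.norm_gradient_le x
  have h4 := norm_add_le (κ • x) (b x)
  nlinarith [norm_nonneg x, hW.nonneg]

theorem IsConvexPotential.abs_coeff_le (hW : IsConvexPotential A W b H) (hκ : 0 < κ)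
    {e : E n} (he : ‖e‖ = 1) (x : E n) :
    |(inner ℝ (κ • x + b x) e) ^ 2 - (κ * ‖e‖ ^ 2 + inner ℝ (H x e) e)| ≤
      ((κ + A) ^ 2 + (κ + A)) * (1 + ‖x‖) ^ 2 := by
  have hA := hW.nonneg
  have hin : ∀ v : E n, |inner ℝ v e| ≤ ‖v‖ := fun v => by
    simpa [he] using abs_real_inner_le_norm v e
  have hβ := (hin _).trans (hW.norm_drift_le hκ x)
  have hHe : |inner ℝ (H x e) e| ≤ A :=
    (hin _).trans (((H x).le_opNorm e).trans (by simpa [he] using hW.norm_hessian_le x))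
  set β := inner ℝ (κ • x + b x) e
  have h1 : β ^ 2 ≤ ((κ + A) * (1 + ‖x‖)) ^ 2 := sq_le_sq' (abs_le.1 hβ).1 (abs_le.1 hβ).2
  have h2 := abs_le.1 hHe
  have h3 : κ + A ≤ (κ + A) * (1 + ‖x‖) ^ 2 :=
    le_mul_of_one_le_right (by positivity) (one_le_pow₀ (by simp))
  rw [abs_le]
  constructor
  · simp only [he]
    nlinarith [sq_nonneg β, sq_nonneg ((κ + A) * (1 + ‖x‖))]
  · simp only [he]
    nlinarith [sq_nonneg β, sq_nonneg ((κ + A) * (1 + ‖x‖))]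

theorem IsConvexPotential.exists_densitySecond_lipschitz (hW : IsConvexPotential A W b H)
    (hκ : 0 < κ) : ∃ C, 0 ≤ C ∧ ∀ e x y : E n, ‖e‖ = 1 → ‖y - x‖ ≤ 1 →
      |densitySecond κ W b H e y - densitySecond κ W b H e x| ≤
        C * ((1 + ‖x‖) ^ 3 * Real.exp (-(κ / 8) * ‖x‖ ^ 2)) * ‖y - x‖ := by
  obtain ⟨G, hG0, hG⟩ := hW.exists_density_le hκ
  have hA := hW.nonneg
  set R : ℝ := κ + A with hR
  have hR0 : 0 < R := by positivity
  refine ⟨(2 * R * R + A) * G + (R ^ 2 + R) * (R * G), by positivity, fun e x y he hxy => ?_⟩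
  set g := G * Real.exp (-(κ / 8) * ‖x‖ ^ 2) with hg
  have hg0 : 0 ≤ g := by positivity
  set t := 1 + ‖x‖ with ht
  have ht1 : 1 ≤ t := by simp [ht]
  have hball : ∀ z, ‖z - x‖ ≤ 1 → ‖κ • z + b z‖ ≤ R * t := by
    intro z hz
    have h1 : ‖z‖ ≤ t := by
      have := norm_sub_norm_le z x
      linarith
    have h2 := norm_add_le (κ • z) (b z)
    rw [norm_smul, Real.norm_of_nonneg hκ.le] at h2
    nlinarith [hW.norm_gradient_le z]
  -- The density is Lipschitz on the unit ball around `x`.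
  have hm : |density κ W y - density κ W x| ≤ (R * t * g) * ‖y - x‖ := by
    refine (convex_closedBall x 1).norm_image_sub_le_of_norm_hasFDerivWithin_le (𝕜 := ℝ)
      (fun z _ => (hW.hasFDerivAt_density z).hasFDerivWithinAt) (fun z hz => ?_)
      (by simp) (by simpa [dist_eq_norm] using hxy)
    have hz' : ‖z - x‖ ≤ 1 := by simpa [dist_eq_norm] using hz
    rw [norm_smul, norm_neg, Real.norm_of_nonneg (density_pos z).le, innerSL_apply_norm, mul_comm]
    exact mul_le_mul (hball z hz') (hG x z hz') (density_pos z).le (by positivity)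
  have hbl : ‖(κ • y + b y) - (κ • x + b x)‖ ≤ R * ‖y - x‖ := by
    have h1 : ‖b y - b x‖ ≤ A * ‖y - x‖ :=
      convex_univ.norm_image_sub_le_of_norm_hasFDerivWithin_le (𝕜 := ℝ)
        (fun z _ => (hW.hasFDerivAt_gradient z).hasFDerivWithinAt)
        (fun z _ => hW.norm_hessian_le z) (Set.mem_univ x) (Set.mem_univ y)
    have e1 : (κ • y + b y) - (κ • x + b x) = κ • (y - x) + (b y - b x) := by
      rw [smul_sub]; abel
    rw [e1]
    refine (norm_add_le _ _).trans ?_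
    rw [norm_smul, Real.norm_of_nonneg hκ.le]
    linarith
  have hin : ∀ v : E n, |inner ℝ v e| ≤ ‖v‖ := fun v => by
    simpa [he] using abs_real_inner_le_norm v e
  set α := inner ℝ (κ • y + b y) e
  set β := inner ℝ (κ • x + b x) e
  have hα : |α| ≤ R * t := (hin _).trans (hball y hxy)
  have hβ : |β| ≤ R * t := (hin _).trans (hball x (by simp))
  have hαβ : |α - β| ≤ R * ‖y - x‖ := by
    rw [← inner_sub_left]
    exact (hin _).trans hbl
  have hHe : ∀ z, |inner ℝ (H z e) e| ≤ A := fun z =>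
    (hin _).trans (((H z).le_opNorm e).trans (by simpa [he] using hW.norm_hessian_le z))
  have hHd : |inner ℝ (H y e) e - inner ℝ (H x e) e| ≤ A * ‖y - x‖ := by
    rw [← inner_sub_left, ← sub_apply]
    exact (hin _).trans (((H y - H x).le_opNorm e).trans
      (by simpa [he] using hW.hessian_lipschitz y x))
  set p := α ^ 2 - (κ * ‖e‖ ^ 2 + inner ℝ (H y e) e)
  set q := β ^ 2 - (κ * ‖e‖ ^ 2 + inner ℝ (H x e) e)
  have hpq : |p - q| ≤ (2 * R * R + A) * t * ‖y - x‖ := by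
    have e1 : p - q = (α - β) * (α + β) - (inner ℝ (H y e) e - inner ℝ (H x e) e) := by
      simp only [p, q]; ring
    have h1 : |(α - β) * (α + β)| ≤ (R * ‖y - x‖) * (2 * (R * t)) := by
      rw [abs_mul]
      exact mul_le_mul hαβ ((abs_add_le _ _).trans (by linarith)) (abs_nonneg _) (by positivity)
    rw [e1]
    refine (abs_sub _ _).trans ?_
    have h2 : A * ‖y - x‖ ≤ A * ‖y - x‖ * t := le_mul_of_one_le_right (by positivity) ht1
    linarith
  have hq : |q| ≤ (R ^ 2 + R) * t ^ 2 := hW.abs_coeff_le hκ he x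
  have e2 : densitySecond κ W b H e y - densitySecond κ W b H e x =
      (p - q) * density κ W y + q * (density κ W y - density κ W x) := by
    simp only [densitySecond, p, q, α, β]; ring
  rw [e2]
  calc _ ≤ |p - q| * |density κ W y| + |q| * |density κ W y - density κ W x| := by
        rw [← abs_mul, ← abs_mul]; exact abs_add_le _ _
    _ ≤ ((2 * R * R + A) * t * ‖y - x‖) * g +
        ((R ^ 2 + R) * t ^ 2) * ((R * t * g) * ‖y - x‖) := by
        refine add_le_add (mul_le_mul hpq ?_ (abs_nonneg _) (by positivity))
          (mul_le_mul hq hm (abs_nonneg _) (by positivity))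
        rw [abs_of_nonneg (density_pos y).le]
        exact hG x y hxy
    _ ≤ ((2 * R * R + A) * t ^ 3 * ‖y - x‖) * g +
        ((R ^ 2 + R) * t ^ 2) * ((R * t * g) * ‖y - x‖) := by
        gcongr
        exact le_self_pow₀ ht1 (by norm_num)
    _ = _ := by rw [hg]; ring

theorem IsConvexPotential.exists_abs_second_difference_le (hW : IsConvexPotential A W b H)
    (hκ : 0 < κ) : ∃ C, 0 ≤ C ∧ ∀ (e x : E n) (s : ℝ), ‖e‖ = 1 → 0 ≤ s → s ≤ 1 →
      |density κ W (x + s • e) + density κ W (x - s • e) - 2 * density κ W x -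
        s ^ 2 * densitySecond κ W b H e x| ≤
        C * ((1 + ‖x‖) ^ 3 * Real.exp (-(κ / 8) * ‖x‖ ^ 2)) * s ^ 3 := by
  obtain ⟨C, hC0, hC⟩ := hW.exists_densitySecond_lipschitz hκ
  refine ⟨2 * C, by positivity, fun e x s he hs0 hs1 => ?_⟩
  set G := (1 + ‖x‖) ^ 3 * Real.exp (-(κ / 8) * ‖x‖ ^ 2)
  have hline : ∀ t : ℝ, HasDerivAt (fun t : ℝ => x + t • e) e t := fun t => by
    simpa using ((hasDerivAt_id t).smul_const e).const_add x
  have key : ∀ t : ℝ, |t| ≤ 1 → |density κ W (x + t • e) - density κ W x -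
      -(inner ℝ (κ • x + b x) e * density κ W x) * t - densitySecond κ W b H e x * t ^ 2 / 2| ≤
      C * G * |t| ^ 3 := by
    intro t ht
    have := abs_taylor_two_le (f := fun t : ℝ => density κ W (x + t • e))
      (f₁ := fun t : ℝ => -(inner ℝ (κ • (x + t • e) + b (x + t • e)) e *
        density κ W (x + t • e)))
      (f₂ := fun t : ℝ => densitySecond κ W b H e (x + t • e)) (c := 0) (t := t) (C := C * G)
      (by positivity) (fun z _ => ?_) (fun z _ => ?_) (fun z hz => ?_)
    · simpa using this
    · have h1 := (hW.hasFDerivAt_density (κ := κ) (x + z • e)).comp_hasDerivAt z (hline z)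
      refine h1.congr_deriv ?_
      rw [smul_apply, innerSL_apply_apply, smul_eq_mul]
      ring
    · obtain ⟨l, hl, hl'⟩ := hW.hasFDerivAt_density_first (κ := κ) e (x + z • e)
      exact (hl'.comp_hasDerivAt z (hline z)).congr_deriv hl
    · have hz' : |z| ≤ |t| := by simpa using Set.abs_sub_left_of_mem_uIcc hz
      have e1 : ‖x + z • e - x‖ = |z| := by simp [norm_smul, he]
      have := hC e x (x + z • e) he (by rw [e1]; exact hz'.trans ht)
      rw [e1] at this
      simpa only [zero_smul, add_zero, sub_zero] using this
  have h1 := key s (by rwa [abs_of_nonneg hs0])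
  have h2 := key (-s) (by rwa [abs_neg, abs_of_nonneg hs0])
  rw [abs_of_nonneg hs0] at h1
  rw [abs_neg, abs_of_nonneg hs0, neg_smul, ← sub_eq_add_neg] at h2
  have h3 := abs_le.1 h1
  have h4 := abs_le.1 h2
  rw [abs_le]
  constructor <;> linarith [h3.1, h3.2, h4.1, h4.2]

end Density

end WeightedGaussian

namespace WeightedGaussian

/-! ### The Euler scheme and its stationarity defect -/

section Euler

variable {n : ℕ} {A κ : ℝ} {W : E n → ℝ} {b : E n → E n} {H : E n → E n →L[ℝ] E n}
  {h s B L M : ℝ} {u : E n → ℝ}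

/-- The uniform weights on the `2n` noise vectors. -/
noncomputable def noiseWeight (n : ℕ) : Fin n ⊕ Fin n → ℝ := fun _ => (2 * n : ℝ)⁻¹

/-- The noise vectors `± s eᵢ`. -/
noncomputable def noise (n : ℕ) (s : ℝ) : Fin n ⊕ Fin n → E n :=
  Sum.elim (fun i => s • EuclideanSpace.single i 1) (fun i => -(s • EuclideanSpace.single i 1))

/-- The explicit Euler step for the gradient flow of `κ|x|²/2 + W`, where `b = ∇W`. -/
def drift (κ : ℝ) (b : E n → E n) (h : ℝ) (x : E n) : E n := x - h • (κ • x + b x)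

theorem sum_sq_apply_single_le (l : E n →L[ℝ] ℝ) :
    ∑ i, (l (EuclideanSpace.single i 1)) ^ 2 ≤ ‖l‖ ^ 2 := by
  set z := (InnerProductSpace.toDual ℝ (E n)).symm l
  have hz : ∀ v, l v = inner ℝ z v := fun v => by simp [z]
  have hn : ‖z‖ = ‖l‖ := by simp [z]
  rw [← hn, EuclideanSpace.real_norm_sq_eq]
  refine le_of_eq (Finset.sum_congr rfl fun i _ => ?_)
  rw [hz]
  simp [EuclideanSpace.inner_single_right]

theorem IsConvexPotential.hasFDerivAt_drift (hW : IsConvexPotential A W b H) (x : E n) :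
    HasFDerivAt (drift κ b h) (ContinuousLinearMap.id ℝ (E n) -
      h • (κ • ContinuousLinearMap.id ℝ (E n) + H x)) x :=
  (hasFDerivAt_id x).sub
    ((((hasFDerivAt_id x).const_smul κ).add (hW.hasFDerivAt_gradient x)).const_smul h)

theorem IsConvexPotential.gradient_lipschitz (hW : IsConvexPotential A W b H) (x y : E n) :
    ‖b x - b y‖ ≤ A * ‖x - y‖ :=
  convex_univ.norm_image_sub_le_of_norm_hasFDerivWithin_le (𝕜 := ℝ)
    (fun z _ => (hW.hasFDerivAt_gradient z).hasFDerivWithinAt)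
    (fun z _ => hW.norm_hessian_le z) (Set.mem_univ y) (Set.mem_univ x)

/-- The drift contracts by `1 - κh + O(h²)`; this is where the convexity of `W` enters. -/
theorem IsConvexPotential.drift_contracts (hW : IsConvexPotential A W b H) (hh : 0 ≤ h)
    (hhκ : h * κ ≤ 1) (x y : E n) :
    ‖drift κ b h x - drift κ b h y‖ ≤
      Real.sqrt ((1 - h * κ) ^ 2 + h ^ 2 * A ^ 2) * ‖x - y‖ := by
  have e : drift κ b h x - drift κ b h y = (1 - h * κ) • (x - y) - h • (b x - b y) := by
    simp only [drift]; module
  have h1 : ‖drift κ b h x - drift κ b h y‖ ^ 2 ≤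
      ((1 - h * κ) ^ 2 + h ^ 2 * A ^ 2) * ‖x - y‖ ^ 2 := by
    rw [e, norm_sub_sq_real, norm_smul, norm_smul, inner_smul_left, inner_smul_right, mul_pow,
      mul_pow, Real.norm_eq_abs, Real.norm_eq_abs, sq_abs, sq_abs, real_inner_comm]
    have h2 := hW.monotone x y
    have h3 : ‖b x - b y‖ ^ 2 ≤ (A * ‖x - y‖) ^ 2 := by
      gcongr
      exact hW.gradient_lipschitz x y
    have h4 : 0 ≤ (1 - h * κ) * (h * inner ℝ (b x - b y) (x - y)) :=
      mul_nonneg (by linarith) (mul_nonneg hh h2)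
    have h5 : h ^ 2 * ‖b x - b y‖ ^ 2 ≤ h ^ 2 * (A * ‖x - y‖) ^ 2 := by gcongr
    simp only [conj_trivial]
    nlinarith
  refine abs_le_of_sq_le_sq' ?_ (by positivity) |>.2
  rw [mul_pow, Real.sq_sqrt (by positivity)]
  exact h1

theorem isEulerStep_drift (hn : 0 < n) (hW : IsConvexPotential A W b H) (hh : 0 ≤ h)
    (hhκ : h * κ ≤ 1) (hs : 0 ≤ s) (hsh : s ^ 2 = 2 * n * h) :
    IsEulerStep (noiseWeight n) (noise n s) (drift κ b h) h s
      (Real.sqrt ((1 - h * κ) ^ 2 + h ^ 2 * A ^ 2)) (h * A) where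
  nonneg _ := by simp only [noiseWeight]; positivity
  sum_eq_one := by
    have : (n : ℝ) ≠ 0 := by positivity
    simp [noiseWeight]
    field_simp
    norm_num
  norm_noise_le j := by
    rcases j with i | i <;> simp [noise, norm_smul, abs_of_nonneg hs]
  variance_le l := by
    have hn' : (n : ℝ) ≠ 0 := by positivity
    have e : ∑ j, noiseWeight n j * (l (noise n s j)) ^ 2 =
        2 * h * ∑ i, (l (EuclideanSpace.single i 1)) ^ 2 := by
      simp only [Fintype.sum_sum_type, noise, noiseWeight, Sum.elim_inl, Sum.elim_inr, map_neg,
        neg_sq, map_smul, smul_eq_mul, mul_pow, hsh, ← Finset.mul_sum]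
      field_simp
      ring
    rw [e]
    exact mul_le_mul_of_nonneg_left (sum_sq_apply_single_le l) (by positivity)
  differentiable x := (hW.hasFDerivAt_drift x).differentiableAt
  norm_fderiv_le x := by
    refine norm_fderiv_le_of_lip' ℝ (by positivity) (Eventually.of_forall fun y => ?_)
    exact hW.drift_contracts hh hhκ y x
  fderiv_lipschitz x y := by
    rw [(hW.hasFDerivAt_drift x).fderiv, (hW.hasFDerivAt_drift y).fderiv]
    have e : ContinuousLinearMap.id ℝ (E n) - h • (κ • ContinuousLinearMap.id ℝ (E n) + H x) -
        (ContinuousLinearMap.id ℝ (E n) - h • (κ • ContinuousLinearMap.id ℝ (E n) + H y)) =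
        -(h • (H x - H y)) := by module
    rw [e, norm_neg, norm_smul, Real.norm_of_nonneg hh, mul_assoc]
    exact mul_le_mul_of_nonneg_left (hW.hessian_lipschitz x y) hh

theorem C11Bound.continuous_fderiv {F : Type*} [NormedAddCommGroup F] [NormedSpace ℝ F]
    {u : F → ℝ} (hu : C11Bound B L M u) : Continuous (fderiv ℝ u) := by
  refine (LipschitzWith.of_dist_le_mul (K := M.toNNReal) fun x y => ?_).continuous
  rw [dist_eq_norm, dist_eq_norm]
  exact (hu.fderiv_lipschitz x y).trans
    (mul_le_mul_of_nonneg_right (Real.le_coe_toNNReal M) (norm_nonneg _))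

/-- The drift displacement of one step, to first order in the step size. -/
theorem C11Bound.abs_drift_le (hu : C11Bound B L M u) (hM : 0 ≤ M) (x δ v : E n) :
    |u (x + δ - v) - u (x + δ) + fderiv ℝ u x v| ≤ M * ‖v‖ ^ 2 + M * ‖δ‖ * ‖v‖ := by
  have h1 := hu.abs_taylor_le hM (x + δ) (-v)
  rw [← sub_eq_add_neg, map_neg, norm_neg] at h1
  have h2 : |(fderiv ℝ u x - fderiv ℝ u (x + δ)) v| ≤ M * ‖δ‖ * ‖v‖ := by
    refine ((fderiv ℝ u x - fderiv ℝ u (x + δ)).le_opNorm v).trans ?_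
    gcongr
    simpa using hu.fderiv_lipschitz x (x + δ)
  rw [sub_apply] at h2
  have h3 := abs_le.1 h1
  have h4 := abs_le.1 h2
  rw [abs_le]
  constructor <;> linarith [h3.1, h3.2, h4.1, h4.2]

/-- Integration by parts against the density: the Laplacian part of the generator. -/
theorem IsConvexPotential.integral_mul_densitySecond (hW : IsConvexPotential A W b H)
    (hκ : 0 < κ) (hu : C11Bound B L M u) {e : E n} (he : ‖e‖ = 1) :
    Integrable (fun x => u x * densitySecond κ W b H e x) ∧
    ∫ x, u x * densitySecond κ W b H e x =
      ∫ x, fderiv ℝ u x e * inner ℝ (κ • x + b x) e * density κ W x := by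
  have hb := hW.continuous_gradient
  have hH := hW.continuous_hessian
  have hcu := hu.differentiable.continuous
  have hcu' := hu.continuous_fderiv
  have hin : ∀ x, |inner ℝ (κ • x + b x) e| ≤ (κ + A) * (1 + ‖x‖) := fun x =>
    (by simpa [he] using abs_real_inner_le_norm (κ • x + b x) e : _ ≤ _).trans
      (hW.norm_drift_le hκ x)
  have i1 : Integrable (fun x => u x * densitySecond κ W b H e x) := by
    have := hW.integrable_mul_density hκ (f := fun x => u x *
      ((inner ℝ (κ • x + b x) e) ^ 2 - (κ * ‖e‖ ^ 2 + inner ℝ (H x e) e))) (by fun_prop)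
      (K := B * ((κ + A) ^ 2 + (κ + A))) (k := 2) (fun x => by
        rw [abs_mul, mul_assoc]
        exact mul_le_mul (hu.bound x) (hW.abs_coeff_le hκ he x) (abs_nonneg _) hu.nonneg)
    refine this.congr (ae_of_all _ fun x => ?_)
    simp only [densitySecond]; ring
  refine ⟨i1, ?_⟩
  choose l hl hl' using fun x => hW.hasFDerivAt_density_first (κ := κ) e x
  have hfd : ∀ x, fderiv ℝ (fun y => -(inner ℝ (κ • y + b y) e * density κ W y)) x e =
      densitySecond κ W b H e x := fun x => by rw [(hl' x).fderiv, hl]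
  have hbound' : ∀ x, |fderiv ℝ u x e| ≤ L := fun x =>
    ((fderiv ℝ u x).le_opNorm e).trans (by simpa [he] using hu.norm_fderiv_le x)
  have i2 : Integrable (fun x => fderiv ℝ u x e * inner ℝ (κ • x + b x) e * density κ W x) :=
    hW.integrable_mul_density hκ (by fun_prop) (K := L * (κ + A)) (k := 1) (fun x => by
      rw [abs_mul, pow_one, mul_assoc]
      exact mul_le_mul (hbound' x) (hin x) (abs_nonneg _) hu.nonneg_fderiv)
  have i3 : Integrable (fun x => u x * inner ℝ (κ • x + b x) e * density κ W x) :=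
    hW.integrable_mul_density hκ (by fun_prop) (K := B * (κ + A)) (k := 1) (fun x => by
      rw [abs_mul, pow_one, mul_assoc]
      exact mul_le_mul (hu.bound x) (hin x) (abs_nonneg _) hu.nonneg)
  have := integral_mul_fderiv_eq_neg_fderiv_mul_of_integrable (μ := volume) (f := u)
    (g := fun y => -(inner ℝ (κ • y + b y) e * density κ W y)) (v := e)
    (i2.neg.congr (ae_of_all _ fun x => by simp; ring))
    (i1.congr (ae_of_all _ fun x => by simp only [hfd]))
    (i3.neg.congr (ae_of_all _ fun x => by simp; ring))
    (fun x _ => hu.differentiable x) (fun x _ => (hl' x).differentiableAt)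
  simp only [hfd] at this
  rw [this, ← integral_neg]
  exact integral_congr_ae (ae_of_all _ fun x => by simp; ring)

theorem IsConvexPotential.integral_second_difference (hW : IsConvexPotential A W b H)
    (hκ : 0 < κ) (hu : C11Bound B L M u) (v : E n) :
    Integrable (fun x => u x * (density κ W (x + v) + density κ W (x - v) -
      2 * density κ W x)) ∧
    ∫ x, (u (x + v) + u (x - v) - 2 * u x) * density κ W x =
      ∫ x, u x * (density κ W (x + v) + density κ W (x - v) - 2 * density κ W x) := by
  have hcu := hu.differentiable.continuous
  have i0 := hW.integrable_bounded_mul_density hκ hcu hu.bound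
  have i1 := hW.integrable_bounded_mul_density hκ (f := fun x => u (x + v)) (by fun_prop)
    (fun x => hu.bound _)
  have i2 := hW.integrable_bounded_mul_density hκ (f := fun x => u (x - v)) (by fun_prop)
    (fun x => hu.bound _)
  have j1 : Integrable (fun x => u x * density κ W (x - v)) := by
    simpa using i1.comp_sub_right v
  have j2 : Integrable (fun x => u x * density κ W (x + v)) := by
    simpa using i2.comp_add_right v
  have e1 : ∫ x, u (x + v) * density κ W x = ∫ x, u x * density κ W (x - v) := by
    rw [← integral_sub_right_eq_self (fun x => u (x + v) * density κ W x) v]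
    simp
  have e2 : ∫ x, u (x - v) * density κ W x = ∫ x, u x * density κ W (x + v) := by
    rw [← integral_add_right_eq_self (fun x => u (x - v) * density κ W x) v]
    simp
  have f1 : ∀ x, (u (x + v) + u (x - v) - 2 * u x) * density κ W x =
      u (x + v) * density κ W x + u (x - v) * density κ W x - 2 * (u x * density κ W x) :=
    fun x => by ring
  have f2 : ∀ x, u x * (density κ W (x + v) + density κ W (x - v) - 2 * density κ W x) =
      u x * density κ W (x - v) + u x * density κ W (x + v) - 2 * (u x * density κ W x) :=
    fun x => by ring
  simp only [f1, f2]
  refine ⟨(j1.add j2).sub (i0.const_mul 2), ?_⟩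
  have i12 : Integrable (fun x => u (x + v) * density κ W x + u (x - v) * density κ W x) :=
    i1.add i2
  have j12 : Integrable (fun x => u x * density κ W (x - v) + u x * density κ W (x + v)) :=
    j1.add j2
  rw [integral_sub i12 (i0.const_mul 2), integral_sub j12 (i0.const_mul 2),
    integral_add i1 i2, integral_add j1 j2, e1, e2]

theorem IsConvexPotential.exists_integral_second_difference_le (hW : IsConvexPotential A W b H)
    (hκ : 0 < κ) : ∃ C, 0 ≤ C ∧ ∀ {B L M s : ℝ} {u : E n → ℝ} {e : E n}, C11Bound B L M u →
      ‖e‖ = 1 → 0 ≤ s → s ≤ 1 →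
      |(∫ x, (u (x + s • e) + u (x - s • e) - 2 * u x) * density κ W x) -
        s ^ 2 * ∫ x, fderiv ℝ u x e * inner ℝ (κ • x + b x) e * density κ W x| ≤
      C * B * s ^ 3 := by
  obtain ⟨C, hC0, hC⟩ := hW.exists_abs_second_difference_le hκ
  have hint := integrable_gaussian_weight (n := n) (by positivity : 0 < κ / 8) 3
  refine ⟨C * ∫ x : E n, (1 + ‖x‖) ^ 3 * Real.exp (-(κ / 8) * ‖x‖ ^ 2),
    mul_nonneg hC0 (integral_nonneg fun x => by positivity), ?_⟩
  intro B L M s u e hu he hs0 hs1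
  obtain ⟨i1, e1⟩ := hW.integral_second_difference hκ hu (s • e)
  obtain ⟨i2, e2⟩ := hW.integral_mul_densitySecond hκ hu he
  rw [e1, ← e2, ← integral_const_mul, ← integral_sub i1 (i2.const_mul _)]
  rw [← Real.norm_eq_abs]
  calc _ ≤ ∫ x : E n, (C * B * s ^ 3) * ((1 + ‖x‖) ^ 3 * Real.exp (-(κ / 8) * ‖x‖ ^ 2)) := by
        refine norm_integral_le_of_norm_le (hint.const_mul _) (ae_of_all _ fun x => ?_)
        have f : u x * (density κ W (x + s • e) + density κ W (x - s • e) - 2 * density κ W x) -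
            s ^ 2 * (u x * densitySecond κ W b H e x) =
            u x * (density κ W (x + s • e) + density κ W (x - s • e) - 2 * density κ W x -
            s ^ 2 * densitySecond κ W b H e x) := by ring
        rw [f, norm_mul]
        calc _ ≤ B * (C * ((1 + ‖x‖) ^ 3 * Real.exp (-(κ / 8) * ‖x‖ ^ 2)) * s ^ 3) :=
              mul_le_mul (hu.bound x) (hC e x s he hs0 hs1) (abs_nonneg _) hu.nonneg
          _ = _ := by ring
    _ = _ := by rw [integral_const_mul]; ring

/-- One Euler step preserves the measure with density `exp(-κ|x|²/2 - W)` up to an error of the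
order of the cube of the noise. -/
theorem IsConvexPotential.exists_defect_le (hn : 0 < n) (hW : IsConvexPotential A W b H)
    (hκ : 0 < κ) : ∃ K, 0 ≤ K ∧ ∀ {B L M s h : ℝ} {u : E n → ℝ}, C11Bound B L M u → 0 ≤ M →
      0 ≤ h → h * κ ≤ 1 → 0 ≤ s → s ≤ 1 → s ^ 2 = 2 * n * h →
      |∫ x, (step (noiseWeight n) (noise n s) (drift κ b h) u x - u x) * density κ W x| ≤
      K * (B + M) * s ^ 3 := by
  obtain ⟨C, hC0, hC⟩ := hW.exists_integral_second_difference_le hκ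
  have hA := hW.nonneg
  set R := κ + A with hR
  have hR0 : 0 < R := by positivity
  have i0 : Integrable (fun x : E n => (1 + ‖x‖) ^ 2 * density κ W x) :=
    hW.integrable_mul_density hκ (by fun_prop) (K := 1) (k := 2)
      (fun x => by rw [abs_of_nonneg (by positivity), one_mul])
  set I := ∫ x : E n, (1 + ‖x‖) ^ 2 * density κ W x with hI
  have hI0 : 0 ≤ I := integral_nonneg fun x => mul_nonneg (by positivity) (density_pos x).le
  refine ⟨C + 2 * (R ^ 2 + R) * I, by positivity, ?_⟩
  intro B L M s h u hu hM hh hhκ hs0 hs1 hsh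
  have hB := hu.nonneg
  have hn1 : (1 : ℝ) ≤ n := by exact_mod_cast hn
  have hn0 : (n : ℝ) ≠ 0 := by positivity
  have hhs : h ≤ s ^ 2 := by rw [hsh]; nlinarith
  have hE := isEulerStep_drift hn hW hh hhκ hs0 hsh
  have hb := hW.continuous_gradient
  have hcu := hu.differentiable.continuous
  have hcu' := hu.continuous_fderiv
  set e : Fin n → E n := fun i => EuclideanSpace.single i 1 with he
  have he1 : ∀ i, ‖e i‖ = 1 := fun i => by simp [he]
  set P := step (noiseWeight n) (noise n s) (drift κ b h) u with hP
  set v : E n → E n := fun x => κ • x + b x with hv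
  have hcv : Continuous v := by fun_prop
  set D : E n → ℝ := fun x => (2 * n : ℝ)⁻¹ * ∑ i, (u (x + s • e i) + u (x - s • e i) - 2 * u x)
    with hD
  have hPx : ∀ x, P x = (2 * n : ℝ)⁻¹ *
      ∑ i, (u (x + s • e i - h • v x) + u (x - s • e i - h • v x)) := by
    intro x
    simp only [hP, step, Fintype.sum_sum_type, noiseWeight, noise, Sum.elim_inl, Sum.elim_inr,
      drift, Finset.sum_add_distrib, mul_add, Finset.mul_sum]
    congr 1 <;> refine Finset.sum_congr rfl fun i _ => ?_
    · rw [sub_add_eq_add_sub]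
    · rw [← sub_eq_add_neg, sub_right_comm]
  have hpt : ∀ x, |P x - u x - D x + h * fderiv ℝ u x (v x)| ≤
      2 * M * (R ^ 2 + R) * s ^ 3 * (1 + ‖x‖) ^ 2 := by
    intro x
    set t := 1 + ‖x‖
    have ht1 : 1 ≤ t := by simp [t]
    have hvx : ‖v x‖ ≤ R * t := hW.norm_drift_le hκ x
    set β := 2 * M * (R ^ 2 + R) * s ^ 3 * t ^ 2
    have key : ∀ δ : E n, ‖δ‖ = s →
        |u (x + δ - h • v x) - u (x + δ) + h * fderiv ℝ u x (v x)| ≤ β := by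
      intro δ hδ
      have h1 := hu.abs_drift_le hM x δ (h • v x)
      rw [map_smul, smul_eq_mul, hδ, norm_smul, Real.norm_of_nonneg hh] at h1
      refine h1.trans ?_
      have h2 : h * ‖v x‖ ≤ s ^ 2 * (R * t) := mul_le_mul hhs hvx (norm_nonneg _) (by positivity)
      have h3 : (h * ‖v x‖) ^ 2 ≤ (s ^ 2 * (R * t)) ^ 2 := by gcongr
      have h4 : s ^ 4 ≤ s ^ 3 := pow_le_pow_of_le_one hs0 hs1 (by norm_num)
      have h5 : t ≤ t ^ 2 := le_self_pow₀ ht1 (by norm_num)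
      calc _ ≤ M * (s ^ 2 * (R * t)) ^ 2 + M * s * (s ^ 2 * (R * t)) := by gcongr
        _ = M * R ^ 2 * t ^ 2 * s ^ 4 + M * R * s ^ 3 * t := by ring
        _ ≤ M * R ^ 2 * t ^ 2 * s ^ 3 + M * R * s ^ 3 * t ^ 2 := by gcongr
        _ ≤ _ := by
          have : 0 ≤ M * (R ^ 2 + R) * s ^ 3 * t ^ 2 := by positivity
          simp only [β]
          linarith
    have e1 : P x - u x - D x + h * fderiv ℝ u x (v x) = (2 * n : ℝ)⁻¹ * ∑ i,
        ((u (x + s • e i - h • v x) - u (x + s • e i) + h * fderiv ℝ u x (v x)) +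
        (u (x - s • e i - h • v x) - u (x - s • e i) + h * fderiv ℝ u x (v x))) := by
      rw [hPx, hD]
      simp only [Finset.sum_add_distrib, Finset.sum_sub_distrib, Finset.sum_const,
        Finset.card_univ, Fintype.card_fin, nsmul_eq_mul]
      field_simp
      ring
    rw [e1, abs_mul, abs_of_nonneg (by positivity : (0 : ℝ) ≤ (2 * n : ℝ)⁻¹)]
    calc _ ≤ (2 * n : ℝ)⁻¹ * ∑ i : Fin n, 2 * β := by
          gcongr
          refine (Finset.abs_sum_le_sum_abs _ _).trans (Finset.sum_le_sum fun i _ => ?_)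
          refine (abs_add_le _ _).trans ?_
          have h1 := key (s • e i) (by simp [norm_smul, he1, abs_of_nonneg hs0])
          have h2 := key (-(s • e i)) (by simp [norm_smul, he1, abs_of_nonneg hs0])
          rw [← sub_eq_add_neg] at h2
          linarith
      _ = β := by
          simp only [Finset.sum_const, Finset.card_univ, Fintype.card_fin, nsmul_eq_mul]
          field_simp
  -- Integrability of the pieces.
  have hPb := hu.markov_step hM hE
  have iP : Integrable (fun x => (P x - u x) * density κ W x) := by
    refine hW.integrable_bounded_mul_density hκ (K := B + B)
      (hPb.differentiable.continuous.sub hcu) fun x => ?_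
    exact (abs_sub _ _).trans (add_le_add (hPb.bound x) (hu.bound x))
  have iDi : ∀ i, Integrable (fun x => (u (x + s • e i) + u (x - s • e i) - 2 * u x) *
      density κ W x) := by
    intro i
    refine hW.integrable_bounded_mul_density hκ (K := B + B + 2 * B) (by fun_prop) fun x => ?_
    have h1 := abs_le.1 (hu.bound (x + s • e i))
    have h2 := abs_le.1 (hu.bound (x - s • e i))
    have h3 := abs_le.1 (hu.bound x)
    rw [abs_le]
    constructor <;> linarith [h1.1, h1.2, h2.1, h2.2, h3.1, h3.2]
  have iGi : ∀ i, Integrable (fun x => fderiv ℝ u x (e i) * inner ℝ (v x) (e i) *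
      density κ W x) := by
    intro i
    refine hW.integrable_mul_density hκ (by fun_prop) (K := L * R) (k := 1) (fun x => ?_)
    rw [abs_mul, pow_one, mul_assoc]
    refine mul_le_mul (((fderiv ℝ u x).le_opNorm (e i)).trans ?_)
      ((abs_real_inner_le_norm _ _).trans ?_) (abs_nonneg _) hu.nonneg_fderiv
    · simpa [he1] using hu.norm_fderiv_le x
    · simpa [he1] using hW.norm_drift_le hκ x
  have eG : ∀ x, fderiv ℝ u x (v x) * density κ W x =
      ∑ i, fderiv ℝ u x (e i) * inner ℝ (v x) (e i) * density κ W x := by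
    intro x
    rw [← Finset.sum_mul]
    congr 1
    have hvs : v x = ∑ i, (inner ℝ (v x) (e i)) • e i := by
      conv_lhs => rw [← (EuclideanSpace.basisFun (Fin n) ℝ).sum_repr (v x)]
      refine Finset.sum_congr rfl fun i _ => ?_
      simp [he, EuclideanSpace.inner_single_right]
    conv_lhs => rw [hvs]
    rw [map_sum]
    exact Finset.sum_congr rfl fun i _ => by rw [map_smul, smul_eq_mul, mul_comm]
  have eD : ∀ x, D x * density κ W x = (2 * n : ℝ)⁻¹ *
      ∑ i, (u (x + s • e i) + u (x - s • e i) - 2 * u x) * density κ W x := by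
    intro x; rw [← Finset.sum_mul]; simp only [hD]; ring
  have iG : Integrable (fun x => fderiv ℝ u x (v x) * density κ W x) := by
    simp only [eG]; exact integrable_finsetSum _ fun i _ => iGi i
  have iD : Integrable (fun x => D x * density κ W x) := by
    simp only [eD]; exact (integrable_finsetSum _ fun i _ => iDi i).const_mul _
  have hsplit : ∫ x, (P x - u x) * density κ W x =
      (∫ x, (P x - u x - D x + h * fderiv ℝ u x (v x)) * density κ W x) +
      ((∫ x, D x * density κ W x) - h * ∫ x, fderiv ℝ u x (v x) * density κ W x) := by
    have : ∀ x, (P x - u x - D x + h * fderiv ℝ u x (v x)) * density κ W x =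
        (P x - u x) * density κ W x - D x * density κ W x +
          h * (fderiv ℝ u x (v x) * density κ W x) := fun x => by ring
    simp only [this]
    have iPD : Integrable (fun x => (P x - u x) * density κ W x - D x * density κ W x) :=
      iP.sub iD
    rw [integral_add iPD (iG.const_mul h), integral_sub iP iD, integral_const_mul]
    ring
  have b1 : |∫ x, (P x - u x - D x + h * fderiv ℝ u x (v x)) * density κ W x| ≤
      2 * M * (R ^ 2 + R) * s ^ 3 * I := by
    rw [hI, ← integral_const_mul, ← Real.norm_eq_abs]
    refine norm_integral_le_of_norm_le (i0.const_mul _) (ae_of_all _ fun x => ?_)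
    rw [norm_mul, Real.norm_eq_abs, Real.norm_of_nonneg (density_pos x).le, ← mul_assoc]
    exact mul_le_mul_of_nonneg_right (hpt x) (density_pos x).le
  have b2 : |(∫ x, D x * density κ W x) - h * ∫ x, fderiv ℝ u x (v x) * density κ W x| ≤
      C * B * s ^ 3 := by
    simp only [eD, eG]
    rw [integral_const_mul, integral_finsetSum _ fun i _ => iDi i,
      integral_finsetSum _ fun i _ => iGi i]
    have e1 : ∀ a c : Fin n → ℝ, (2 * n : ℝ)⁻¹ * ∑ i, a i - h * ∑ i, c i =
        (2 * n : ℝ)⁻¹ * ∑ i, (a i - s ^ 2 * c i) := by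
      intro a c
      rw [Finset.sum_sub_distrib, ← Finset.mul_sum, hsh]
      field_simp
    rw [e1, abs_mul, abs_of_nonneg (by positivity : (0 : ℝ) ≤ (2 * n : ℝ)⁻¹)]
    calc _ ≤ (2 * n : ℝ)⁻¹ * ∑ i : Fin n, C * B * s ^ 3 := by
          gcongr
          refine (Finset.abs_sum_le_sum_abs _ _).trans (Finset.sum_le_sum fun i _ => ?_)
          exact hC hu (he1 i) hs0 hs1
      _ = C * B * s ^ 3 / 2 := by
          simp only [Finset.sum_const, Finset.card_univ, Fintype.card_fin, nsmul_eq_mul]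
          field_simp
      _ ≤ C * B * s ^ 3 := half_le_self (by positivity)
  rw [hsplit]
  calc _ ≤ 2 * M * (R ^ 2 + R) * s ^ 3 * I + C * B * s ^ 3 :=
        (abs_add_le _ _).trans (add_le_add b1 b2)
    _ ≤ _ := by
      have h1 : 0 ≤ C * M * s ^ 3 := by positivity
      have h2 : 0 ≤ 2 * B * (R ^ 2 + R) * s ^ 3 * I := by positivity
      linarith

end Euler

end WeightedGaussian

namespace WeightedGaussian

/-! ### The entropy inequality for smooth potentials -/

/-- The expectation with respect to the probability measure proportional to
`exp(-κ|x|²/2 - W)`. -/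
noncomputable def expect {n : ℕ} (κ : ℝ) (W : E n → ℝ) (f : E n → ℝ) : ℝ :=
  (∫ x, f x * density κ W x) / ∫ x, density κ W x

section Expect

variable {n : ℕ} {A κ : ℝ} {W : E n → ℝ} {b : E n → E n} {H : E n → E n →L[ℝ] E n}
  {B L M r a₀ : ℝ} {u g : E n → ℝ} {f f₁ f₂ : E n → ℝ}

theorem IsConvexPotential.integrable_density (hW : IsConvexPotential A W b H) (hκ : 0 < κ) :
    Integrable (density κ W) := by
  simpa using hW.integrable_bounded_mul_density hκ (f := fun _ => 1) (K := 1) (by fun_prop)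
    (by simp)

theorem IsConvexPotential.integral_density_pos (hW : IsConvexPotential A W b H) (hκ : 0 < κ) :
    0 < ∫ x, density κ W x := by
  rw [integral_pos_iff_support_of_nonneg (fun x => (density_pos x).le) (hW.integrable_density hκ)]
  have : Function.support (density κ W) = Set.univ :=
    Set.eq_univ_of_forall fun x => (density_pos x).ne'
  rw [this]
  exact Measure.measure_univ_pos.2 (NeZero.ne _)

theorem IsConvexPotential.expect_mono (hW : IsConvexPotential A W b H) (hκ : 0 < κ)
    (h1 : Integrable (fun x => f₁ x * density κ W x))
    (h2 : Integrable (fun x => f₂ x * density κ W x)) (h : ∀ x, f₁ x ≤ f₂ x) :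
    expect κ W f₁ ≤ expect κ W f₂ :=
  div_le_div_of_nonneg_right
    (integral_mono h1 h2 fun x => mul_le_mul_of_nonneg_right (h x) (density_pos x).le)
    (hW.integral_density_pos hκ).le

theorem expect_add (h1 : Integrable (fun x => f₁ x * density κ W x))
    (h2 : Integrable (fun x => f₂ x * density κ W x)) :
    expect κ W (fun x => f₁ x + f₂ x) = expect κ W f₁ + expect κ W f₂ := by
  simp only [expect, add_mul]
  rw [integral_add h1 h2, add_div]

theorem expect_const_mul (c : ℝ) : expect κ W (fun x => c * f x) = c * expect κ W f := by
  simp only [expect, mul_assoc]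
  rw [integral_const_mul, mul_div_assoc]

theorem IsConvexPotential.expect_const (hW : IsConvexPotential A W b H) (hκ : 0 < κ) (c : ℝ) :
    expect κ W (fun _ => c) = c := by
  simp only [expect]
  rw [integral_const_mul, mul_div_cancel_right₀ _ (hW.integral_density_pos hκ).ne']

theorem C11Bound.integrable (hu : C11Bound B L M u) (hW : IsConvexPotential A W b H)
    (hκ : 0 < κ) : Integrable (fun x => u x * density κ W x) :=
  hW.integrable_bounded_mul_density hκ hu.differentiable.continuous hu.bound

/-- The invariance defects of the single steps add up, because the `C^{1,1}` bounds are uniform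
along the chain. -/
theorem IsConvexPotential.exists_iterate_defect_le (hn : 0 < n) (hW : IsConvexPotential A W b H)
    (hκ : 0 < κ) : ∃ K, 0 ≤ K ∧ ∀ {B L M s h ρ : ℝ} {u : E n → ℝ}, C11Bound B L M u → 0 ≤ M →
      0 ≤ h → h * κ ≤ 1 → 0 ≤ s → s ≤ 1 → s ^ 2 = 2 * n * h →
      ρ = Real.sqrt ((1 - h * κ) ^ 2 + h ^ 2 * A ^ 2) → ρ ≤ 1 →
      h * A * L ≤ (1 - ρ ^ 2) * M → ∀ N : ℕ,
      |expect κ W ((step (noiseWeight n) (noise n s) (drift κ b h))^[N] u) - expect κ W u| ≤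
        N * (K * (B + M) * s ^ 3) := by
  obtain ⟨K, hK0, hK⟩ := hW.exists_defect_le hn hκ
  have hZ := hW.integral_density_pos hκ
  refine ⟨K / ∫ x, density κ W x, by positivity, ?_⟩
  intro B L M s h ρ u hu hM hh hhκ hs0 hs1 hsh hρ hρ1 hML N
  have hE := isEulerStep_drift hn hW hh hhκ hs0 hsh
  rw [← hρ] at hE
  induction N with
  | zero => simp
  | succ N ih =>
    have hN := hu.iterate_step hE hρ1 (mul_nonneg hh hW.nonneg) hM hML N
    have hN1 := hu.iterate_step hE hρ1 (mul_nonneg hh hW.nonneg) hM hML (N + 1)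
    have h1 := hK hN hM hh hhκ hs0 hs1 hsh
    rw [Function.iterate_succ_apply'] at hN1 ⊢
    set v := (step (noiseWeight n) (noise n s) (drift κ b h))^[N] u
    set w := step (noiseWeight n) (noise n s) (drift κ b h) v
    have h2 : expect κ W w - expect κ W v =
        (∫ x, (w x - v x) * density κ W x) / ∫ x, density κ W x := by
      simp only [expect, sub_mul]
      rw [integral_sub (hN1.integrable hW hκ) (hN.integrable hW hκ), sub_div]
    have h3 : |expect κ W w - expect κ W v| ≤
        K / (∫ x, density κ W x) * (B + M) * s ^ 3 := by
      rw [h2, abs_div, abs_of_pos hZ, div_le_iff₀ hZ]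
      refine h1.trans (le_of_eq ?_)
      field_simp
    have h4 := abs_add_le (expect κ W w - expect κ W v) (expect κ W v - expect κ W u)
    rw [sub_add_sub_cancel] at h4
    push_cast
    linarith

theorem abs_rpow_sub_rpow_le {r x y B : ℝ} (hr : 1 ≤ r) (hx : 0 ≤ x) (hxB : x ≤ B) (hy : 0 ≤ y)
    (hyB : y ≤ B) : |x ^ r - y ^ r| ≤ r * B ^ (r - 1) * |x - y| := by
  refine (convex_Icc 0 B).norm_image_sub_le_of_norm_hasDerivWithin_le (f := fun t : ℝ => t ^ r)
    (fun t _ => (Real.hasDerivAt_rpow_const (Or.inr hr)).hasDerivWithinAt) (fun t ht => ?_)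
    ⟨hy, hyB⟩ ⟨hx, hxB⟩
  have h0 := ht.1
  rw [Real.norm_of_nonneg (by positivity)]
  gcongr
  exact ht.2

set_option maxHeartbeats 1000000 in
/-- The entropy inequality up to the discretization error of the Euler scheme with step size `h`
run for `N` steps. -/
theorem IsConvexPotential.exists_entropy_error (hn : 0 < n) (hW : IsConvexPotential A W b H)
    (hκ : 0 < κ) (hr1 : 1 < r) (hr2 : r ≤ 2) (ha₀ : 0 < a₀) (hM : 0 ≤ M)
    (hg : C11Bound B L M g) (hga : ∀ x, a₀ ≤ g x) {B₁ L₁ M₁ B₂ L₂ M₂ : ℝ} (hM₁ : 0 ≤ M₁)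
    (hM₂ : 0 ≤ M₂) (hΦ : C11Bound B₁ L₁ M₁ fun x => g x ^ r)
    (hΨ : C11Bound B₂ L₂ M₂ (entropyDensity r g)) :
    ∃ K₁ K₂ : ℝ, ∀ (h : ℝ) (N : ℕ), 0 < h → h * κ ≤ 1 → (κ ^ 2 + A ^ 2) * h ≤ κ →
      Real.sqrt (2 * n * h) ≤ 1 →
      expect κ W (fun x => g x ^ r) - expect κ W g ^ r ≤
        1 / (2 * κ - (κ ^ 2 + A ^ 2) * h) * expect κ W (entropyDensity r g) +
        K₁ * (N * Real.sqrt (2 * n * h) ^ 3) + K₂ * Real.exp (-(κ / 2) * (h * N)) := by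
  obtain ⟨K, hK0, hK⟩ := hW.exists_iterate_defect_le hn hκ
  have hA := hW.nonneg
  have hL := hg.nonneg_fderiv
  have hB := hg.nonneg
  have hL₁ := hΦ.nonneg_fderiv
  have hL₂ := hΨ.nonneg_fderiv
  have hB₂ := hΨ.nonneg
  set M' := M + A * L / κ with hM'
  set M₁' := M₁ + A * L₁ / κ with hM₁'
  set M₂' := M₂ + A * L₂ / κ with hM₂'
  obtain ⟨C, hC0, hC⟩ := exists_step_entropy_le (ι := Fin n ⊕ Fin n) (F := E n) r L M' hr1 hr2 ha₀
    hL (by positivity)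
  set T := r * B ^ (r - 1) with hT
  have hT0 : 0 ≤ T := by positivity
  set X := expect κ W (fun x => ‖x‖) with hX
  have iX : Integrable (fun x : E n => ‖x‖ * density κ W x) :=
    hW.integrable_mul_density hκ (by fun_prop) (K := 1) (k := 1) (fun x => by simp)
  refine ⟨C + K * (B₁ + M₁') + T * (K * (B + M')) + 1 / κ * (K * (B₂ + M₂')), T * (2 * L * X), ?_⟩
  intro h N hh hhκ hhA hs1
  set s := Real.sqrt (2 * n * h) with hs
  have hs0 : 0 ≤ s := Real.sqrt_nonneg _
  have hsh : s ^ 2 = 2 * n * h := Real.sq_sqrt (by positivity)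
  have hn1 : (1 : ℝ) ≤ n := by exact_mod_cast hn
  have hhs : h ≤ s ^ 2 := by rw [hsh]; nlinarith
  set ρ := Real.sqrt ((1 - h * κ) ^ 2 + h ^ 2 * A ^ 2) with hρ
  have hρ0 : 0 ≤ ρ := Real.sqrt_nonneg _
  have hρsq : 1 - ρ ^ 2 = h * (2 * κ - (κ ^ 2 + A ^ 2) * h) := by
    rw [hρ, Real.sq_sqrt (by positivity)]; ring
  have hgap : κ ≤ 2 * κ - (κ ^ 2 + A ^ 2) * h := by linarith
  have hρ2 : h * κ ≤ 1 - ρ ^ 2 := by rw [hρsq]; gcongr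
  have hhκ0 : 0 < h * κ := by positivity
  have hρ1 : ρ ≤ 1 := by
    refine (sq_le_sq₀ hρ0 zero_le_one).1 ?_
    linarith
  have hE := isEulerStep_drift hn hW hh.le hhκ hs0 hsh
  rw [← hρ] at hE
  have habs : ∀ l m : ℝ, 0 ≤ l → 0 ≤ m → h * A * l ≤ (1 - ρ ^ 2) * (m + A * l / κ) := by
    intro l m hl hm
    calc h * A * l = (h * κ) * (A * l / κ) := by field_simp
      _ ≤ (1 - ρ ^ 2) * (m + A * l / κ) := by
        gcongr
        · linarith
        · linarith
  have hle : ∀ l m : ℝ, 0 ≤ l → m ≤ m + A * l / κ := fun l m hl => by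
    have : 0 ≤ A * l / κ := by positivity
    linarith
  have hg' := hg.mono le_rfl (hle L M hL)
  have hΦ' := hΦ.mono le_rfl (hle L₁ M₁ hL₁)
  have hΨ' := hΨ.mono le_rfl (hle L₂ M₂ hL₂)
  have hΛ : 0 ≤ h * A := by positivity
  have pg := hg'.iterate_step hE hρ1 hΛ (by positivity) (habs L M hL hM) N
  have pΦ := hΦ'.iterate_step hE hρ1 hΛ (by positivity) (habs L₁ M₁ hL₁ hM₁) N
  have pΨ := hΨ'.iterate_step hE hρ1 hΛ (by positivity) (habs L₂ M₂ hL₂ hM₂) N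
  have dg := hK hg' (by positivity) hh.le hhκ hs0 hs1 hsh hρ hρ1 (habs L M hL hM) N
  have dΦ := hK hΦ' (by positivity) hh.le hhκ hs0 hs1 hsh hρ hρ1 (habs L₁ M₁ hL₁ hM₁) N
  have dΨ := hK hΨ' (by positivity) hh.le hhκ hs0 hs1 hsh hρ hρ1 (habs L₂ M₂ hL₂ hM₂) N
  have hent := hE.iterate_entropy_le hρ1 hΛ (by positivity) hg' (habs L M hL hM) hr1 hr2 ha₀ hga
    hh.le (ε := C * s ^ 3)
    (fun g hg hga x => hC hE hh.le hhs hs0 hs1 hg hga x) N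
  have hlow := hE.le_iterate_step hga N
  set P := step (noiseWeight n) (noise n s) (drift κ b h)
  set S := ∑ k ∈ Finset.range N, ρ ^ (2 * k)
  have hS : h * S ≤ 1 / (2 * κ - (κ ^ 2 + A ^ 2) * h) := by
    have h1 : S * (1 - ρ ^ 2) ≤ 1 := by
      have := geom_sum_mul_neg (ρ ^ 2) N
      simp only [← pow_mul] at this
      rw [this]
      have : 0 ≤ ρ ^ (2 * N) := by positivity
      linarith
    rw [le_div_iff₀ (by linarith)]
    calc _ = S * (1 - ρ ^ 2) := by rw [hρsq]; ring
      _ ≤ 1 := h1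
  have hS0 : 0 ≤ h * S := mul_nonneg hh.le (Finset.sum_nonneg fun k _ => by positivity)
  have hρN : ρ ^ N ≤ Real.exp (-(κ / 2) * (h * N)) := by
    have h1 : ρ ≤ Real.exp (-(κ / 2) * h) := by
      refine (sq_le_sq₀ hρ0 (Real.exp_pos _).le).1 ?_
      rw [← Real.exp_nat_mul]
      have := Real.add_one_le_exp (((2 : ℕ) : ℝ) * (-(κ / 2) * h))
      push_cast at this ⊢
      linarith
    calc ρ ^ N ≤ Real.exp (-(κ / 2) * h) ^ N := by gcongr
      _ = _ := by rw [← Real.exp_nat_mul]; ring_nf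
  -- The final function is nearly constant.
  set G := expect κ W g with hG
  have hgB : ∀ x, g x ≤ B := fun x => (abs_le.1 (hg.bound x)).2
  have hG0 : 0 ≤ G := by
    have := hW.expect_mono hκ (f₁ := fun _ => 0) (by simp) (hg.integrable hW hκ)
      (fun x => ha₀.le.trans (hga x))
    rwa [hW.expect_const hκ] at this
  have hGB : G ≤ B := by
    have := hW.expect_mono hκ (f₂ := fun _ => B) (hg.integrable hW hκ)
      ((hW.integrable_density hκ).const_mul B) hgB
    rwa [hW.expect_const hκ] at this
  have hosc : ∀ x, |(P^[N] g) x - (P^[N] g) 0| ≤ ρ ^ N * L * ‖x‖ := fun x => by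
    simpa using pg.abs_sub_le x 0
  have hmean : |(P^[N] g) 0 - expect κ W (P^[N] g)| ≤ ρ ^ N * L * X := by
    have i1 : Integrable (fun x => (ρ ^ N * L * ‖x‖) * density κ W x) := by
      simpa [mul_assoc] using iX.const_mul (ρ ^ N * L)
    have i2 : Integrable (fun x => (P^[N] g) 0 * density κ W x) :=
      (hW.integrable_density hκ).const_mul _
    have h1 := hW.expect_mono hκ (f₂ := fun x => (P^[N] g) 0 + ρ ^ N * L * ‖x‖)
      (pg.integrable hW hκ)
      (by simp only [add_mul]; exact i2.add i1) (fun x => by linarith [(abs_le.1 (hosc x)).2])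
    have h2 := hW.expect_mono hκ (f₁ := fun x => (P^[N] g) 0 + (-(ρ ^ N * L)) * ‖x‖)
      (f₂ := P^[N] g)
      (by simp only [add_mul, neg_mul]; exact i2.add i1.neg) (pg.integrable hW hκ)
      (fun x => by linarith [(abs_le.1 (hosc x)).1])
    rw [expect_add i2 i1, hW.expect_const hκ, expect_const_mul] at h1
    rw [expect_add i2 (by simp only [neg_mul]; exact i1.neg), hW.expect_const hκ,
      expect_const_mul] at h2
    rw [abs_le]
    constructor <;> linarith
  have hX0 : 0 ≤ X := div_nonneg
    (integral_nonneg fun x => mul_nonneg (norm_nonneg _) (density_pos x).le)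
    (hW.integral_density_pos hκ).le
  have hpow : ∀ x, (P^[N] g) x ^ r ≤ (G ^ r + T * (ρ ^ N * L * X + N * (K * (B + M') * s ^ 3))) +
      T * (ρ ^ N * L) * ‖x‖ := by
    intro x
    have h1 := abs_rpow_sub_rpow_le hr1.le (ha₀.le.trans (hlow x))
      (abs_le.1 (pg.bound x)).2 hG0 hGB
    have h2 : |(P^[N] g) x - G| ≤
        ρ ^ N * L * ‖x‖ + ρ ^ N * L * X + N * (K * (B + M') * s ^ 3) := by
      have h3 := abs_le.1 (hosc x)
      have h4 := abs_le.1 hmean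
      have h5 := abs_le.1 dg
      rw [abs_le]
      constructor <;> linarith [h3.1, h3.2, h4.1, h4.2, h5.1, h5.2]
    have h3 := mul_le_mul_of_nonneg_left h2 hT0
    have h4 := (abs_le.1 h1).2
    linarith
  have hfinal : ∀ x, (P^[N] fun y => g y ^ r) x ≤
      ((G ^ r + T * (ρ ^ N * L * X + N * (K * (B + M') * s ^ 3)) + N * (C * s ^ 3)) +
      T * (ρ ^ N * L) * ‖x‖) + h * S * (P^[N] (entropyDensity r g)) x := by
    intro x
    linarith [hent x, hpow x]
  set Q := G ^ r + T * (ρ ^ N * L * X + N * (K * (B + M') * s ^ 3)) + N * (C * s ^ 3) with hQ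
  have i1 : Integrable (fun x : E n => Q * density κ W x) :=
    (hW.integrable_density hκ).const_mul _
  have i2 : Integrable (fun x => (T * (ρ ^ N * L) * ‖x‖) * density κ W x) := by
    simpa only [mul_assoc] using iX.const_mul (T * (ρ ^ N * L))
  have i12 : Integrable (fun x => (Q + T * (ρ ^ N * L) * ‖x‖) * density κ W x) := by
    simp only [add_mul]; exact i1.add i2
  have i3 : Integrable (fun x => (h * S * (P^[N] (entropyDensity r g)) x) * density κ W x) := by
    simpa only [mul_assoc] using (pΨ.integrable hW hκ).const_mul (h * S)
  have hint := hW.expect_mono hκ (pΦ.integrable hW hκ)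
    (by simp only [add_mul _ (h * S * _)]; exact i12.add i3) hfinal
  rw [expect_add i12 i3, expect_add i1 i2, hW.expect_const hκ, expect_const_mul,
    expect_const_mul, ← hX] at hint
  have hΨ0 : 0 ≤ expect κ W (entropyDensity r g) := by
    have := hW.expect_mono hκ (f₁ := fun _ => 0) (by simp) (hΨ.integrable hW hκ)
      (fun x => by
        have h1 : 0 ≤ g x := ha₀.le.trans (hga x)
        have h2 : 0 ≤ r * (r - 1) := by nlinarith
        simp only [entropyDensity]
        positivity)
    rwa [hW.expect_const hκ] at this
  have hS1 : h * S ≤ 1 / κ := hS.trans (one_div_le_one_div_of_le hκ hgap)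
  have e2 : T * (2 * L * X) * ρ ^ N ≤ T * (2 * L * X) * Real.exp (-(κ / 2) * (h * N)) :=
    mul_le_mul_of_nonneg_left hρN (by positivity)
  have e3 := (abs_le.1 dΦ).1
  have e4 := (abs_le.1 dΨ).2
  have hδ : 0 ≤ N * (K * (B₂ + M₂') * s ^ 3) := by positivity
  generalize expect κ W (P^[N] (entropyDensity r g)) = Y at hint e4
  generalize expect κ W (P^[N] fun y => g y ^ r) = Y₁ at hint e3
  generalize expect κ W (entropyDensity r g) = Z at hΨ0 e4 ⊢
  generalize expect κ W (fun x => g x ^ r) = Z₁ at e3 ⊢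
  have e1 : h * S * Y ≤ 1 / (2 * κ - (κ ^ 2 + A ^ 2) * h) * Z +
      1 / κ * (N * (K * (B₂ + M₂') * s ^ 3)) := by
    have h1 := mul_le_mul_of_nonneg_left (sub_le_iff_le_add'.1 e4) hS0
    rw [mul_add] at h1
    exact h1.trans (add_le_add (mul_le_mul_of_nonneg_right hS hΨ0)
      (mul_le_mul_of_nonneg_right hS1 hδ))
  rw [hQ] at hint
  linarith only [hint, e1, e2, e3]

/-- The sharp `Φ`-entropy inequality, `Φ(x) = x ^ r`, for a smooth `κ`-convex potential. -/
theorem IsConvexPotential.entropy_le (hn : 0 < n) (hW : IsConvexPotential A W b H)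
    (hκ : 0 < κ) (hr1 : 1 < r) (hr2 : r ≤ 2) (ha₀ : 0 < a₀) (hM : 0 ≤ M)
    (hg : C11Bound B L M g) (hga : ∀ x, a₀ ≤ g x) {B₁ L₁ M₁ B₂ L₂ M₂ : ℝ} (hM₁ : 0 ≤ M₁)
    (hM₂ : 0 ≤ M₂) (hΦ : C11Bound B₁ L₁ M₁ fun x => g x ^ r)
    (hΨ : C11Bound B₂ L₂ M₂ (entropyDensity r g)) :
    expect κ W (fun x => g x ^ r) - expect κ W g ^ r ≤
      1 / (2 * κ) * expect κ W (entropyDensity r g) := by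
  obtain ⟨K₁, K₂, hK⟩ := hW.exists_entropy_error hn hκ hr1 hr2 ha₀ hM hg hga hM₁ hM₂ hΦ hΨ
  -- With `h = q⁻⁴` and `N = q⁵` the time `h N` tends to infinity while `N h^{3/2}` tends to `0`.
  have hq : Tendsto (fun q : ℕ => (q : ℝ)⁻¹) atTop (𝓝 0) := tendsto_inv_atTop_nhds_zero_nat
  have hh : Tendsto (fun q : ℕ => ((q : ℝ)⁻¹) ^ 4) atTop (𝓝 0) := by simpa using hq.pow 4
  have hlim : Tendsto (fun q : ℕ =>
      1 / (2 * κ - (κ ^ 2 + A ^ 2) * ((q : ℝ)⁻¹) ^ 4) * expect κ W (entropyDensity r g) +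
      K₁ * (Real.sqrt (2 * n) ^ 3 * (q : ℝ)⁻¹) + K₂ * Real.exp (-(κ / 2) * q)) atTop
      (𝓝 (1 / (2 * κ) * expect κ W (entropyDensity r g))) := by
    have t1 : Tendsto (fun q : ℕ => 1 / (2 * κ - (κ ^ 2 + A ^ 2) * ((q : ℝ)⁻¹) ^ 4)) atTop
        (𝓝 (1 / (2 * κ - (κ ^ 2 + A ^ 2) * 0))) :=
      tendsto_const_nhds.div (tendsto_const_nhds.sub (tendsto_const_nhds.mul hh))
        (by simp [hκ.ne'])
    have t2 : Tendsto (fun q : ℕ => K₁ * (Real.sqrt (2 * n) ^ 3 * (q : ℝ)⁻¹)) atTop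
        (𝓝 (K₁ * (Real.sqrt (2 * n) ^ 3 * 0))) :=
      tendsto_const_nhds.mul (tendsto_const_nhds.mul hq)
    have t3 : Tendsto (fun q : ℕ => K₂ * Real.exp (-(κ / 2) * q)) atTop (𝓝 (K₂ * 0)) := by
      refine tendsto_const_nhds.mul (Real.tendsto_exp_atBot.comp ?_)
      exact Tendsto.const_mul_atTop_of_neg (by linarith) tendsto_natCast_atTop_atTop
    simpa using ((t1.mul_const _).add t2).add t3
  refine ge_of_tendsto hlim ?_
  have c1 : ∀ᶠ q : ℕ in atTop, ((q : ℝ)⁻¹) ^ 4 * κ < 1 :=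
    (show Tendsto (fun q : ℕ => ((q : ℝ)⁻¹) ^ 4 * κ) atTop (𝓝 0) by
      simpa using hh.mul_const κ).eventually_lt_const one_pos
  have c2 : ∀ᶠ q : ℕ in atTop, (κ ^ 2 + A ^ 2) * ((q : ℝ)⁻¹) ^ 4 < κ :=
    (show Tendsto (fun q : ℕ => (κ ^ 2 + A ^ 2) * ((q : ℝ)⁻¹) ^ 4) atTop (𝓝 0) by
      simpa using hh.const_mul (κ ^ 2 + A ^ 2)).eventually_lt_const hκ
  have c3 : ∀ᶠ q : ℕ in atTop, (2 * n : ℝ) * ((q : ℝ)⁻¹) ^ 4 < 1 :=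
    (show Tendsto (fun q : ℕ => (2 * n : ℝ) * ((q : ℝ)⁻¹) ^ 4) atTop (𝓝 0) by
      simpa using hh.const_mul (2 * n : ℝ)).eventually_lt_const one_pos
  filter_upwards [c1, c2, c3, eventually_gt_atTop 0] with q h1 h2 h3 hq0
  have hq0' : (0 : ℝ) < q := by exact_mod_cast hq0
  have key := hK (((q : ℝ)⁻¹) ^ 4) (q ^ 5) (by positivity) h1.le h2.le
    (Real.sqrt_le_one.2 h3.le)
  have e1 : Real.sqrt (2 * n * ((q : ℝ)⁻¹) ^ 4) = Real.sqrt (2 * n) * ((q : ℝ)⁻¹) ^ 2 := by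
    rw [Real.sqrt_mul (by positivity), show ((q : ℝ)⁻¹) ^ 4 = (((q : ℝ)⁻¹) ^ 2) ^ 2 by ring,
      Real.sqrt_sq (by positivity)]
  have e2 : ((q ^ 5 : ℕ) : ℝ) * Real.sqrt (2 * n * ((q : ℝ)⁻¹) ^ 4) ^ 3 =
      Real.sqrt (2 * n) ^ 3 * (q : ℝ)⁻¹ := by
    rw [e1]; push_cast; field_simp
  have e3 : ((q : ℝ)⁻¹) ^ 4 * ((q ^ 5 : ℕ) : ℝ) = q := by
    push_cast; field_simp
  rw [e2, e3] at key
  exact key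

end Expect

end WeightedGaussian

namespace WeightedGaussian

/-! ### Mollified convex functions are admissible potentials -/

section Mollify

variable {n : ℕ} {F : Type*} [NormedAddCommGroup F] [NormedSpace ℝ F]
  {V : E n → ℝ} {ψ : E n → F} {K : NNReal}

/-- The convolution of a scalar function with a vector-valued kernel. -/
noncomputable def smear (V : E n → ℝ) (ψ : E n → F) (x : E n) : F := ∫ t, V t • ψ (x - t)

theorem smear_eq_swap (V : E n → ℝ) (ψ : E n → F) (x : E n) :
    smear V ψ x = ∫ t, V (x - t) • ψ t := by
  rw [smear, ← integral_sub_left_eq_self _ volume x]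
  simp

theorem integrable_smear (hV : Continuous V) (hψ : Continuous ψ) (hc : HasCompactSupport ψ)
    (x : E n) : Integrable (fun t => V (x - t) • ψ t) :=
  Continuous.integrable_of_hasCompactSupport (by fun_prop) (hc.smul_left)

theorem hasFDerivAt_smear [CompleteSpace F] (hV : Continuous V) (hψ : ContDiff ℝ 1 ψ)
    (hc : HasCompactSupport ψ) (x : E n) :
    HasFDerivAt (smear V ψ) (smear V (fderiv ℝ ψ) x) x := by
  have := hc.hasFDerivAt_convolution_right (μ := volume) (ContinuousLinearMap.lsmul ℝ ℝ)
    hV.locallyIntegrable hψ x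
  exact this

theorem norm_smear_sub_le (hV : LipschitzWith K V) (hψ : Continuous ψ)
    (hc : HasCompactSupport ψ) (x y : E n) :
    ‖smear V ψ x - smear V ψ y‖ ≤ (K * ∫ t, ‖ψ t‖) * ‖x - y‖ := by
  have hi := integrable_smear hV.continuous hψ hc
  rw [smear_eq_swap, smear_eq_swap, ← integral_sub (hi x) (hi y)]
  calc _ ≤ ∫ t, (K * ‖x - y‖) * ‖ψ t‖ := by
        refine norm_integral_le_of_norm_le
          ((hψ.integrable_of_hasCompactSupport hc).norm.const_mul _) (ae_of_all _ fun t => ?_)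
        rw [← sub_smul, norm_smul]
        gcongr
        simpa [dist_eq_norm] using hV.dist_le_mul (x - t) (y - t)
    _ = _ := by rw [integral_const_mul]; ring

theorem convexOn_smear {η : E n → ℝ} (hV : ConvexOn ℝ Set.univ V) (hVc : Continuous V)
    (hη : Continuous η) (hc : HasCompactSupport η) (h0 : ∀ t, 0 ≤ η t) :
    ConvexOn ℝ Set.univ (smear V η) := by
  have hi := integrable_smear hVc hη hc
  refine ⟨convex_univ, fun x _ y _ a b ha hb hab => ?_⟩
  simp only [smear_eq_swap]
  rw [smul_eq_mul, smul_eq_mul, ← integral_const_mul, ← integral_const_mul,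
    ← integral_add ((hi x).const_mul a) ((hi y).const_mul b)]
  refine integral_mono (hi _) (((hi x).const_mul a).add ((hi y).const_mul b)) fun t => ?_
  have e : a • x + b • y - t = a • (x - t) + b • (y - t) := by
    have : t = (a + b) • t := by rw [hab, one_smul]
    conv_lhs => rw [this]
    module
  have := hV.2 (Set.mem_univ (x - t)) (Set.mem_univ (y - t)) ha hb hab
  simp only [smul_eq_mul] at this ⊢
  rw [e]
  nlinarith [mul_le_mul_of_nonneg_right this (h0 t)]

end Mollify

/-- The linear map sending a functional to the vector that represents it. -/
noncomputable def riesz (n : ℕ) : (E n →L[ℝ] ℝ) →L[ℝ] E n :=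
  ∑ i, (ContinuousLinearMap.apply ℝ ℝ (EuclideanSpace.single i (1 : ℝ))).smulRight
    (EuclideanSpace.single i (1 : ℝ))

theorem inner_riesz {n : ℕ} (l : E n →L[ℝ] ℝ) (v : E n) : inner ℝ (riesz n l) v = l v := by
  have hv : v = ∑ i, v i • EuclideanSpace.single i (1 : ℝ) := by
    conv_lhs => rw [← (EuclideanSpace.basisFun (Fin n) ℝ).sum_repr v]
    simp
  conv_rhs => rw [hv]
  simp [riesz, sum_inner, inner_smul_left, EuclideanSpace.inner_single_left, mul_comm]

theorem norm_riesz {n : ℕ} (l : E n →L[ℝ] ℝ) : ‖riesz n l‖ = ‖l‖ := by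
  have : innerSL ℝ (riesz n l) = l := by ext v; simp [inner_riesz]
  rw [← innerSL_apply_norm (𝕜 := ℝ), this]

theorem gradient_eq_riesz {n : ℕ} (u : E n → ℝ) (x : E n) :
    gradient u x = riesz n (fderiv ℝ u x) := by
  refine ext_inner_right ℝ fun v => ?_
  rw [inner_riesz, gradient, InnerProductSpace.toDual_symm_apply]

theorem ConvexOn.inner_gradient_monotone {n : ℕ} {W : E n → ℝ} {b : E n → E n}
    (hW : ConvexOn ℝ Set.univ W) (hd : ∀ x, HasFDerivAt W (innerSL ℝ (b x)) x) (x y : E n) :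
    0 ≤ inner ℝ (b x - b y) (x - y) := by
  set g : ℝ → ℝ := fun t => W (y + t • (x - y))
  have hg : ConvexOn ℝ Set.univ g := by
    have := hW.comp_affineMap (AffineMap.lineMap y x)
    refine (this.congr fun t _ => ?_)
    simp [g, AffineMap.lineMap_apply, add_comm]
  have hgd : ∀ t, HasDerivAt g (inner ℝ (b (y + t • (x - y))) (x - y)) t := fun t => by
    have h1 : HasDerivAt (fun t : ℝ => y + t • (x - y)) (x - y) t := by
      simpa using ((hasDerivAt_id t).smul_const (x - y)).const_add y
    exact ((hd (y + t • (x - y))).comp_hasDerivAt t h1).congr_deriv (by simp)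
  have := hg.monotoneOn_deriv (fun t _ => (hgd t).differentiableAt) (Set.mem_univ (0 : ℝ))
    (Set.mem_univ (1 : ℝ)) zero_le_one
  rw [(hgd 0).deriv, (hgd 1).deriv] at this
  simp only [zero_smul, add_zero, one_smul, add_sub_cancel] at this
  rw [inner_sub_left]
  linarith

/-- A Lipschitz convex function is uniformly approximated by admissible potentials. -/
theorem exists_isConvexPotential_near {n : ℕ} {V : E n → ℝ} {K : NNReal}
    (hV : LipschitzWith K V) (hconv : ConvexOn ℝ Set.univ V) {ε : ℝ} (hε : 0 < ε) :
    ∃ A W b H, IsConvexPotential (n := n) A W b H ∧ ∀ x, |W x - V x| ≤ ε := by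
  obtain ⟨δ, hδ, hKδ⟩ : ∃ δ : ℝ, 0 < δ ∧ K * δ ≤ ε := by
    refine ⟨ε / (K + 1), by positivity, ?_⟩
    rw [mul_div_assoc', div_le_iff₀ (by positivity)]
    nlinarith [K.2]
  let φ : ContDiffBump (0 : E n) := ⟨δ / 2, δ, by positivity, by linarith⟩
  set η := φ.normed (volume : Measure (E n)) with hη
  have hη1 : ContDiff ℝ ∞ η := φ.contDiff_normed
  have hηc : HasCompactSupport η := φ.hasCompactSupport_normed
  have hD1 : ContDiff ℝ ∞ (fderiv ℝ η) := hη1.fderiv_right (by simp)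
  have hD1c : HasCompactSupport (fderiv ℝ η) := hηc.fderiv ℝ
  have hD2 : ContDiff ℝ ∞ (fderiv ℝ (fderiv ℝ η)) := hD1.fderiv_right (by simp)
  have hD2c : HasCompactSupport (fderiv ℝ (fderiv ℝ η)) := hD1c.fderiv ℝ
  have hVc := hV.continuous
  set W := smear V η
  set D₁ := smear V (fderiv ℝ η)
  set D₂ := smear V (fderiv ℝ (fderiv ℝ η))
  have d1 : ∀ x, HasFDerivAt W (D₁ x) x := hasFDerivAt_smear hVc (hη1.of_le (by simp)) hηc
  have d2 : ∀ x, HasFDerivAt D₁ (D₂ x) x := hasFDerivAt_smear hVc (hD1.of_le (by simp)) hD1c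
  have l0 := norm_smear_sub_le hV hη1.continuous hηc
  have l1 := norm_smear_sub_le hV hD1.continuous hD1c
  have l2 := norm_smear_sub_le hV hD2.continuous hD2c
  set K₀ := K * ∫ t, ‖η t‖
  set K₁ := K * ∫ t, ‖fderiv ℝ η t‖
  set K₂ := K * ∫ t, ‖fderiv ℝ (fderiv ℝ η) t‖
  have hK₀ : 0 ≤ K₀ := by positivity
  have hK₁ : 0 ≤ K₁ := by positivity
  have hK₂ : 0 ≤ K₂ := by positivity
  set J := riesz n
  have hJ : innerSL ℝ ∘ J = fun l => l := by ext l v; simp [J, inner_riesz]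
  have hWb : ∀ x, HasFDerivAt W (innerSL ℝ (J (D₁ x))) x := fun x => by
    have : innerSL ℝ (J (D₁ x)) = D₁ x := congrFun hJ (D₁ x)
    rw [this]; exact d1 x
  have hWconv : ConvexOn ℝ Set.univ W :=
    convexOn_smear hconv hVc hη1.continuous hηc fun t => φ.nonneg_normed t
  refine ⟨K₀ + ‖J‖ * K₁ + ‖J‖ * K₂, W, fun x => J (D₁ x), fun x => J ∘L D₂ x,
    ⟨hWb, fun x => ?_, fun x => ?_, fun x => ?_, fun x y => ?_,
      ConvexOn.inner_gradient_monotone hWconv hWb⟩, fun x => ?_⟩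
  · exact J.hasFDerivAt.comp x (d2 x)
  · rw [norm_riesz]
    have h1 : ‖D₁ x‖ ≤ K₀ := by
      rw [← (d1 x).fderiv]
      exact norm_fderiv_le_of_lip' ℝ hK₀ (Eventually.of_forall fun y => l0 y x)
    have : 0 ≤ ‖J‖ * K₁ + ‖J‖ * K₂ := by positivity
    linarith
  · have h1 : ‖D₂ x‖ ≤ K₁ := by
      rw [← (d2 x).fderiv]
      exact norm_fderiv_le_of_lip' ℝ hK₁ (Eventually.of_forall fun y => l1 y x)
    have h2 := (J.opNorm_comp_le (D₂ x)).trans (mul_le_mul_of_nonneg_left h1 (norm_nonneg J))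
    have : 0 ≤ ‖J‖ * K₂ := by positivity
    linarith
  · rw [← ContinuousLinearMap.comp_sub]
    refine (J.opNorm_comp_le _).trans
      ((mul_le_mul_of_nonneg_left (l2 x y) (norm_nonneg J)).trans ?_)
    rw [← mul_assoc]
    gcongr
    have : 0 ≤ ‖J‖ * K₁ := by positivity
    linarith
  · have e : V x = ∫ t, V x • η t := by
      simp only [smul_eq_mul]
      rw [integral_const_mul, φ.integral_normed, mul_one]
    have hi := integrable_smear hVc hη1.continuous hηc x
    have hi2 : Integrable (fun t => V x • η t) := φ.integrable_normed.const_mul _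
    have h1 : W x - V x = ∫ t, (V (x - t) - V x) • η t := by
      simp only [sub_smul]
      rw [integral_sub hi hi2, ← e, ← smear_eq_swap]
    rw [h1, ← Real.norm_eq_abs]
    calc _ ≤ ∫ t, ε * η t := by
          refine norm_integral_le_of_norm_le (φ.integrable_normed.const_mul _)
            (ae_of_all _ fun t => ?_)
          rw [norm_smul, Real.norm_of_nonneg (φ.nonneg_normed t)]
          by_cases ht : t ∈ Metric.ball (0 : E n) δ
          · refine mul_le_mul_of_nonneg_right ?_ (φ.nonneg_normed t)
            have h2 := hV.dist_le_mul (x - t) x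
            rw [dist_eq_norm, dist_eq_norm, sub_sub_cancel_left, norm_neg] at h2
            have h3 : ‖t‖ ≤ δ := by simpa using (Metric.mem_ball.1 ht).le
            exact h2.trans ((mul_le_mul_of_nonneg_left h3 K.2).trans hKδ)
          · have : φ.normed volume t = 0 := by
              rw [← Function.notMem_support, φ.support_normed_eq]; exact ht
            simp [this, hη]
      _ = ε := by rw [integral_const_mul, φ.integral_normed, mul_one]

end WeightedGaussian

namespace WeightedGaussian

/-! ### Approximation of a weight by smooth potentials -/

section Weight

variable {n : ℕ} {w : E n → ℝ} {K : ℝ}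

theorem Star.continuousAt (hw : Star w) {x : E n} (hx : x ∈ posSet w) : ContinuousAt w x :=
  (hw.differentiable x hx).continuousAt

theorem Star.isOpen (hw : Star w) : IsOpen (posSet w) :=
  isOpen_iff_mem_nhds.2 fun _ hx => (hw.continuousAt hx).eventually_const_lt hx

theorem Star.hasFDerivAt_log (hw : Star w) {x : E n} (hx : x ∈ posSet w) :
    HasFDerivAt (fun y => Real.log (w y)) ((w x)⁻¹ • fderiv ℝ w x) x :=
  (hw.differentiable x hx).hasFDerivAt.log (ne_of_gt hx)

theorem Star.differentiableAt_fderiv_log (hw : Star w) {x : E n} (hx : x ∈ posSet w) :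
    DifferentiableAt ℝ (fderiv ℝ fun y => Real.log (w y)) x := by
  have h1 : DifferentiableAt ℝ (fun y => (w y)⁻¹ • fderiv ℝ w y) x :=
    ((hw.differentiable x hx).inv (ne_of_gt hx)).smul (hw.twice_differentiable x hx)
  refine h1.congr_of_eventuallyEq ?_
  filter_upwards [hw.isOpen.mem_nhds hx] with y hy
  exact (hw.hasFDerivAt_log hy).fderiv

/-- The convex part `-log w - K|x|²/2` of the potential. -/
noncomputable def convexPart (K : ℝ) (w : E n → ℝ) (x : E n) : ℝ :=
  -Real.log (w x) - K / 2 * ‖x‖ ^ 2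

/-- The derivative of `convexPart`. -/
noncomputable def convexPartDeriv (K : ℝ) (w : E n → ℝ) (x : E n) : E n →L[ℝ] ℝ :=
  -(fderiv ℝ (fun y => Real.log (w y)) x) - K • innerSL ℝ x

theorem Star.hasFDerivAt_convexPart (hw : Star w) {x : E n} (hx : x ∈ posSet w) :
    HasFDerivAt (convexPart K w) (convexPartDeriv K w x) x := by
  have h1 : HasFDerivAt (fun y : E n => ‖y‖ ^ 2) (2 • innerSL ℝ x) x :=
    (hasStrictFDerivAt_norm_sq x).hasFDerivAt
  have h2 := (hw.hasFDerivAt_log hx).differentiableAt.hasFDerivAt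
  refine (h2.neg.sub (h1.const_mul (K / 2))).congr_fderiv ?_
  ext v
  simp [convexPartDeriv]
  ring

theorem Star.continuousAt_convexPartDeriv (hw : Star w) {x : E n} (hx : x ∈ posSet w) :
    ContinuousAt (convexPartDeriv K w) x :=
  (hw.differentiableAt_fderiv_log hx).continuousAt.neg.sub
    ((innerSL ℝ).continuous.continuousAt.const_smul K)

/-- The curvature bound says that `-log w - K|x|²/2` is convex: it lies above its tangents. -/
theorem Star.tangent_le (hw : Star w) (hK : CurvatureBound w K) {x y : E n} (hx : x ∈ posSet w)
    (hy : y ∈ posSet w) :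
    convexPart K w y + convexPartDeriv K w y (x - y) ≤ convexPart K w x := by
  set v := x - y
  have hseg : ∀ t ∈ Set.Icc (0 : ℝ) 1, y + t • v ∈ posSet w := fun t ht => by
    have := hw.convex hy hx (sub_nonneg.2 ht.2) ht.1 (sub_add_cancel 1 t)
    convert this using 1
    simp only [v]; module
  have hline : ∀ t : ℝ, HasDerivAt (fun t : ℝ => y + t • v) v t := fun t => by
    simpa using ((hasDerivAt_id t).smul_const v).const_add y
  have h1 : ∀ t ∈ Set.Icc (0 : ℝ) 1, HasDerivAt (fun t => convexPart K w (y + t • v))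
      (convexPartDeriv K w (y + t • v) v) t := fun t ht =>
    HasFDerivAt.comp_hasDerivAt (l := convexPart K w) t
      (hw.hasFDerivAt_convexPart (hseg t ht)) (hline t)
  have h2 : ∀ t ∈ Set.Icc (0 : ℝ) 1, HasDerivAt (fun t => convexPartDeriv K w (y + t • v) v)
      (-logHessian w (y + t • v) v - K * ‖v‖ ^ 2) t := fun t ht => by
    have h3 := HasFDerivAt.comp_hasDerivAt t
      (hw.differentiableAt_fderiv_log (hseg t ht)).hasFDerivAt (hline t)
    have h4 := (h3.clm_apply (hasDerivAt_const t v)).neg.sub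
      (((hline t).inner ℝ (hasDerivAt_const t v)).const_mul K)
    refine h4.congr_deriv ?_
    simp [logHessian]
  have hmono : MonotoneOn (fun t : ℝ => convexPartDeriv K w (y + t • v) v) (Set.Icc 0 1) := by
    refine monotoneOn_of_deriv_nonneg (convex_Icc 0 1)
      (fun t ht => (h2 t ht).continuousAt.continuousWithinAt)
      (fun t ht => (h2 t (interior_subset ht)).differentiableAt.differentiableWithinAt)
      (fun t ht => ?_)
    rw [(h2 t (interior_subset ht)).deriv]
    linarith [hK _ (hseg t (interior_subset ht)) v]
  obtain ⟨c, hc, hc'⟩ := exists_hasDerivAt_eq_slope _ _ one_pos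
    (fun t ht => (h1 t ht).continuousAt.continuousWithinAt)
    (fun t ht => h1 t (Set.Ioo_subset_Icc_self ht))
  have h3 := hmono (Set.left_mem_Icc.2 zero_le_one) (Set.Ioo_subset_Icc_self hc) hc.1.le
  simp only [zero_smul, add_zero, one_smul, sub_zero, div_one] at h3 hc'
  have e : y + v = x := by simp [v]
  rw [e] at hc'
  linarith

theorem convexOn_infDist {S : Set (E n)} (hS : Convex ℝ S) (hne : S.Nonempty) :
    ConvexOn ℝ Set.univ fun x => Metric.infDist x S := by
  refine ⟨convex_univ, fun x _ y _ a b ha hb hab => ?_⟩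
  refine le_of_forall_pos_le_add fun ε hε => ?_
  obtain ⟨p, hp, hp'⟩ := (Metric.infDist_lt_iff hne).1 (lt_add_of_pos_right (Metric.infDist x S) hε)
  obtain ⟨q, hq, hq'⟩ := (Metric.infDist_lt_iff hne).1 (lt_add_of_pos_right (Metric.infDist y S) hε)
  have h1 := Metric.infDist_le_dist_of_mem (x := a • x + b • y) (hS hp hq ha hb hab)
  have h2 : dist (a • x + b • y) (a • p + b • q) ≤ a * dist x p + b * dist y q := by
    rw [dist_eq_norm, dist_eq_norm, dist_eq_norm]
    have e : a • x + b • y - (a • p + b • q) = a • (x - p) + b • (y - q) := by module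
    rw [e]
    refine (norm_add_le _ _).trans ?_
    rw [norm_smul, norm_smul, Real.norm_of_nonneg ha, Real.norm_of_nonneg hb]
  simp only [smul_eq_mul]
  have h3 := mul_le_mul_of_nonneg_left hp'.le ha
  have h4 := mul_le_mul_of_nonneg_left hq'.le hb
  have h5 : a * ε + b * ε = ε := by rw [← add_mul, hab, one_mul]
  linarith

/-- The potential `-log w - K|x|²/2`, extended by `+∞` outside `Σ`, is a limit of admissible
potentials: finite maxima of tangents plus a multiple of the distance to `Σ`, mollified. -/
theorem Star.exists_potentials (hw : Star w) (hK : CurvatureBound w K) :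
    ∃ (A : ℕ → ℝ) (W : ℕ → E n → ℝ) (b : ℕ → E n → E n) (H : ℕ → E n → E n →L[ℝ] E n)
      (α β : ℝ), 0 ≤ β ∧ (∀ j, IsConvexPotential (A j) (W j) (b j) (H j)) ∧
      (∀ j x, α - β * ‖x‖ ≤ W j x) ∧
      (∀ x ∈ posSet w, Tendsto (fun j => W j x) atTop (𝓝 (convexPart K w x))) ∧
      (∀ x, x ∉ closure (posSet w) → Tendsto (fun j => W j x) atTop atTop) := by
  set S := posSet w
  have hne := hw.nonempty
  have : Nonempty S := hne.to_subtype
  set y : ℕ → S := TopologicalSpace.denseSeq S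
  set a : ℕ → E n → ℝ := fun i x =>
    convexPart K w (y i) + convexPartDeriv K w (y i) (x - y i) with ha
  have haL : ∀ i, LipschitzWith ‖convexPartDeriv K w (y i)‖₊ (a i) := fun i => by
    refine LipschitzWith.of_dist_le_mul fun x z => ?_
    have : a i x - a i z = convexPartDeriv K w (y i) (x - z) := by
      simp only [ha, map_sub]; ring
    rw [Real.dist_eq, this, dist_eq_norm]
    exact (convexPartDeriv K w (y i)).le_opNorm _
  have haC : ∀ i, ConvexOn ℝ Set.univ (a i) := fun i => by
    refine ⟨convex_univ, fun x _ z _ s t _ _ hst => le_of_eq ?_⟩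
    simp only [ha, map_sub, map_add, map_smul, smul_eq_mul]
    linear_combination (convexPartDeriv K w (y i) (y i) - convexPart K w (y i)) * hst
  set M : ℕ → E n → ℝ := fun j => partialSups a j with hM
  have hMC : ∀ j, ConvexOn ℝ Set.univ (M j) := fun j => by
    induction j with
    | zero => simpa [hM] using haC 0
    | succ j ih =>
      simp only [hM, partialSups_add_one]
      exact ih.sup (haC (j + 1))
  have hML : ∀ j, ∃ L, LipschitzWith L (M j) := fun j => by
    induction j with
    | zero => exact ⟨_, by simpa [hM] using haL 0⟩
    | succ j ih =>
      obtain ⟨L, hL⟩ := ih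
      simp only [hM, partialSups_add_one]
      exact ⟨_, hL.max (haL (j + 1))⟩
  have hMle : ∀ j, ∀ x ∈ S, M j x ≤ convexPart K w x := fun j x hx => by
    induction j with
    | zero =>
      simp only [hM, partialSups_zero]
      exact hw.tangent_le hK hx (y 0).2
    | succ j ih =>
      simp only [hM, partialSups_add_one]
      exact sup_le ih (hw.tangent_le hK hx (y (j + 1)).2)
  have haM : ∀ i j, i ≤ j → ∀ x, a i x ≤ M j x := fun i j hij x =>
    le_partialSups_of_le a hij x
  set V : ℕ → E n → ℝ := fun j x => M j x + j * Metric.infDist x S with hV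
  have hVC : ∀ j, ConvexOn ℝ Set.univ (V j) := fun j =>
    (hMC j).add ((convexOn_infDist hw.convex hne).smul (Nat.cast_nonneg j))
  have hVL : ∀ j, ∃ L, LipschitzWith L (V j) := fun j => by
    obtain ⟨L, hL⟩ := hML j
    refine ⟨L + j, hL.add (LipschitzWith.of_dist_le_mul fun x z => ?_)⟩
    rw [Real.dist_eq, ← mul_sub, abs_mul, Nat.abs_cast]
    have := (Metric.lipschitz_infDist_pt S).dist_le_mul x z
    rw [Real.dist_eq, NNReal.coe_one, one_mul] at this
    simpa using mul_le_mul_of_nonneg_left this (Nat.cast_nonneg (α := ℝ) j)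
  choose L hL using hVL
  choose A W b H hW hWV using fun j : ℕ =>
    exists_isConvexPotential_near (hL j) (hVC j) (ε := 1 / ((j : ℝ) + 1)) (by positivity)
  have hε : Tendsto (fun j : ℕ => 1 / ((j : ℝ) + 1)) atTop (𝓝 0) :=
    tendsto_one_div_add_atTop_nhds_zero_nat
  have hε1 : ∀ j : ℕ, 1 / ((j : ℝ) + 1) ≤ 1 := fun j => by
    rw [div_le_one (by positivity)]; linarith [Nat.cast_nonneg (α := ℝ) j]
  have hinf : ∀ j : ℕ, ∀ x, 0 ≤ (j : ℝ) * Metric.infDist x S := fun j x =>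
    mul_nonneg (Nat.cast_nonneg j) Metric.infDist_nonneg
  refine ⟨A, W, b, H, a 0 0 - 1, ‖convexPartDeriv K w (y 0)‖, norm_nonneg _, hW, fun j x => ?_,
    fun x hx => ?_, fun x hx => ?_⟩
  · have h1 := (haL 0).dist_le_mul x 0
    rw [Real.dist_eq, dist_zero_right, coe_nnnorm] at h1
    have h2 := (abs_le.1 h1).1
    have h3 := (abs_le.1 (hWV j x)).1
    have h4 := haM 0 j (Nat.zero_le j) x
    have h5 := hinf j x
    have h6 := hε1 j
    simp only [hV] at h3
    linarith
  · rw [Metric.tendsto_atTop]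
    intro ε hε0
    -- The tangents at points close to `x` nearly attain the value at `x`.
    have hcont : ContinuousAt (fun z => convexPart K w z + convexPartDeriv K w z (x - z)) x :=
      (hw.hasFDerivAt_convexPart hx).continuousAt.add
        ((hw.continuousAt_convexPartDeriv hx).clm_apply
          (continuousAt_const.sub continuousAt_id))
    have hev : ∀ᶠ z in 𝓝 x, convexPart K w x - ε / 2 <
        convexPart K w z + convexPartDeriv K w z (x - z) := by
      refine hcont.eventually_const_lt ?_
      simp only [sub_self, map_zero, add_zero]
      linarith
    have hev' : ∀ᶠ z : S in 𝓝 (⟨x, hx⟩ : S), convexPart K w x - ε / 2 <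
        convexPart K w z + convexPartDeriv K w z (x - z) :=
      (show Tendsto ((↑) : S → E n) (𝓝 ⟨x, hx⟩) (𝓝 x) from
        continuous_subtype_val.tendsto _).eventually hev
    obtain ⟨i, hi⟩ := (TopologicalSpace.denseRange_denseSeq S).exists_mem_open isOpen_interior
      ⟨_, mem_interior_iff_mem_nhds.2 hev'⟩
    have hi' := interior_subset hi
    change convexPart K w x - ε / 2 < a i x at hi'
    obtain ⟨N, hN⟩ := (eventually_atTop.1 (hε.eventually_lt_const (half_pos hε0)))
    refine ⟨max N i, fun j hj => ?_⟩
    have h1 := haM i j ((le_max_right _ _).trans hj) x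
    have h2 := hMle j x hx
    have h3 := abs_le.1 (hWV j x)
    have h4 := hN j ((le_max_left _ _).trans hj)
    simp only [hV, Metric.infDist_zero_of_mem hx, mul_zero, add_zero] at h3
    rw [Real.dist_eq, abs_lt]
    constructor <;> linarith [h3.1, h3.2]
  · have hpos : 0 < Metric.infDist x S := by
      rw [Metric.mem_closure_iff_infDist_zero hne] at hx
      exact lt_of_le_of_ne Metric.infDist_nonneg (Ne.symm hx)
    have h1 : Tendsto (fun j : ℕ => (a 0 x - 1) + (j : ℝ) * Metric.infDist x S) atTop atTop :=
      tendsto_atTop_add_const_left _ _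
        (tendsto_natCast_atTop_atTop.atTop_mul_const hpos)
    refine tendsto_atTop_mono (fun j => ?_) h1
    have h3 := (abs_le.1 (hWV j x)).1
    have h4 := haM 0 j (Nat.zero_le j) x
    have h6 := hε1 j
    simp only [hV] at h3
    linarith

end Weight

end WeightedGaussian

namespace WeightedGaussian

/-! ### The weighted Gaussian measure -/

section Measure

variable {n : ℕ} {w : E n → ℝ} {K : ℝ}

theorem weight_eq_density {x : E n} (hx : x ∈ posSet w) :
    w x * Real.exp (-‖x‖ ^ 2 / 2) = density (1 + K) (convexPart K w) x := by
  rw [density, convexPart]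
  conv_lhs => rw [← Real.exp_log (show 0 < w x from hx)]
  rw [← Real.exp_add]
  congr 1
  ring

theorem density_le_of_lower_bound {κ α β : ℝ} (hκ : 0 < κ) {W : E n → ℝ} {x : E n}
    (h : α - β * ‖x‖ ≤ W x) :
    density κ W x ≤ Real.exp (-α + β ^ 2 / κ) * Real.exp (-(κ / 4) * ‖x‖ ^ 2) := by
  rw [density, ← Real.exp_add]
  refine Real.exp_le_exp.2 ?_
  have h2 : β * ‖x‖ ≤ κ / 4 * ‖x‖ ^ 2 + β ^ 2 / κ := by
    have e : κ / 4 * ‖x‖ ^ 2 + β ^ 2 / κ - β * ‖x‖ = (κ * ‖x‖ - 2 * β) ^ 2 / (4 * κ) := by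
      field_simp; ring
    have : 0 ≤ (κ * ‖x‖ - 2 * β) ^ 2 / (4 * κ) := by positivity
    linarith
  linarith

theorem integrable_gaussian {κ : ℝ} (hκ : 0 < κ) :
    Integrable (fun x : E n => Real.exp (-κ * ‖x‖ ^ 2)) := by
  simpa using integrable_gaussian_weight (n := n) hκ 0

theorem Star.aestronglyMeasurable_weight (hw : Star w) :
    AEStronglyMeasurable (fun x => w x * Real.exp (-‖x‖ ^ 2 / 2))
      (volume.restrict (posSet w)) := by
  have : ContinuousOn (fun x => w x * Real.exp (-‖x‖ ^ 2 / 2)) (posSet w) :=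
    ContinuousOn.mul (fun x hx => (hw.continuousAt hx).continuousWithinAt) (by fun_prop)
  exact this.aestronglyMeasurable hw.isOpen.measurableSet

/-- On `Σ` the weight decays like a Gaussian. -/
theorem Star.exists_weight_le (hw : Star w) :
    ∃ C c : ℝ, 0 ≤ C ∧ 0 < c ∧ ∀ x ∈ posSet w,
      w x * Real.exp (-‖x‖ ^ 2 / 2) ≤ C * Real.exp (-c * ‖x‖ ^ 2) := by
  obtain ⟨K, hK1, hK⟩ := hw.bound
  obtain ⟨A, W, b, H, α, β, hβ, -, hlow, hlim, -⟩ := hw.exists_potentials hK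
  refine ⟨Real.exp (-α + β ^ 2 / (1 + K)), (1 + K) / 4, by positivity, by linarith,
    fun x hx => ?_⟩
  rw [weight_eq_density (K := K) hx]
  exact density_le_of_lower_bound (by linarith) (ge_of_tendsto' (hlim x hx) fun j => hlow j x)

theorem Star.integrableOn_weight (hw : Star w) :
    IntegrableOn (fun x => w x * Real.exp (-‖x‖ ^ 2 / 2)) (posSet w) := by
  obtain ⟨C, c, hC, hc, h⟩ := hw.exists_weight_le
  refine ((integrable_gaussian hc).const_mul C).integrableOn.mono'
    hw.aestronglyMeasurable_weight ?_
  refine (ae_restrict_iff' hw.isOpen.measurableSet).2 (ae_of_all _ fun x hx => ?_)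
  rw [Real.norm_of_nonneg (mul_nonneg (hw.nonneg x) (Real.exp_pos _).le)]
  exact h x hx

theorem Star.integral_weight_pos (hw : Star w) :
    0 < ∫ x in posSet w, w x * Real.exp (-‖x‖ ^ 2 / 2) := by
  rw [setIntegral_pos_iff_support_of_nonneg_ae
    (ae_of_all _ fun x => mul_nonneg (hw.nonneg x) (Real.exp_pos _).le) hw.integrableOn_weight]
  have : Function.support (fun x => w x * Real.exp (-‖x‖ ^ 2 / 2)) ∩ posSet w = posSet w :=
    Set.inter_eq_right.2 fun x hx => (mul_pos hx (Real.exp_pos _)).ne'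
  rw [this]
  exact hw.isOpen.measure_pos _ hw.nonempty

theorem Star.preMeasure_univ (hw : Star w) :
    preMeasure w Set.univ = ENNReal.ofReal (∫ x in posSet w, w x * Real.exp (-‖x‖ ^ 2 / 2)) := by
  rw [preMeasure, withDensity_apply _ MeasurableSet.univ, Measure.restrict_univ,
    ofReal_integral_eq_lintegral_ofReal hw.integrableOn_weight
      (ae_of_all _ fun x => mul_nonneg (hw.nonneg x) (Real.exp_pos _).le)]

theorem Star.isProbabilityMeasure (hw : Star w) : IsProbabilityMeasure (mu w) where
  measure_univ := by
    rw [mu, Measure.smul_apply, smul_eq_mul, ENNReal.inv_mul_cancel]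
    · rw [hw.preMeasure_univ]
      exact (ENNReal.ofReal_pos.2 hw.integral_weight_pos).ne'
    · rw [hw.preMeasure_univ]
      exact ENNReal.ofReal_ne_top

theorem Star.integral_mu (hw : Star w) (f : E n → ℝ) :
    ∫ x, f x ∂(mu w) = (∫ x in posSet w, f x * (w x * Real.exp (-‖x‖ ^ 2 / 2))) /
      ∫ x in posSet w, w x * Real.exp (-‖x‖ ^ 2 / 2) := by
  rw [mu, integral_smul_measure, preMeasure, integral_withDensity_eq_integral_toReal_smul₀
    hw.aestronglyMeasurable_weight.aemeasurable.ennreal_ofReal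
    (ae_of_all _ fun x => ENNReal.ofReal_lt_top), ← preMeasure, hw.preMeasure_univ,
    ENNReal.toReal_inv, ENNReal.toReal_ofReal hw.integral_weight_pos.le, smul_eq_mul, mul_comm,
    div_eq_mul_inv]
  congr 1
  refine integral_congr_ae (ae_of_all _ fun x => ?_)
  simp only [smul_eq_mul]
  rw [ENNReal.toReal_ofReal (mul_nonneg (hw.nonneg x) (Real.exp_pos _).le), mul_comm]

/-- The approximating measures converge to the weighted Gaussian measure; the boundary of the
convex set `Σ`, where nothing is known about the limit of the potentials, is a null set. -/
theorem Star.tendsto_integral (hw : Star w) (hK1 : -1 < K)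
    {A : ℕ → ℝ} {W : ℕ → E n → ℝ} {b : ℕ → E n → E n} {H : ℕ → E n → E n →L[ℝ] E n} {α β : ℝ}
    (hW : ∀ j, IsConvexPotential (A j) (W j) (b j) (H j)) (hlow : ∀ j x, α - β * ‖x‖ ≤ W j x)
    (hlim : ∀ x ∈ posSet w, Tendsto (fun j => W j x) atTop (𝓝 (convexPart K w x)))
    (hinf : ∀ x, x ∉ closure (posSet w) → Tendsto (fun j => W j x) atTop atTop)
    {f : E n → ℝ} (hf : Continuous f) {B : ℝ} (hB : ∀ x, |f x| ≤ B) :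
    Tendsto (fun j => ∫ x, f x * density (1 + K) (W j) x) atTop
      (𝓝 (∫ x in posSet w, f x * (w x * Real.exp (-‖x‖ ^ 2 / 2)))) := by
  have hκ : 0 < 1 + K := by linarith
  rw [← integral_indicator hw.isOpen.measurableSet]
  refine tendsto_integral_of_dominated_convergence
    (fun x => B * (Real.exp (-α + β ^ 2 / (1 + K)) * Real.exp (-((1 + K) / 4) * ‖x‖ ^ 2)))
    (fun j => (hf.mul (hW j).continuous_density).aestronglyMeasurable)
    (((integrable_gaussian (by positivity)).const_mul _).const_mul _)
    (fun j => ae_of_all _ fun x => ?_) ?_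
  · rw [norm_mul, Real.norm_eq_abs, Real.norm_of_nonneg (density_pos x).le]
    exact mul_le_mul (hB x) (density_le_of_lower_bound hκ (hlow j x)) (density_pos x).le
      ((abs_nonneg _).trans (hB x))
  · have hfr : ∀ᵐ x : E n, x ∉ frontier (posSet w) :=
      measure_eq_zero_iff_ae_notMem.1 (hw.convex.addHaar_frontier volume)
    filter_upwards [hfr] with x hx
    by_cases hxS : x ∈ posSet w
    · rw [Set.indicator_of_mem hxS, weight_eq_density (K := K) hxS]
      refine tendsto_const_nhds.mul ((Real.continuous_exp.tendsto _).comp ?_)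
      exact (tendsto_const_nhds.add (hlim x hxS)).neg
    · have hxc : x ∉ closure (posSet w) := fun hc => hx (by
        rw [hw.isOpen.frontier_eq]; exact ⟨hc, hxS⟩)
      rw [Set.indicator_of_notMem hxS, ← mul_zero (f x)]
      refine tendsto_const_nhds.mul (Real.tendsto_exp_neg_atTop_nhds_zero.comp ?_)
      exact tendsto_atTop_add_const_left _ _ (hinf x hxc)

/-- The `Φ`-entropy inequality, `Φ(x) = x ^ r`, for the weighted Gaussian measure and regular
functions bounded away from zero. -/
theorem Star.entropy_le (hn : 0 < n) (hw : Star w) (hK1 : -1 < K) (hK : CurvatureBound w K)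
    {r a₀ B L M B₁ L₁ M₁ B₂ L₂ M₂ : ℝ} {g : E n → ℝ} (hr1 : 1 < r) (hr2 : r ≤ 2) (ha₀ : 0 < a₀)
    (hM : 0 ≤ M) (hg : C11Bound B L M g) (hga : ∀ x, a₀ ≤ g x) (hM₁ : 0 ≤ M₁) (hM₂ : 0 ≤ M₂)
    (hΦ : C11Bound B₁ L₁ M₁ fun x => g x ^ r) (hΨ : C11Bound B₂ L₂ M₂ (entropyDensity r g)) :
    (∫ x, g x ^ r ∂(mu w)) - (∫ x, g x ∂(mu w)) ^ r ≤
      1 / (2 * (1 + K)) * ∫ x, entropyDensity r g x ∂(mu w) := by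
  have hκ : 0 < 1 + K := by linarith
  obtain ⟨A, W, b, H, α, β, hβ, hW, hlow, hlim, hinf⟩ := hw.exists_potentials hK
  have hZ : Tendsto (fun j => ∫ x, density (1 + K) (W j) x) atTop
      (𝓝 (∫ x in posSet w, w x * Real.exp (-‖x‖ ^ 2 / 2))) := by
    simpa using hw.tendsto_integral hK1 hW hlow hlim hinf (f := fun _ => 1) (by fun_prop) (B := 1)
      (by simp)
  have hE : ∀ {B L M : ℝ} {u : E n → ℝ}, C11Bound B L M u →
      Tendsto (fun j => expect (1 + K) (W j) u) atTop (𝓝 (∫ x, u x ∂(mu w))) := fun hu => by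
    rw [hw.integral_mu]
    exact (hw.tendsto_integral hK1 hW hlow hlim hinf hu.differentiable.continuous hu.bound).div hZ
      hw.integral_weight_pos.ne'
  have hlhs := (hE hΦ).sub ((hE hg).rpow_const (p := r) (Or.inr (by linarith)))
  exact le_of_tendsto_of_tendsto' hlhs ((hE hΨ).const_mul (1 / (2 * (1 + K)))) fun j =>
    (hW j).entropy_le hn hκ hr1 hr2 ha₀ hM hg hga hM₁ hM₂ hΦ hΨ

end Measure

end WeightedGaussian

namespace WeightedGaussian

/-! ### The Beckner inequality -/

section Beckner

variable {n : ℕ} {w : E n → ℝ} {K p : ℝ}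

theorem exists_c11Bound_const_add {v : E n → ℝ} (hv : ContDiff ℝ ∞ v) (hc : HasCompactSupport v)
    (c : ℝ) : ∃ B L M, 0 ≤ M ∧ C11Bound B L M fun x => c + v x := by
  have hv' : ContDiff ℝ ∞ (fderiv ℝ v) := hv.fderiv_right (by simp)
  have hc' : HasCompactSupport (fderiv ℝ v) := hc.fderiv ℝ
  obtain ⟨B, hB⟩ := hc.exists_bound_of_continuous hv.continuous
  obtain ⟨L, hL⟩ := hc'.exists_bound_of_continuous hv'.continuous
  obtain ⟨M, hM⟩ := ContDiff.lipschitzWith_of_hasCompactSupport hc' hv' (by simp)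
  refine ⟨|c| + B, L, M, M.2, fun x => ?_, ?_, fun x => ?_, fun x y => ?_⟩
  · exact (abs_add_le _ _).trans (add_le_add_right (hB x) _)
  · exact (differentiable_const c).add (hv.differentiable (by simp))
  · rw [fderiv_const_add]; exact hL x
  · rw [fderiv_const_add, fderiv_const_add, ← dist_eq_norm, ← dist_eq_norm]
    exact hM.dist_le_mul x y

theorem norm_gradient (u : E n → ℝ) (x : E n) : ‖gradient u x‖ = ‖fderiv ℝ u x‖ := by
  rw [gradient_eq_riesz, norm_riesz]

theorem contDiff_gradient {u : E n → ℝ} (hu : ContDiff ℝ ∞ u) : ContDiff ℝ ∞ (gradient u) := by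
  have : gradient u = fun x => riesz n (fderiv ℝ u x) := funext (gradient_eq_riesz u)
  rw [this]
  exact (riesz n).contDiff.comp (hu.fderiv_right (by simp))

theorem hasCompactSupport_gradient {u : E n → ℝ} (hu : HasCompactSupport u) :
    HasCompactSupport (gradient u) := by
  have : gradient u = riesz n ∘ fderiv ℝ u := funext (gradient_eq_riesz u)
  rw [this]
  exact (hu.fderiv ℝ).comp_left (map_zero _)

/-- The Beckner inequality for the regularization `√(f² + ε)` of a test function. -/
theorem Star.beckner_regularized (hn : 0 < n) (hw : Star w) (hK1 : -1 < K)
    (hK : CurvatureBound w K) (hp1 : 1 ≤ p) (hp2 : p < 2) {f : E n → ℝ} (hf : ContDiff ℝ ∞ f)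
    (hc : HasCompactSupport f) {ε : ℝ} (hε : 0 < ε) :
    (∫ x, (f x ^ 2 + ε) ∂(mu w)) - (∫ x, (f x ^ 2 + ε) ^ (p / 2) ∂(mu w)) ^ (2 / p) ≤
      (2 - p) / (1 + K) * ∫ x, ‖fderiv ℝ f x‖ ^ 2 ∂(mu w) := by
  have hp0 : 0 < p := by linarith
  have hκ : 0 < 1 + K := by linarith
  have := hw.isProbabilityMeasure
  set r := 2 / p with hr
  have hr1 : 1 < r := by rw [hr, lt_div_iff₀ hp0]; linarith
  have hr2 : r ≤ 2 := by rw [hr, div_le_iff₀ hp0]; linarith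
  set q : E n → ℝ := fun x => f x ^ 2 + ε with hq
  have hq0 : ∀ x, 0 < q x := fun x => by positivity
  set g : E n → ℝ := fun x => q x ^ (p / 2) with hg
  set a₀ := ε ^ (p / 2) with ha
  have ha0 : 0 < a₀ := by positivity
  have hqs : ContDiff ℝ ∞ q := (hf.pow 2).add contDiff_const
  have hgs : ContDiff ℝ ∞ g := hqs.rpow_const_of_ne fun x => (hq0 x).ne'
  have hga : ∀ x, a₀ ≤ g x := fun x => by
    refine Real.rpow_le_rpow hε.le ?_ (by positivity)
    simp only [hq]
    linarith [sq_nonneg (f x)]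
  have hgr : (fun x => g x ^ r) = q := funext fun x => by
    simp only [hg, hr]
    rw [← Real.rpow_mul (hq0 x).le, show p / 2 * (2 / p) = 1 by field_simp, Real.rpow_one]
  -- The chain rule identifies the entropy density.
  have hΨ : entropyDensity r g = fun x =>
      2 * (2 - p) * (f x ^ 2 / q x * ‖fderiv ℝ f x‖ ^ 2) := by
    funext x
    have hd : HasFDerivAt f (fderiv ℝ f x) x :=
      (hf.differentiable (by simp) x).hasFDerivAt
    have hdq : HasFDerivAt q ((2 * f x) • fderiv ℝ f x) x := by
      exact ((hd.pow 2).add_const ε).congr_fderiv (by simp)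
    have hdg := hdq.rpow_const (p := p / 2) (Or.inl (hq0 x).ne')
    rw [entropyDensity, hdg.fderiv, norm_smul, norm_smul, mul_pow, mul_pow, Real.norm_eq_abs,
      Real.norm_eq_abs, sq_abs, sq_abs]
    have e1 : g x ^ (r - 2) = q x ^ (1 - p) := by
      simp only [hg]
      rw [← Real.rpow_mul (hq0 x).le]
      congr 1
      rw [hr]; field_simp
    have e2 : (q x ^ (p / 2 - 1)) ^ 2 = q x ^ (p - 2) := by
      rw [← Real.rpow_natCast, ← Real.rpow_mul (hq0 x).le]
      congr 1
      push_cast; ring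
    have e3 : q x ^ (1 - p) * q x ^ (p - 2) = (q x)⁻¹ := by
      rw [← Real.rpow_add (hq0 x), show 1 - p + (p - 2) = -1 by ring, Real.rpow_neg_one]
    rw [e1, mul_pow, e2]
    calc _ = r * (r - 1) * (p / 2) ^ 2 * 4 * (q x ^ (1 - p) * q x ^ (p - 2)) *
          (f x ^ 2 * ‖fderiv ℝ f x‖ ^ 2) := by ring
      _ = _ := by
        rw [e3, hr]
        have := (hq0 x).ne'
        field_simp
        ring
  obtain ⟨B, L, M, hM, hgb⟩ := exists_c11Bound_const_add (v := fun x => g x - a₀)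
    (hgs.sub contDiff_const)
    (hc.comp_left (g := fun t => (t ^ 2 + ε) ^ (p / 2) - a₀) (by simp [ha])) a₀
  simp only [add_sub_cancel] at hgb
  obtain ⟨B₁, L₁, M₁, hM₁, hΦb⟩ := exists_c11Bound_const_add (v := fun x => f x ^ 2)
    (hf.pow 2) (hc.comp_left (g := fun t => t ^ 2) (by simp)) ε
  have e1 : (fun x => ε + f x ^ 2) = fun x => g x ^ r := by
    rw [hgr]; funext x; simp only [hq]; ring
  rw [e1] at hΦb
  have hΨs : ContDiff ℝ ∞ (fun x => 2 * (2 - p) * (f x ^ 2 / q x * ‖fderiv ℝ f x‖ ^ 2)) := by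
    simp only [← norm_gradient]
    exact contDiff_const.mul (((hf.pow 2).div hqs fun x => (hq0 x).ne').mul
      ((contDiff_gradient hf).norm_sq ℝ))
  have hΨc : HasCompactSupport
      (fun x => 2 * (2 - p) * (f x ^ 2 / q x * ‖fderiv ℝ f x‖ ^ 2)) :=
    hc.mono' fun x hx => by
      refine subset_tsupport f ?_
      contrapose! hx
      simp [Function.notMem_support.1 hx]
  obtain ⟨B₂, L₂, M₂, hM₂, hΨb⟩ := exists_c11Bound_const_add hΨs hΨc 0
  simp only [zero_add] at hΨb
  rw [← hΨ] at hΨb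
  have key := hw.entropy_le hn hK1 hK hr1 hr2 ha0 hM hgb hga hM₁ hM₂ hΦb hΨb
  rw [hgr] at key
  refine key.trans ?_
  obtain ⟨B₃, hB₃⟩ := (hc.fderiv ℝ).exists_bound_of_continuous (hf.continuous_fderiv (by simp))
  have i1 : Integrable (fun x => ‖fderiv ℝ f x‖ ^ 2) (mu w) := by
    have hcont : Continuous (fun x => ‖fderiv ℝ f x‖ ^ 2) :=
      (hf.continuous_fderiv (by simp)).norm.pow 2
    refine Integrable.of_bound hcont.aestronglyMeasurable (B₃ ^ 2) (ae_of_all _ fun x => ?_)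
    rw [Real.norm_of_nonneg (by positivity)]
    exact pow_le_pow_left₀ (norm_nonneg _) (hB₃ x) 2
  have hle : ∫ x, entropyDensity r g x ∂(mu w) ≤
      2 * (2 - p) * ∫ x, ‖fderiv ℝ f x‖ ^ 2 ∂(mu w) := by
    rw [← integral_const_mul]
    refine integral_mono_of_nonneg (ae_of_all _ fun x => ?_) (i1.const_mul _)
      (ae_of_all _ fun x => ?_)
    · rw [hΨ]
      have := hq0 x
      have : 0 ≤ 2 - p := by linarith
      simp only [Pi.zero_apply]
      positivity
    · rw [hΨ]
      have h1 : f x ^ 2 / q x ≤ 1 := by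
        rw [div_le_one (hq0 x)]
        simp only [hq]; linarith
      exact mul_le_mul_of_nonneg_left (mul_le_of_le_one_left (by positivity) h1) (by linarith)
  calc _ ≤ 1 / (2 * (1 + K)) * (2 * (2 - p) * ∫ x, ‖fderiv ℝ f x‖ ^ 2 ∂(mu w)) := by gcongr
    _ = _ := by field_simp

/-- The Beckner inequality for smooth compactly supported functions, with no condition at the
boundary. -/
theorem Star.beckner_smooth (hn : 0 < n) (hw : Star w) (hK1 : -1 < K)
    (hK : CurvatureBound w K) (hp1 : 1 ≤ p) (hp2 : p < 2) {f : E n → ℝ} (hf : ContDiff ℝ ∞ f)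
    (hc : HasCompactSupport f) :
    (∫ x, f x ^ 2 ∂(mu w)) - (∫ x, |f x| ^ p ∂(mu w)) ^ (2 / p) ≤
      (2 - p) / (1 + K) * ∫ x, ‖fderiv ℝ f x‖ ^ 2 ∂(mu w) := by
  have := hw.isProbabilityMeasure
  have hp0 : 0 < p := by linarith
  obtain ⟨B, hB⟩ := hc.exists_bound_of_continuous hf.continuous
  have hcont := hf.continuous
  have hε : Tendsto (fun j : ℕ => 1 / ((j : ℝ) + 1)) atTop (𝓝 0) :=
    tendsto_one_div_add_atTop_nhds_zero_nat
  have hε1 : ∀ j : ℕ, 1 / ((j : ℝ) + 1) ≤ 1 := fun j => by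
    rw [div_le_one (by positivity)]; linarith [Nat.cast_nonneg (α := ℝ) j]
  have hf2 : ∀ x, f x ^ 2 ≤ B ^ 2 := fun x => sq_le_sq' (abs_le.1 (hB x)).1 (abs_le.1 (hB x)).2
  have t1 : Tendsto (fun j : ℕ => ∫ x, (f x ^ 2 + 1 / ((j : ℝ) + 1)) ∂(mu w)) atTop
      (𝓝 (∫ x, f x ^ 2 ∂(mu w))) := by
    refine tendsto_integral_of_dominated_convergence (fun _ => B ^ 2 + 1)
      (fun j => by fun_prop) (integrable_const _) (fun j => ae_of_all _ fun x => ?_)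
      (ae_of_all _ fun x => ?_)
    · rw [Real.norm_of_nonneg (by positivity)]
      exact add_le_add (hf2 x) (hε1 j)
    · simpa using (tendsto_const_nhds (x := f x ^ 2)).add hε
  have t2 : Tendsto (fun j : ℕ => ∫ x, (f x ^ 2 + 1 / ((j : ℝ) + 1)) ^ (p / 2) ∂(mu w)) atTop
      (𝓝 (∫ x, |f x| ^ p ∂(mu w))) := by
    refine tendsto_integral_of_dominated_convergence (fun _ => (B ^ 2 + 1) ^ (p / 2))
      (fun j => ?_) (integrable_const _) (fun j => ae_of_all _ fun x => ?_)
      (ae_of_all _ fun x => ?_)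
    · exact (Continuous.rpow_const (by fun_prop)
        fun x => Or.inr (by positivity)).aestronglyMeasurable
    · rw [Real.norm_of_nonneg (by positivity)]
      exact Real.rpow_le_rpow (by positivity) (add_le_add (hf2 x) (hε1 j)) (by positivity)
    · have h1 : Tendsto (fun j : ℕ => f x ^ 2 + 1 / ((j : ℝ) + 1)) atTop (𝓝 (f x ^ 2)) := by
        simpa using (tendsto_const_nhds (x := f x ^ 2)).add hε
      have h2 := h1.rpow_const (p := p / 2) (Or.inr (by positivity))
      have e : (f x ^ 2) ^ (p / 2) = |f x| ^ p := by
        rw [← sq_abs, ← Real.rpow_natCast, ← Real.rpow_mul (abs_nonneg _)]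
        congr 1
        push_cast; ring
      rwa [e] at h2
  refine le_of_tendsto' (t1.sub (t2.rpow_const (p := 2 / p) (Or.inr (by positivity)))) fun j => ?_
  exact hw.beckner_regularized hn hK1 hK hp1 hp2 hf hc (by positivity)

theorem toReal_eLpNorm_sq {X F : Type*} [MeasurableSpace X] [NormedAddCommGroup F] {ν : Measure X}
    {f : X → F} {p : ℝ} (hp : 1 ≤ p) (hf : MemLp f (ENNReal.ofReal p) ν) :
    (eLpNorm f (ENNReal.ofReal p) ν).toReal ^ 2 = (∫ x, ‖f x‖ ^ p ∂ν) ^ (2 / p) := by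
  have hp0 : 0 < p := by linarith
  have hI : 0 ≤ ∫ x, ‖f x‖ ^ p ∂ν := integral_nonneg fun x => by positivity
  rw [hf.eLpNorm_eq_integral_rpow_norm (by simpa using hp0) ENNReal.ofReal_ne_top,
    ENNReal.toReal_ofReal hp0.le, ENNReal.toReal_ofReal (by positivity), ← Real.rpow_natCast,
    ← Real.rpow_mul hI]
  congr 1
  push_cast
  field_simp

theorem tendsto_toReal_eLpNorm {X F : Type*} [MeasurableSpace X] [NormedAddCommGroup F]
    {ν : Measure X} {q : ENNReal} (hq : 1 ≤ q) {f : X → F} {u : ℕ → X → F} (hf : MemLp f q ν)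
    (hu : ∀ k, MemLp (u k) q ν)
    (h : Tendsto (fun k => eLpNorm (fun x => u k x - f x) q ν) atTop (𝓝 0)) :
    Tendsto (fun k => (eLpNorm (u k) q ν).toReal) atTop (𝓝 (eLpNorm f q ν).toReal) := by
  have : Fact (1 ≤ q) := ⟨hq⟩
  have h1 := ((Lp.tendsto_Lp_iff_tendsto_eLpNorm'' u hu f hf).2 h).norm
  simpa only [Lp.norm_toLp] using h1

theorem TestFunctions.memLp [IsFiniteMeasure (mu w)] {S : Set (E n)} {u : E n → ℝ}
    (hu : u ∈ TestFunctions S) (q : ENNReal) : MemLp u q (mu w) ∧ MemLp (gradient u) q (mu w) := by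
  obtain ⟨B, hB⟩ := hu.2.1.exists_bound_of_continuous hu.1.continuous
  have hg := (contDiff_gradient hu.1).continuous
  obtain ⟨B', hB'⟩ := (hasCompactSupport_gradient hu.2.1).exists_bound_of_continuous hg
  exact ⟨MemLp.of_bound hu.1.continuous.aestronglyMeasurable B (ae_of_all _ hB),
    MemLp.of_bound hg.aestronglyMeasurable B' (ae_of_all _ hB')⟩

theorem Star.becknerInequality (hn : 0 < n) (hw : Star w) (hK1 : -1 < K)
    (hK : CurvatureBound w K) (hp1 : 1 ≤ p) (hp2 : p < 2) :
    BecknerInequality w p (1 / (1 + K)) := by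
  rintro f G ⟨hf, hG, u, hu, hlim⟩
  have := hw.isProbabilityMeasure
  have h2p : (0 : ℝ) < 2 - p := by linarith
  have hκ : 0 < 1 + K := by linarith
  set q := ENNReal.ofReal p
  have hq1 : 1 ≤ q := by simpa [q] using ENNReal.ofReal_le_ofReal hp1
  have hq2 : q ≤ 2 := by simpa [q] using ENNReal.ofReal_le_ofReal hp2.le
  have e2 : ENNReal.ofReal 2 = 2 := by simp
  have hmu : ∀ k, MemLp (u k) 2 (mu w) := fun k => (TestFunctions.memLp (hu k) 2).1
  have hmG : ∀ k, MemLp (gradient (u k)) 2 (mu w) := fun k => (TestFunctions.memLp (hu k) 2).2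
  have lim1 : Tendsto (fun k => eLpNorm (fun x => u k x - f x) 2 (mu w)) atTop (𝓝 0) :=
    tendsto_of_tendsto_of_tendsto_of_le_of_le tendsto_const_nhds hlim (fun _ => zero_le)
      (fun _ => le_self_add)
  have lim2 : Tendsto (fun k => eLpNorm (fun x => gradient (u k) x - G x) 2 (mu w)) atTop (𝓝 0) :=
    tendsto_of_tendsto_of_tendsto_of_le_of_le tendsto_const_nhds hlim (fun _ => zero_le)
      (fun _ => le_add_self)
  have lim3 : Tendsto (fun k => eLpNorm (fun x => u k x - f x) q (mu w)) atTop (𝓝 0) :=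
    tendsto_of_tendsto_of_tendsto_of_le_of_le tendsto_const_nhds lim1 (fun _ => zero_le)
      (fun k => eLpNorm_le_eLpNorm_of_exponent_le hq2 ((hmu k).sub hf).aestronglyMeasurable)
  have T1 := (tendsto_toReal_eLpNorm one_le_two hf hmu lim1).pow 2
  have T2 := (tendsto_toReal_eLpNorm one_le_two hG hmG lim2).pow 2
  have T3 := (tendsto_toReal_eLpNorm hq1 (hf.mono_exponent hq2)
    (fun k => (hmu k).mono_exponent hq2) lim3).pow 2
  have N2 : ∀ {F : Type} [NormedAddCommGroup F] {g : E n → F}, MemLp g 2 (mu w) →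
      (eLpNorm g 2 (mu w)).toReal ^ 2 = ∫ x, ‖g x‖ ^ 2 ∂(mu w) := by
    intro F _ g hg
    have := toReal_eLpNorm_sq one_le_two (ν := mu w) (f := g) (by rwa [e2])
    rw [e2] at this
    simpa using this
  have Np : ∀ {g : E n → ℝ}, MemLp g 2 (mu w) →
      (eLpNorm g q (mu w)).toReal ^ 2 = (∫ x, |g x| ^ p ∂(mu w)) ^ (2 / p) := fun hg =>
    toReal_eLpNorm_sq hp1 (hg.mono_exponent hq2)
  have key := le_of_tendsto_of_tendsto' (T1.sub T3) (T2.const_mul ((2 - p) / (1 + K))) fun k => by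
    rw [N2 (hmu k), N2 (hmG k), Np (hmu k)]
    simpa [norm_gradient] using hw.beckner_smooth hn hK1 hK hp1 hp2 (hu k).1 (hu k).2.1
  rw [N2 hf, N2 hG, Np hf] at key
  simp only [Real.norm_eq_abs, sq_abs] at key
  rw [one_div, inv_mul_le_iff₀ h2p]
  calc _ ≤ _ := key
    _ = _ := by ring

end Beckner

end WeightedGaussian

namespace WeightedGaussian

/-! ### Sharpness for weights that are independent of a coordinate -/

section Sharp

variable {n : ℕ} {w : E n → ℝ} {i : Fin n} {p C : ℝ}

/-- The Hessian of `log w` vanishes in the direction in which `w` is constant. -/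
theorem curvature_nonpos_of_isPartial (hw : Star w)
    (hi : ∀ (x : E n) (t : ℝ), w (x + EuclideanSpace.single i t) = w x) {K : ℝ}
    (hK : CurvatureBound w K) : K ≤ 0 := by
  obtain ⟨x, hx⟩ := hw.nonempty
  set e : E n := EuclideanSpace.single i 1 with he
  have he1 : ‖e‖ = 1 := by simp [he]
  have hsm : ∀ t : ℝ, t • e = EuclideanSpace.single i t := fun t => by
    ext j
    rcases eq_or_ne j i with rfl | hj <;> simp [*]
  set D := fderiv ℝ fun y => Real.log (w y)
  have hD : ∀ t : ℝ, D (x + t • e) = D x := fun t => by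
    have h1 := fderiv_comp_add_right (𝕜 := ℝ) (f := fun y => Real.log (w y)) (x := x) (t • e)
    simp only [hsm, hi] at h1
    rw [hsm]
    exact h1.symm
  have h2 : fderiv ℝ D x e = 0 := by
    have h3 := ((hw.differentiableAt_fderiv_log hx).hasFDerivAt.hasLineDerivAt e)
    have h4 : HasLineDerivAt ℝ D 0 x e := by
      unfold HasLineDerivAt
      simp only [hD]
      exact hasDerivAt_const _ _
    exact h3.unique h4
  have h5 := hK x hx e
  have h6 : logHessian w x e = 0 := by
    rw [logHessian]
    change (fderiv ℝ D x) e e = 0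
    rw [h2]; rfl
  rw [h6, he1] at h5
  linarith

/-- The coordinate on which the weight does not depend is a standard Gaussian variable: its Laplace
transform follows from the translation invariance of Lebesgue measure. -/
theorem Star.integral_exp_coord (hw : Star w)
    (hi : ∀ (x : E n) (t : ℝ), w (x + EuclideanSpace.single i t) = w x) (a : ℝ) :
    ∫ x, Real.exp (a * x i) ∂(mu w) = Real.exp (a ^ 2 / 2) := by
  have hset : ∀ f : E n → ℝ, ∫ x in posSet w, f x * (w x * Real.exp (-‖x‖ ^ 2 / 2)) =
      ∫ x, f x * (w x * Real.exp (-‖x‖ ^ 2 / 2)) := fun f => by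
    refine setIntegral_eq_integral_of_forall_compl_eq_zero fun x hx => ?_
    have : w x = 0 := le_antisymm (not_lt.1 hx) (hw.nonneg x)
    simp [this]
  have hset1 := hset fun _ => 1
  simp only [one_mul] at hset1
  have hpos := hw.integral_weight_pos
  rw [hw.integral_mu, hset, hset1, div_eq_iff (by rw [← hset1]; exact hpos.ne'),
    ← integral_add_right_eq_self _ (EuclideanSpace.single i a : E n), ← integral_const_mul]
  refine integral_congr_ae (ae_of_all _ fun x => ?_)
  have hn : ‖x + EuclideanSpace.single i a‖ ^ 2 = ‖x‖ ^ 2 + 2 * (a * x i) + a ^ 2 := by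
    rw [norm_add_sq_real]
    simp [EuclideanSpace.inner_single_right]
  have hc : (x + EuclideanSpace.single i a) i = x i + a := by simp
  simp only [hi, hn, hc]
  rw [mul_left_comm, ← Real.exp_add, mul_left_comm (Real.exp (a ^ 2 / 2)), ← Real.exp_add]
  ring_nf

theorem Star.integrable_exp_coord (hw : Star w)
    (hi : ∀ (x : E n) (t : ℝ), w (x + EuclideanSpace.single i t) = w x) (a : ℝ) :
    Integrable (fun x : E n => Real.exp (a * x i)) (mu w) :=
  Integrable.of_integral_ne_zero (by
    rw [hw.integral_exp_coord hi]; exact (Real.exp_pos _).ne')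

/-- `Σ` is a cylinder over the coordinate on which the weight does not depend, so its outer
normals are orthogonal to that direction. -/
theorem IsOuterNormal.inner_single_eq_zero (hw : Star w)
    (hi : ∀ (x : E n) (t : ℝ), w (x + EuclideanSpace.single i t) = w x) {x η : E n}
    (hη : IsOuterNormal (posSet w) x η) :
    inner ℝ (EuclideanSpace.single i (1 : ℝ)) η = 0 := by
  obtain ⟨y, hy⟩ := hw.nonempty
  have h : ∀ t : ℝ, inner ℝ η (y - x) + t * η i ≤ 0 := fun t => by
    have h1 := hη.2 (y + EuclideanSpace.single i t) (by
      change 0 < w _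
      rw [hi]; exact hy)
    have e : y + EuclideanSpace.single i t - x = (y - x) + EuclideanSpace.single i t := by abel
    rw [e, inner_add_right] at h1
    simpa [EuclideanSpace.inner_single_right] using h1
  have h2 : η i = 0 := by
    by_contra hne
    have := h ((1 - inner ℝ η (y - x)) / η i)
    rw [div_mul_cancel₀ _ hne] at this
    linarith
  simpa [EuclideanSpace.inner_single_left] using h2

theorem hasFDerivAt_comp_coord {φ : ℝ → ℝ} {φ' : ℝ} {x : E n} (h : HasDerivAt φ φ' (x i)) :
    HasFDerivAt (fun y : E n => φ (y i)) (φ' • EuclideanSpace.proj (𝕜 := ℝ) i) x :=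
  h.comp_hasFDerivAt x (EuclideanSpace.proj (𝕜 := ℝ) i).hasFDerivAt

theorem riesz_proj (i : Fin n) :
    riesz n (EuclideanSpace.proj (𝕜 := ℝ) i) = EuclideanSpace.single i (1 : ℝ) := by
  refine ext_inner_right ℝ fun v => ?_
  rw [inner_riesz]
  simp [EuclideanSpace.inner_single_left]

theorem gradient_comp_coord_mul {φ : ℝ → ℝ} {χ : E n → ℝ} {φ' : ℝ} {x : E n}
    (h : HasDerivAt φ φ' (x i)) (hχ : DifferentiableAt ℝ χ x) :
    gradient (fun y : E n => φ (y i) * χ y) x =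
      φ (x i) • gradient χ x + (χ x * φ') • EuclideanSpace.single i (1 : ℝ) := by
  rw [gradient_eq_riesz, gradient_eq_riesz,
    ((hasFDerivAt_comp_coord h).fun_mul hχ.hasFDerivAt).fderiv, map_add, map_smul, map_smul,
    map_smul, riesz_proj, smul_smul]

/-- If the constant `1` belongs to `W^{1,2}_A`, so does every bounded smooth function of the
coordinate on which the weight does not depend. -/
theorem memW12A_comp_coord (hw : Star w)
    (hi : ∀ (x : E n) (t : ℝ), w (x + EuclideanSpace.single i t) = w x)
    (h1 : MemW12A w (fun _ => 1) (fun _ => 0)) {φ : ℝ → ℝ} (hφ : ContDiff ℝ ∞ φ) {B : ℝ}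
    (hB : ∀ t, |φ t| ≤ B) (hB' : ∀ t, |deriv φ t| ≤ B) :
    MemW12A w (fun x => φ (x i))
      (fun x => deriv φ (x i) • EuclideanSpace.single i (1 : ℝ)) := by
  have := hw.isProbabilityMeasure
  obtain ⟨-, -, χ, hχ, hlim⟩ := h1
  have hφc := hφ.continuous
  have hφc' : Continuous (deriv φ) := hφ.continuous_deriv (by simp)
  have hd : ∀ t, HasDerivAt φ (deriv φ t) t := fun t =>
    (hφ.differentiable (by simp) t).hasDerivAt
  have hB0 : 0 ≤ B := (abs_nonneg _).trans (hB 0)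
  refine ⟨MemLp.of_bound (Continuous.aestronglyMeasurable (by fun_prop)) B
      (ae_of_all _ fun x => hB _),
    MemLp.of_bound (Continuous.aestronglyMeasurable (by fun_prop)) B
      (ae_of_all _ fun x => by simpa [norm_smul] using hB' (x i)),
    fun k x => φ (x i) * χ k x, fun k => ⟨?_, ?_, fun x hx η hη => ?_⟩, ?_⟩
  · have : ContDiff ℝ ∞ fun x : E n => φ (x i) :=
      hφ.comp (EuclideanSpace.proj (𝕜 := ℝ) i).contDiff
    exact this.mul (hχ k).1
  · exact (hχ k).2.1.mul_left
  · rw [gradient_comp_coord_mul (hd _) ((hχ k).1.differentiable (by simp) x), inner_add_left,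
      inner_smul_left, inner_smul_left, (hχ k).2.2 x hx η hη, hη.inner_single_eq_zero hw hi]
    simp
  · have hmeas : ∀ k, AEStronglyMeasurable (fun x => χ k x - 1) (mu w) := fun k =>
      ((hχ k).1.continuous.sub continuous_const).aestronglyMeasurable
    have hmeas' : ∀ k, AEStronglyMeasurable (fun x => gradient (χ k) x - 0) (mu w) := fun k =>
      ((contDiff_gradient (hχ k).1).continuous.sub continuous_const).aestronglyMeasurable
    have hbound : ∀ k, eLpNorm (fun x => φ (x i) * χ k x - φ (x i)) 2 (mu w) +
        eLpNorm (fun x => gradient (fun y : E n => φ (y i) * χ k y) x -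
          deriv φ (x i) • EuclideanSpace.single i (1 : ℝ)) 2 (mu w) ≤
        ENNReal.ofReal (2 * B) * (eLpNorm (fun x => χ k x - 1) 2 (mu w) +
          eLpNorm (fun x => gradient (χ k) x - 0) 2 (mu w)) := by
      intro k
      have b1 : eLpNorm (fun x => φ (x i) * χ k x - φ (x i)) 2 (mu w) ≤
          ENNReal.ofReal B * eLpNorm (fun x => χ k x - 1) 2 (mu w) := by
        refine eLpNorm_le_mul_eLpNorm_of_ae_le_mul (ae_of_all _ fun x => ?_) 2
        have e : φ (x i) * χ k x - φ (x i) = φ (x i) * (χ k x - 1) := by ring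
        rw [e, norm_mul]
        exact mul_le_mul_of_nonneg_right (hB _) (norm_nonneg _)
      have b2 : eLpNorm (fun x => gradient (fun y : E n => φ (y i) * χ k y) x -
          deriv φ (x i) • EuclideanSpace.single i (1 : ℝ)) 2 (mu w) ≤
          ENNReal.ofReal B * eLpNorm (fun x => ‖χ k x - 1‖ + ‖gradient (χ k) x - 0‖) 2 (mu w) := by
        refine eLpNorm_le_mul_eLpNorm_of_ae_le_mul (ae_of_all _ fun x => ?_) 2
        rw [gradient_comp_coord_mul (hd _) ((hχ k).1.differentiable (by simp) x)]
        have e : φ (x i) • gradient (χ k) x + (χ k x * deriv φ (x i)) •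
            EuclideanSpace.single i (1 : ℝ) - deriv φ (x i) • EuclideanSpace.single i (1 : ℝ) =
            φ (x i) • (gradient (χ k) x - 0) + (deriv φ (x i) * (χ k x - 1)) •
              EuclideanSpace.single i (1 : ℝ) := by module
        rw [e, Real.norm_of_nonneg (by positivity), mul_add]
        refine (norm_add_le _ _).trans ?_
        rw [norm_smul, norm_smul, norm_mul, PiLp.norm_single, norm_one, mul_one,
          add_comm]
        exact add_le_add (mul_le_mul_of_nonneg_right (hB' _) (norm_nonneg _))
          (mul_le_mul_of_nonneg_right (hB _) (norm_nonneg _))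
      have b3 : eLpNorm (fun x => ‖χ k x - 1‖ + ‖gradient (χ k) x - 0‖) 2 (mu w) ≤
          eLpNorm (fun x => χ k x - 1) 2 (mu w) +
            eLpNorm (fun x => gradient (χ k) x - 0) 2 (mu w) := by
        refine (eLpNorm_add_le (hmeas k).norm (hmeas' k).norm one_le_two).trans (le_of_eq ?_)
        rw [eLpNorm_norm, eLpNorm_norm]
      calc _ ≤ ENNReal.ofReal B * (eLpNorm (fun x => χ k x - 1) 2 (mu w) +
            eLpNorm (fun x => gradient (χ k) x - 0) 2 (mu w)) +
            ENNReal.ofReal B * (eLpNorm (fun x => χ k x - 1) 2 (mu w) +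
            eLpNorm (fun x => gradient (χ k) x - 0) 2 (mu w)) := by
            refine add_le_add (b1.trans ?_) (b2.trans ?_)
            · gcongr; exact le_self_add
            · gcongr
        _ = _ := by
          rw [← add_mul, ← ENNReal.ofReal_add hB0 hB0, ← two_mul]
    refine tendsto_of_tendsto_of_tendsto_of_le_of_le tendsto_const_nhds ?_ (fun _ => zero_le)
      hbound
    have h := ENNReal.Tendsto.const_mul (a := ENNReal.ofReal (2 * B)) hlim
      (Or.inr ENNReal.ofReal_ne_top)
    rwa [mul_zero] at h

/-- Testing with bounded approximations of `exp (s xᵢ)`. -/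
theorem BecknerInequality.exp_le (hC : BecknerInequality w p C) (hw : Star w)
    (hi : ∀ (x : E n) (t : ℝ), w (x + EuclideanSpace.single i t) = w x)
    (h1 : MemW12A w (fun _ => 1) (fun _ => 0)) (hp1 : 1 ≤ p) (s : ℝ) :
    1 / (2 - p) * (Real.exp (2 * s ^ 2) - Real.exp (p * s ^ 2)) ≤
      C * (s ^ 2 * Real.exp (2 * s ^ 2)) := by
  have := hw.isProbabilityMeasure
  have hp0 : 0 < p := by linarith
  -- The argument `t` is replaced by the bounded function `R sin (t / R)`.
  set S : ℕ → ℝ → ℝ := fun k t => ((k : ℝ) + 1) * Real.sin (t / ((k : ℝ) + 1)) with hS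
  have hS1 : ∀ k t, |S k t| ≤ |t| := fun k t => by
    have hk : (0 : ℝ) < (k : ℝ) + 1 := by positivity
    rw [hS]
    simp only
    rw [abs_mul, abs_of_pos hk]
    have := Real.abs_sin_le_abs (x := t / ((k : ℝ) + 1))
    rw [abs_div, abs_of_pos hk, le_div_iff₀ hk] at this
    linarith
  have hS2 : ∀ k t, |S k t| ≤ (k : ℝ) + 1 := fun k t => by
    have hk : (0 : ℝ) < (k : ℝ) + 1 := by positivity
    rw [hS]
    simp only
    rw [abs_mul, abs_of_pos hk]
    exact mul_le_of_le_one_right hk.le (Real.abs_sin_le_one _)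
  have hSd : ∀ k t, HasDerivAt (S k) (Real.cos (t / ((k : ℝ) + 1))) t := fun k t => by
    have hk : ((k : ℝ) + 1) ≠ 0 := by positivity
    have := (((hasDerivAt_id t).div_const ((k : ℝ) + 1)).sin).const_mul ((k : ℝ) + 1)
    refine this.congr_deriv ?_
    simp only [id]
    field_simp
  have hzero : ∀ t : ℝ, Tendsto (fun k : ℕ => t / ((k : ℝ) + 1)) atTop (𝓝 0) := fun t => by
    have h := (tendsto_one_div_add_atTop_nhds_zero_nat (𝕜 := ℝ)).const_mul t
    rw [mul_zero] at h
    exact h.congr fun k => mul_one_div _ _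
  have hSlim : ∀ t, Tendsto (fun k => S k t) atTop (𝓝 t) := fun t => by
    have h2 : HasDerivAt (fun z => Real.sin (t * z)) t 0 := by
      have := ((hasDerivAt_id (0 : ℝ)).const_mul t).sin
      simpa using this
    have h3 := h2.tendsto_slope_zero_right
    simp only [zero_add, mul_zero, Real.sin_zero, sub_zero, smul_eq_mul] at h3
    have h4 : Tendsto (fun k : ℕ => 1 / ((k : ℝ) + 1)) atTop (𝓝[>] 0) :=
      tendsto_nhdsWithin_iff.2 ⟨tendsto_one_div_add_atTop_nhds_zero_nat,
        Eventually.of_forall fun k => Set.mem_Ioi.2 (by positivity)⟩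
    refine (h3.comp h4).congr fun k => ?_
    simp only [Function.comp, hS]
    rw [one_div, inv_inv, div_eq_mul_inv]
  set φ : ℕ → ℝ → ℝ := fun k t => Real.exp (s * S k t) with hφ
  have hφd : ∀ k t, HasDerivAt (φ k) (φ k t * (s * Real.cos (t / ((k : ℝ) + 1)))) t :=
    fun k t => ((hSd k t).const_mul s).exp
  have hφs : ∀ k, ContDiff ℝ ∞ (φ k) := fun k => by
    simp only [hφ, hS]
    fun_prop
  have hφb : ∀ k t, |φ k t| ≤ Real.exp (|s| * ((k : ℝ) + 1)) := fun k t => by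
    rw [abs_of_pos (Real.exp_pos _)]
    refine Real.exp_le_exp.2 ((le_abs_self _).trans ?_)
    rw [abs_mul]
    exact mul_le_mul_of_nonneg_left (hS2 k t) (abs_nonneg s)
  have hmem : ∀ k, MemW12A w (fun x => φ k (x i))
      (fun x => deriv (φ k) (x i) • EuclideanSpace.single i (1 : ℝ)) := fun k => by
    refine memW12A_comp_coord hw hi h1 (hφs k)
      (B := Real.exp (|s| * ((k : ℝ) + 1)) * (1 + |s|)) (fun t => ?_) (fun t => ?_)
    · exact (hφb k t).trans (le_mul_of_one_le_right (Real.exp_pos _).le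
        (by linarith [abs_nonneg s]))
    · rw [(hφd k t).deriv, abs_mul]
      refine mul_le_mul (hφb k t) ?_ (abs_nonneg _) (Real.exp_pos _).le
      rw [abs_mul]
      have := mul_le_of_le_one_right (abs_nonneg s) (Real.abs_cos_le_one (t / ((k : ℝ) + 1)))
      linarith
  have key := fun k => hC _ _ (hmem k)
  -- Dominated convergence for powers of the test functions.
  have hdom : ∀ (a : ℝ) (k : ℕ) (x : E n), Real.exp (a * (s * S k (x i))) ≤
      Real.exp ((a * s) * x i) + Real.exp (-(a * s) * x i) := fun a k x => by
    have h2 : a * (s * S k (x i)) ≤ |a * s| * |x i| := by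
      rw [← mul_assoc]
      refine (le_abs_self _).trans ?_
      rw [abs_mul]
      exact mul_le_mul_of_nonneg_left (hS1 k _) (abs_nonneg _)
    rw [← abs_mul] at h2
    rcases abs_cases (a * s * x i) with ⟨h3, -⟩ | ⟨h3, -⟩
    · rw [h3] at h2
      exact (Real.exp_le_exp.2 h2).trans (le_add_of_nonneg_right (Real.exp_pos _).le)
    · rw [h3, ← neg_mul] at h2
      exact (Real.exp_le_exp.2 h2).trans (le_add_of_nonneg_left (Real.exp_pos _).le)
  have hint : ∀ a : ℝ, Integrable
      (fun x : E n => Real.exp ((a * s) * x i) + Real.exp (-(a * s) * x i)) (mu w) := fun a =>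
    (hw.integrable_exp_coord hi _).add (hw.integrable_exp_coord hi _)
  have hScont : ∀ k, Continuous (S k) := fun k => by simp only [hS]; fun_prop
  have hlimexp : ∀ a : ℝ, Tendsto (fun k => ∫ x : E n, Real.exp (a * (s * S k (x i))) ∂(mu w))
      atTop (𝓝 (Real.exp ((a * s) ^ 2 / 2))) := fun a => by
    rw [← hw.integral_exp_coord hi (a * s)]
    refine tendsto_integral_of_dominated_convergence _
      (fun k => Continuous.aestronglyMeasurable (by have := hScont k; fun_prop)) (hint a)
      (fun k => ae_of_all _ fun x => ?_) (ae_of_all _ fun x => ?_)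
    · rw [Real.norm_of_nonneg (Real.exp_pos _).le]
      exact hdom a k x
    · refine (Real.continuous_exp.tendsto _).comp ?_
      simpa only [mul_assoc] using ((hSlim (x i)).const_mul s).const_mul a
  have hlimG : Tendsto (fun k : ℕ => ∫ x : E n, s ^ 2 * (Real.cos (x i / ((k : ℝ) + 1)) ^ 2 *
      Real.exp (2 * (s * S k (x i)))) ∂(mu w)) atTop
      (𝓝 (s ^ 2 * Real.exp ((2 * s) ^ 2 / 2))) := by
    rw [← hw.integral_exp_coord hi (2 * s), ← integral_const_mul]
    refine tendsto_integral_of_dominated_convergence _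
      (fun k => Continuous.aestronglyMeasurable (by have := hScont k; fun_prop))
      ((hint 2).const_mul (s ^ 2))
      (fun k => ae_of_all _ fun x => ?_) (ae_of_all _ fun x => ?_)
    · rw [Real.norm_of_nonneg (by positivity)]
      refine mul_le_mul_of_nonneg_left ?_ (sq_nonneg s)
      exact (mul_le_of_le_one_left (Real.exp_pos _).le (Real.cos_sq_le_one _)).trans (hdom 2 k x)
    · have h2 := ((Real.continuous_cos.tendsto _).comp (hzero (x i))).pow 2
      have h3 := (Real.continuous_exp.tendsto _).comp (((hSlim (x i)).const_mul s).const_mul 2)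
      have h4 := (h2.mul h3).const_mul (s ^ 2)
      simpa [Function.comp_def, mul_assoc] using h4
  have e1 : ∀ k, ∫ x : E n, φ k (x i) ^ 2 ∂(mu w) =
      ∫ x : E n, Real.exp (2 * (s * S k (x i))) ∂(mu w) := fun k => by
    refine integral_congr_ae (ae_of_all _ fun x => ?_)
    simp only [hφ]
    rw [← Real.exp_nat_mul]
    norm_num
  have e2 : ∀ k, ∫ x : E n, |φ k (x i)| ^ p ∂(mu w) =
      ∫ x : E n, Real.exp (p * (s * S k (x i))) ∂(mu w) := fun k => by
    refine integral_congr_ae (ae_of_all _ fun x => ?_)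
    simp only [hφ]
    rw [abs_of_pos (Real.exp_pos _), ← Real.exp_mul, mul_comm]
  have e3 : ∀ k : ℕ, ∫ x : E n, ‖deriv (φ k) (x i) • EuclideanSpace.single i (1 : ℝ)‖ ^ 2 ∂(mu w) =
      ∫ x : E n, s ^ 2 * (Real.cos (x i / ((k : ℝ) + 1)) ^ 2 *
        Real.exp (2 * (s * S k (x i)))) ∂(mu w) := fun k => by
    refine integral_congr_ae (ae_of_all _ fun x => ?_)
    simp only []
    rw [(hφd k _).deriv, norm_smul, PiLp.norm_single, norm_one, mul_one,
      Real.norm_eq_abs, sq_abs, mul_pow, mul_pow]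
    have : φ k (x i) ^ 2 = Real.exp (2 * (s * S k (x i))) := by
      simp only [hφ]
      rw [← Real.exp_nat_mul]
      norm_num
    rw [this]; ring
  simp only [e1, e2, e3] at key
  have hfin := le_of_tendsto_of_tendsto' (((hlimexp 2).sub ((hlimexp p).rpow_const (p := 2 / p)
    (Or.inr (by positivity)))).const_mul (1 / (2 - p))) (hlimG.const_mul C) key
  rw [← Real.exp_mul] at hfin
  have f1 : (2 * s) ^ 2 / 2 = 2 * s ^ 2 := by ring
  have f2 : (p * s) ^ 2 / 2 * (2 / p) = p * s ^ 2 := by field_simp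
  rwa [f1, f2] at hfin

/-- Letting `s → 0` in `BecknerInequality.exp_le`. -/
theorem BecknerInequality.one_le (hC : BecknerInequality w p C) (hw : Star w)
    (hi : ∀ (x : E n) (t : ℝ), w (x + EuclideanSpace.single i t) = w x)
    (h1 : MemW12A w (fun _ => 1) (fun _ => 0)) (hp1 : 1 ≤ p) (hp2 : p < 2) : 1 ≤ C := by
  have h2p : 0 < 2 - p := by linarith
  have key : ∀ s : ℝ, 0 < s → Real.exp (-((2 - p) * s ^ 2)) ≤ C := by
    intro s hs
    have h2 := hC.exp_le hw hi h1 hp1 s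
    have h3 : (2 - p) * s ^ 2 * Real.exp (p * s ^ 2) ≤
        Real.exp (2 * s ^ 2) - Real.exp (p * s ^ 2) := by
      have e : Real.exp (2 * s ^ 2) = Real.exp ((2 - p) * s ^ 2) * Real.exp (p * s ^ 2) := by
        rw [← Real.exp_add]; ring_nf
      rw [e]
      have := Real.add_one_le_exp ((2 - p) * s ^ 2)
      nlinarith [Real.exp_pos (p * s ^ 2)]
    have h4 : s ^ 2 * Real.exp (p * s ^ 2) ≤ C * (s ^ 2 * Real.exp (2 * s ^ 2)) := by
      refine le_trans ?_ h2
      rw [one_div, le_inv_mul_iff₀ h2p]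
      linarith
    have h5 : Real.exp (p * s ^ 2) ≤ C * Real.exp (2 * s ^ 2) := by
      have : 0 < s ^ 2 := by positivity
      refine le_of_mul_le_mul_left ?_ this
      linarith
    have e : Real.exp (-((2 - p) * s ^ 2)) = Real.exp (p * s ^ 2) / Real.exp (2 * s ^ 2) := by
      rw [← Real.exp_sub]; ring_nf
    rw [e, div_le_iff₀ (Real.exp_pos _)]
    exact h5
  have hlim : Tendsto (fun s : ℝ => Real.exp (-((2 - p) * s ^ 2))) (𝓝[>] 0) (𝓝 1) := by
    have : Continuous fun s : ℝ => Real.exp (-((2 - p) * s ^ 2)) := by fun_prop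
    have h2 := (this.tendsto 0).mono_left (nhdsWithin_le_nhds (s := Set.Ioi 0))
    simpa using h2
  exact le_of_tendsto hlim (eventually_mem_nhdsWithin.mono fun s hs => key s hs)

end Sharp

end WeightedGaussian

namespace WeightedGaussian

/-! ### The Sobolev space generated by the test functions -/

section Sobolev

variable {n : ℕ} {w : E n → ℝ} {f : E n → ℝ} {G : E n → E n}

theorem tendsto_eLpNorm_of_bounded {X F : Type*} [MeasurableSpace X] [NormedAddCommGroup F]
    {ν : Measure X} [IsFiniteMeasure ν] {u : ℕ → X → F} {g : X → F} {B : ℝ}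
    (hu : ∀ k, AEStronglyMeasurable (u k) ν) (hB : ∀ k, ∀ᵐ x ∂ν, ‖u k x‖ ≤ B)
    (h : ∀ᵐ x ∂ν, Tendsto (fun k => u k x) atTop (𝓝 (g x))) :
    MemLp g 2 ν ∧ Tendsto (fun k => eLpNorm (fun x => u k x - g x) 2 ν) atTop (𝓝 0) := by
  have hg : MemLp g 2 ν := by
    refine MemLp.of_bound (aestronglyMeasurable_of_tendsto_ae _ hu h) B ?_
    filter_upwards [h, ae_all_iff.2 hB] with x hx hx2
    exact le_of_tendsto' hx.norm hx2
  refine ⟨hg, tendsto_Lp_finite_of_tendsto_ae one_le_two (by simp) hu hg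
    (unifIntegrable_of one_le_two (by simp) hu fun ε _ => ⟨(B + 1).toNNReal, fun k => ?_⟩) h⟩
  have h0 : {x | (B + 1).toNNReal ≤ ‖u k x‖₊}.indicator (u k) =ᵐ[ν] 0 := by
    filter_upwards [hB k] with x hx
    refine Set.indicator_of_notMem (fun hmem => ?_) _
    have h1 : ((B + 1).toNNReal : ℝ) ≤ ‖u k x‖ := hmem
    linarith [Real.le_coe_toNNReal (B + 1)]
  rw [eLpNorm_congr_ae h0, eLpNorm_zero]
  exact zero_le

theorem Star.ae_mem_posSet (hw : Star w) : ∀ᵐ x ∂(mu w), x ∈ posSet w :=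
  Measure.ae_smul_measure ((withDensity_absolutelyContinuous _ _).ae_le
    (ae_restrict_mem hw.isOpen.measurableSet)) _

theorem TestFunctions.memW12A (hw : Star w) (hf : f ∈ TestFunctions (posSet w)) :
    MemW12A w f (gradient f) := by
  have := hw.isProbabilityMeasure
  exact ⟨(TestFunctions.memLp hf 2).1, (TestFunctions.memLp hf 2).2, fun _ => f, fun _ => hf,
    by simp⟩

/-- `W^{1,2}_A` is closed. -/
theorem MemW12A.of_tendsto_eLpNorm {u : ℕ → E n → ℝ} {U : ℕ → E n → E n}
    (hu : ∀ k, MemW12A w (u k) (U k)) (hf : MemLp f 2 (mu w)) (hG : MemLp G 2 (mu w))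
    (h : Tendsto (fun k => eLpNorm (fun x => u k x - f x) 2 (mu w) +
      eLpNorm (fun x => U k x - G x) 2 (mu w)) atTop (𝓝 0)) : MemW12A w f G := by
  -- A diagonal sequence.
  have hex : ∀ k : ℕ, ∃ v ∈ TestFunctions (posSet w),
      eLpNorm (fun x => v x - u k x) 2 (mu w) + eLpNorm (fun x => gradient v x - U k x) 2 (mu w) ≤
        ENNReal.ofReal (1 / ((k : ℝ) + 1)) := fun k => by
    obtain ⟨-, -, v, hv, hlim⟩ := hu k
    obtain ⟨j, hj⟩ := (hlim.eventually_le_const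
      (ENNReal.ofReal_pos.2 (show (0 : ℝ) < 1 / ((k : ℝ) + 1) by positivity))).exists
    exact ⟨v j, hv j, hj⟩
  choose v hv hvle using hex
  refine ⟨hf, hG, v, hv, ?_⟩
  have hlim : Tendsto (fun k : ℕ => ENNReal.ofReal (1 / ((k : ℝ) + 1))) atTop (𝓝 0) := by
    rw [← ENNReal.ofReal_zero]
    exact ENNReal.tendsto_ofReal tendsto_one_div_add_atTop_nhds_zero_nat
  have hsum := hlim.add h
  rw [add_zero] at hsum
  refine tendsto_of_tendsto_of_tendsto_of_le_of_le tendsto_const_nhds hsum (fun _ => zero_le)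
    fun k => ?_
  have b1 : eLpNorm (fun x => v k x - f x) 2 (mu w) ≤
      eLpNorm (fun x => v k x - u k x) 2 (mu w) + eLpNorm (fun x => u k x - f x) 2 (mu w) := by
    have e : (fun x => v k x - f x) = (fun x => v k x - u k x) + fun x => u k x - f x :=
      funext fun x => by simp
    rw [e]
    exact eLpNorm_add_le ((hv k).1.continuous.aestronglyMeasurable.sub (hu k).1.1)
      ((hu k).1.1.sub hf.1) one_le_two
  have b2 : eLpNorm (fun x => gradient (v k) x - G x) 2 (mu w) ≤
      eLpNorm (fun x => gradient (v k) x - U k x) 2 (mu w) +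
        eLpNorm (fun x => U k x - G x) 2 (mu w) := by
    have e : (fun x => gradient (v k) x - G x) =
        (fun x => gradient (v k) x - U k x) + fun x => U k x - G x :=
      funext fun x => by simp
    rw [e]
    exact eLpNorm_add_le
      ((contDiff_gradient (hv k).1).continuous.aestronglyMeasurable.sub (hu k).2.1.1)
      ((hu k).2.1.1.sub hG.1) one_le_two
  calc _ ≤ _ := add_le_add b1 b2
    _ = (eLpNorm (fun x => v k x - u k x) 2 (mu w) +
          eLpNorm (fun x => gradient (v k) x - U k x) 2 (mu w)) +
        (eLpNorm (fun x => u k x - f x) 2 (mu w) + eLpNorm (fun x => U k x - G x) 2 (mu w)) := by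
      abel
    _ ≤ _ := add_le_add (hvle k) le_rfl

theorem MemW12A.of_tendsto_of_bounded (hw : Star w) {u : ℕ → E n → ℝ} {U : ℕ → E n → E n}
    (hu : ∀ k, MemW12A w (u k) (U k)) {B : ℝ} (hB : ∀ k, ∀ x ∈ posSet w, |u k x| ≤ B)
    (hB' : ∀ k, ∀ x ∈ posSet w, ‖U k x‖ ≤ B)
    (h : ∀ x ∈ posSet w, Tendsto (fun k => u k x) atTop (𝓝 (f x)))
    (h' : ∀ x ∈ posSet w, Tendsto (fun k => U k x) atTop (𝓝 (G x))) : MemW12A w f G := by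
  have := hw.isProbabilityMeasure
  have h1 := tendsto_eLpNorm_of_bounded (fun k => (hu k).1.1)
    (fun k => hw.ae_mem_posSet.mono fun x hx => hB k x hx) (hw.ae_mem_posSet.mono h)
  have h2 := tendsto_eLpNorm_of_bounded (fun k => (hu k).2.1.1)
    (fun k => hw.ae_mem_posSet.mono fun x hx => hB' k x hx) (hw.ae_mem_posSet.mono h')
  refine .of_tendsto_eLpNorm hu h1.1 h2.1 ?_
  simpa using h1.2.add h2.2

theorem inner_gradient (u : E n → ℝ) (x v : E n) :
    inner ℝ (gradient u x) v = fderiv ℝ u x v := by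
  rw [gradient_eq_riesz, inner_riesz]

theorem gradient_of_notMem_tsupport {u : E n → ℝ} {x : E n} (h : x ∉ tsupport u) :
    gradient u x = 0 := by
  rw [gradient_eq_riesz, fderiv_of_notMem_tsupport ℝ h, map_zero]

theorem gradient_add {u v : E n → ℝ} {x : E n} (hu : DifferentiableAt ℝ u x)
    (hv : DifferentiableAt ℝ v x) :
    gradient (fun y => u y + v y) x = gradient u x + gradient v x := by
  simp only [gradient_eq_riesz]
  rw [fderiv_fun_add hu hv, map_add]

theorem TestFunctions.zero_mem (S : Set (E n)) : (fun _ => 0) ∈ TestFunctions S :=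
  ⟨contDiff_const, HasCompactSupport.zero, fun x _ η _ => by simp⟩

theorem TestFunctions.add_mem {S : Set (E n)} {u v : E n → ℝ} (hu : u ∈ TestFunctions S)
    (hv : v ∈ TestFunctions S) : (fun x => u x + v x) ∈ TestFunctions S :=
  ⟨hu.1.add hv.1, hu.2.1.add hv.2.1, fun x hx η hη => by
    rw [gradient_add (hu.1.differentiable (by simp) x) (hv.1.differentiable (by simp) x),
      inner_add_left, hu.2.2 x hx η hη, hv.2.2 x hx η hη, add_zero]⟩

theorem MemW12A.add {f' : E n → ℝ} {G' : E n → E n} (h : MemW12A w f G)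
    (h' : MemW12A w f' G') : MemW12A w (fun x => f x + f' x) (fun x => G x + G' x) := by
  obtain ⟨hf, hG, u, hu, hlim⟩ := h
  obtain ⟨hf', hG', u', hu', hlim'⟩ := h'
  refine ⟨hf.add hf', hG.add hG', fun k x => u k x + u' k x,
    fun k => TestFunctions.add_mem (hu k) (hu' k), ?_⟩
  have hsum := hlim.add hlim'
  rw [add_zero] at hsum
  refine tendsto_of_tendsto_of_tendsto_of_le_of_le tendsto_const_nhds hsum (fun _ => zero_le)
    fun k => ?_
  have b1 : eLpNorm (fun x => u k x + u' k x - (f x + f' x)) 2 (mu w) ≤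
      eLpNorm (fun x => u k x - f x) 2 (mu w) + eLpNorm (fun x => u' k x - f' x) 2 (mu w) := by
    have e : (fun x => u k x + u' k x - (f x + f' x)) =
        (fun x => u k x - f x) + fun x => u' k x - f' x :=
      funext fun x => by simp only [Pi.add_apply]; abel
    rw [e]
    exact eLpNorm_add_le ((hu k).1.continuous.aestronglyMeasurable.sub hf.1)
      ((hu' k).1.continuous.aestronglyMeasurable.sub hf'.1) one_le_two
  have b2 : eLpNorm (fun x => gradient (fun y => u k y + u' k y) x - (G x + G' x)) 2 (mu w) ≤
      eLpNorm (fun x => gradient (u k) x - G x) 2 (mu w) +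
        eLpNorm (fun x => gradient (u' k) x - G' x) 2 (mu w) := by
    have e : (fun x => gradient (fun y => u k y + u' k y) x - (G x + G' x)) =
        (fun x => gradient (u k) x - G x) + fun x => gradient (u' k) x - G' x :=
      funext fun x => by
        rw [gradient_add ((hu k).1.differentiable (by simp) x)
          ((hu' k).1.differentiable (by simp) x), Pi.add_apply]
        abel
    rw [e]
    exact eLpNorm_add_le
      ((contDiff_gradient (hu k).1).continuous.aestronglyMeasurable.sub hG.1)
      ((contDiff_gradient (hu' k).1).continuous.aestronglyMeasurable.sub hG'.1) one_le_two
  exact (add_le_add b1 b2).trans (le_of_eq (by abel))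

theorem MemW12A.sum (hw : Star w) {ι : Type*} (t : Finset ι) {f : ι → E n → ℝ}
    {G : ι → E n → E n} (h : ∀ i, MemW12A w (f i) (G i)) :
    MemW12A w (fun x => ∑ i ∈ t, f i x) (fun x => ∑ i ∈ t, G i x) := by
  classical
  induction t using Finset.induction_on with
  | empty => simpa using TestFunctions.memW12A hw (TestFunctions.zero_mem (posSet w))
  | insert i t hi ih =>
    simp only [Finset.sum_insert hi]
    exact (h i).add ih

/-! ### Membership of the constant function -/

/-- Smooth radial cutoffs, equal to `1` on the ball of radius `k + 1`. -/
noncomputable def cutoff (k : ℕ) (x : E n) : ℝ :=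
  Real.smoothTransition (2 - ‖((k : ℝ) + 1)⁻¹ • x‖ ^ 2)

theorem contDiff_cutoff (k : ℕ) : ContDiff ℝ ∞ (cutoff (n := n) k) :=
  Real.smoothTransition.contDiff.comp
    (contDiff_const.sub ((contDiff_const_smul _).norm_sq ℝ))

theorem norm_scale (k : ℕ) (x : E n) : ‖((k : ℝ) + 1)⁻¹ • x‖ = ‖x‖ / ((k : ℝ) + 1) := by
  rw [norm_smul, norm_inv, Real.norm_of_nonneg (by positivity), div_eq_inv_mul]

theorem hasCompactSupport_cutoff (k : ℕ) : HasCompactSupport (cutoff (n := n) k) := by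
  refine HasCompactSupport.of_support_subset_isCompact
    (isCompact_closedBall (0 : E n) (2 * ((k : ℝ) + 1))) fun x hx => ?_
  rw [mem_closedBall_zero_iff]
  by_contra hlt
  rw [not_le] at hlt
  refine hx (Real.smoothTransition.zero_of_nonpos ?_)
  rw [norm_scale]
  have : 2 ≤ ‖x‖ / ((k : ℝ) + 1) := (le_div_iff₀ (by positivity)).2 hlt.le
  nlinarith

theorem abs_cutoff_le (k : ℕ) (x : E n) : |cutoff k x| ≤ 1 := by
  rw [cutoff, abs_of_nonneg (Real.smoothTransition.nonneg _)]
  exact Real.smoothTransition.le_one _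

theorem cutoff_eq_one {k : ℕ} {x : E n} (hx : ‖x‖ ≤ k + 1) : cutoff k x = 1 := by
  refine Real.smoothTransition.one_of_one_le ?_
  rw [norm_scale]
  have : ‖x‖ / ((k : ℝ) + 1) ≤ 1 := (div_le_one (by positivity)).2 hx
  have h0 : 0 ≤ ‖x‖ / ((k : ℝ) + 1) := by positivity
  nlinarith

theorem exists_norm_gradient_cutoff_le : ∃ B, ∀ (k : ℕ) (x : E n), ‖gradient (cutoff k) x‖ ≤ B := by
  obtain ⟨B, hB⟩ := ((hasCompactSupport_cutoff (n := n) 0).fderiv ℝ).exists_bound_of_continuous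
    ((contDiff_cutoff 0).continuous_fderiv (by simp))
  refine ⟨B, fun k x => ?_⟩
  have e : (cutoff k : E n → ℝ) = fun x => cutoff 0 (((k : ℝ) + 1)⁻¹ • x) := by
    funext x
    simp [cutoff]
  have hk : ((k : ℝ) + 1)⁻¹ ≤ 1 := inv_le_one_of_one_le₀ (by linarith [Nat.cast_nonneg (α := ℝ) k])
  rw [norm_gradient, e, fderiv_comp_smul, norm_smul, norm_inv, Real.norm_of_nonneg (by positivity)]
  exact (mul_le_of_le_one_left (norm_nonneg _) hk).trans (hB _)

theorem inner_gradient_cutoff_eq_zero (k : ℕ) {x v : E n} (h : inner ℝ x v = 0) :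
    inner ℝ (gradient (cutoff k) x) v = 0 := by
  rw [inner_gradient]
  have h1 : HasFDerivAt (fun y : E n => ((k : ℝ) + 1)⁻¹ • y)
      (((k : ℝ) + 1)⁻¹ • ContinuousLinearMap.id ℝ (E n)) x := (hasFDerivAt_id x).fun_const_smul _
  have h2 := (h1.norm_sq.const_sub 2)
  have h3 : DifferentiableAt ℝ Real.smoothTransition (2 - ‖((k : ℝ) + 1)⁻¹ • x‖ ^ 2) :=
    (Real.smoothTransition.contDiff (n := 1)).differentiable (by simp) _
  have h4 := h3.hasDerivAt.comp_hasFDerivAt x h2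
  have e : (cutoff k : E n → ℝ) =
      Real.smoothTransition ∘ fun y : E n => 2 - ‖((k : ℝ) + 1)⁻¹ • y‖ ^ 2 := rfl
  rw [e, h4.fderiv]
  simp [h]

/-- The constant function belongs to `W^{1,2}_A` as soon as all radial cutoffs do. -/
theorem memW12A_one_of_cutoff (hw : Star w)
    (h : ∀ k, MemW12A w (cutoff k) (gradient (cutoff k))) :
    MemW12A w (fun _ => 1) (fun _ => 0) := by
  obtain ⟨B, hB⟩ := exists_norm_gradient_cutoff_le (n := n)
  have hev : ∀ x : E n, ∀ᶠ k : ℕ in atTop, ‖x‖ + 1 ≤ (k : ℝ) := fun x =>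
    tendsto_natCast_atTop_atTop.eventually_ge_atTop _
  refine .of_tendsto_of_bounded hw h (B := max 1 B)
    (fun k x _ => (abs_cutoff_le k x).trans (le_max_left _ _))
    (fun k x _ => (hB k x).trans (le_max_right _ _)) (fun x _ => ?_) (fun x _ => ?_)
  · refine tendsto_const_nhds.congr' ((hev x).mono fun k hk => ?_)
    exact (cutoff_eq_one (by linarith)).symm
  · refine tendsto_const_nhds.congr' ((hev x).mono fun k hk => ?_)
    have hloc : (cutoff k : E n → ℝ) =ᶠ[𝓝 x] fun _ => 1 := by
      filter_upwards [Metric.ball_mem_nhds x one_pos] with y hy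
      refine cutoff_eq_one ?_
      have h1 := norm_le_norm_add_norm_sub' y x
      rw [← dist_eq_norm] at h1
      linarith [Metric.mem_ball.1 hy]
    change 0 = gradient (cutoff k) x
    rw [gradient_eq_riesz, hloc.fderiv_eq, fderiv_const_apply, map_zero]

theorem IsOuterNormal.inner_sub_le {S : Set (E n)} {x η y : E n} (h : IsOuterNormal S x η)
    (hy : y ∈ closure S) : inner ℝ η (y - x) ≤ 0 := by
  have hc : IsClosed {y : E n | inner ℝ η (y - x) ≤ 0} :=
    isClosed_le (by fun_prop) continuous_const
  exact closure_minimal (fun z hz => h.2 z hz) hc hy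

theorem IsCone.smul_mem_closure {S : Set (E n)} (h : IsCone S) {x : E n} (hx : x ∈ closure S)
    {t : ℝ} (ht : 0 < t) : t • x ∈ closure S :=
  map_mem_closure (continuous_const_smul t) hx fun y hy => h y hy t ht

theorem memW12A_one_of_isCone (hw : Star w) (hc : IsCone (posSet w)) :
    MemW12A w (fun _ => 1) (fun _ => 0) := by
  refine memW12A_one_of_cutoff hw fun k => TestFunctions.memW12A hw
    ⟨contDiff_cutoff k, hasCompactSupport_cutoff k, fun x hx η hη => ?_⟩
  -- The ray through a boundary point lies in the closure of the cone, so an outer normal is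
  -- orthogonal to it.
  have hx' := frontier_subset_closure hx
  have h1 := hη.inner_sub_le (hc.smul_mem_closure hx' two_pos)
  have h2 := hη.inner_sub_le (hc.smul_mem_closure hx' (one_half_pos (α := ℝ)))
  have e1 : (2 : ℝ) • x - x = x := by module
  have e2 : (1 / 2 : ℝ) • x - x = (-(1 / 2) : ℝ) • x := by module
  rw [e1] at h1
  rw [e2, inner_smul_right] at h2
  refine inner_gradient_cutoff_eq_zero k ?_
  rw [real_inner_comm]
  linarith

end Sobolev

end WeightedGaussian

namespace WeightedGaussian

/-! ### Smooth boundaries -/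

section SmoothBoundary

variable {n : ℕ} {w : E n → ℝ}

/-- At a point where the boundary is a regular level set, an outer normal is orthogonal to the
kernel of the differential of the defining function. -/
theorem IsOuterNormal.inner_eq_zero_of_fderiv_eq_zero {S : Set (E n)} {ρ : E n → ℝ} {x η v : E n}
    (hη : IsOuterNormal S x η) (hρ : DifferentiableAt ℝ ρ x) (h0 : ρ x = 0)
    (hne : fderiv ℝ ρ x ≠ 0) (hS : ∀ᶠ y in 𝓝 x, y ∈ S ↔ ρ y < 0) (hv : fderiv ℝ ρ x v = 0) :
    inner ℝ η v = 0 := by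
  have key : ∀ u : E n, fderiv ℝ ρ x u < 0 → inner ℝ η u ≤ 0 := by
    intro u hu
    have hline : HasDerivAt (fun t : ℝ => ρ (x + t • u)) (fderiv ℝ ρ x u) 0 :=
      hρ.hasFDerivAt.hasLineDerivAt u
    have hslope := hline.tendsto_slope_zero_right
    simp only [zero_add, zero_smul, add_zero, h0, sub_zero, smul_eq_mul] at hslope
    have hcont : Tendsto (fun t : ℝ => x + t • u) (𝓝[>] 0) (𝓝 x) := by
      have : Continuous fun t : ℝ => x + t • u := by fun_prop
      simpa using (this.tendsto 0).mono_left nhdsWithin_le_nhds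
    obtain ⟨t, h1, h2, ht⟩ := ((hslope.eventually_lt_const hu).and
      ((hcont.eventually hS).and self_mem_nhdsWithin)).exists
    have ht0 : 0 < t := ht
    have hneg : ρ (x + t • u) < 0 := by
      by_contra hge
      exact absurd h1 (not_lt.2 (mul_nonneg (inv_nonneg.2 ht0.le) (not_lt.1 hge)))
    have h3 := hη.2 _ (h2.2 hneg)
    rw [add_sub_cancel_left, inner_smul_right] at h3
    exact nonpos_of_mul_nonpos_right h3 ht0
  obtain ⟨g, hg⟩ : ∃ g, fderiv ℝ ρ x g < 0 := by
    obtain ⟨g, hg⟩ := DFunLike.ne_iff.1 hne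
    rcases lt_or_gt_of_ne hg with h | h
    · exact ⟨g, h⟩
    · exact ⟨-g, by simpa using h⟩
  have hle : ∀ u : E n, fderiv ℝ ρ x u = 0 → inner ℝ η u ≤ 0 := by
    intro u hu
    have hcont : Continuous fun ε : ℝ => inner ℝ η (u + ε • g) := by fun_prop
    have hlim := (hcont.tendsto 0).mono_left (nhdsWithin_le_nhds (s := Set.Ioi 0))
    simp only [zero_smul, add_zero] at hlim
    refine le_of_tendsto hlim (eventually_mem_nhdsWithin.mono fun ε hε => key _ ?_)
    rw [map_add, map_smul, hu, zero_add, smul_eq_mul]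
    exact mul_neg_of_pos_of_neg hε hg
  refine le_antisymm (hle v hv) ?_
  have := hle (-v) (by rw [map_neg, hv, neg_zero])
  rw [inner_neg_right] at this
  linarith

theorem contDiff_div_of_tsupport {f g : E n → ℝ} {U : Set (E n)} (hf : ContDiff ℝ ∞ f)
    (hg : ContDiff ℝ ∞ g) (hU : tsupport f ⊆ U) (h : ∀ x ∈ U, g x ≠ 0) :
    ContDiff ℝ ∞ fun x => f x / g x := by
  refine contDiff_iff_contDiffAt.2 fun x => ?_
  by_cases hx : x ∈ tsupport f
  · exact hf.contDiffAt.div hg.contDiffAt (h x (hU hx))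
  · refine (contDiffAt_const (c := 0)).congr_of_eventuallyEq ?_
    filter_upwards [notMem_tsupport_iff_eventuallyEq.1 hx] with y hy
    simp [hy]

/-- The function `t ↦ arctan (m t) / m` with `m = k + 1`: it is uniformly small, has derivative
`1` at the origin, and its derivative tends to `0` away from the origin. -/
noncomputable def layer (k : ℕ) (t : ℝ) : ℝ := Real.arctan (((k : ℝ) + 1) * t) / ((k : ℝ) + 1)

theorem hasDerivAt_layer (k : ℕ) (t : ℝ) :
    HasDerivAt (layer k) (1 / (1 + (((k : ℝ) + 1) * t) ^ 2)) t := by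
  have hk : ((k : ℝ) + 1) ≠ 0 := by positivity
  have := (((hasDerivAt_id t).const_mul ((k : ℝ) + 1)).arctan).div_const ((k : ℝ) + 1)
  refine this.congr_deriv ?_
  simp only [id]
  field_simp

theorem contDiff_layer (k : ℕ) : ContDiff ℝ ∞ (layer k) :=
  (contDiff_const.mul contDiff_id).arctan.div_const _

theorem abs_layer_le (k : ℕ) (t : ℝ) : |layer k t| ≤ 2 * (1 / ((k : ℝ) + 1)) := by
  have hk : (0 : ℝ) < (k : ℝ) + 1 := by positivity
  rw [layer, abs_div, abs_of_pos hk, ← mul_one_div]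
  refine mul_le_mul_of_nonneg_right ?_ (by positivity)
  have h1 := Real.arctan_lt_pi_div_two (((k : ℝ) + 1) * t)
  have h2 := Real.neg_pi_div_two_lt_arctan (((k : ℝ) + 1) * t)
  have h3 := Real.pi_lt_four
  exact abs_le.2 ⟨by linarith, by linarith⟩

theorem tendsto_layer (t : ℝ) : Tendsto (fun k => layer k t) atTop (𝓝 0) := by
  refine squeeze_zero_norm (fun k => abs_layer_le k t) ?_
  simpa using (tendsto_one_div_add_atTop_nhds_zero_nat (𝕜 := ℝ)).const_mul 2

theorem abs_layer_le_two (k : ℕ) (t : ℝ) : |layer k t| ≤ 2 := by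
  refine (abs_layer_le k t).trans ?_
  have : 1 / ((k : ℝ) + 1) ≤ 1 :=
    (div_le_one (by positivity)).2 (by linarith [Nat.cast_nonneg (α := ℝ) k])
  linarith

theorem tendsto_deriv_layer {t : ℝ} (ht : t ≠ 0) :
    Tendsto (fun k : ℕ => 1 / (1 + (((k : ℝ) + 1) * t) ^ 2)) atTop (𝓝 0) := by
  have h1 : Tendsto (fun k : ℕ => (k : ℝ) + 1) atTop atTop :=
    tendsto_atTop_add_const_right _ _ tendsto_natCast_atTop_atTop
  have h2 : Tendsto (fun k : ℕ => 1 + ((k : ℝ) + 1) ^ 2 * t ^ 2) atTop atTop :=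
    tendsto_atTop_add_const_left _ _
      (((tendsto_pow_atTop two_ne_zero).comp h1).atTop_mul_const (by positivity))
  simp only [one_div, mul_pow]
  exact h2.inv_tendsto_atTop

/-- A smooth function supported near a regular boundary point is the limit of functions with
vanishing normal derivative: a boundary layer removes its normal derivative. -/
theorem memW12A_of_tsupport_subset (hw : Star w) {ρ f : E n → ℝ} {U : Set (E n)}
    (hρ : ContDiff ℝ ∞ ρ) (hU : IsOpen U) (hne : ∀ x ∈ U, fderiv ℝ ρ x ≠ 0)
    (hS : ∀ x ∈ U, x ∈ posSet w ↔ ρ x < 0) (hf : ContDiff ℝ ∞ f) (hc : HasCompactSupport f)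
    (hfU : tsupport f ⊆ U) : MemW12A w f (gradient f) := by
  set b : E n → ℝ := fun x => inner ℝ (gradient f x) (gradient ρ x) / ‖gradient ρ x‖ ^ 2 with hb
  have hg0 : ∀ x ∈ U, gradient ρ x ≠ 0 := fun x hx h => by
    have := norm_gradient ρ x
    rw [h, norm_zero] at this
    exact hne x hx (norm_eq_zero.1 this.symm)
  have hsub : (tsupport fun x => inner ℝ (gradient f x) (gradient ρ x)) ⊆ tsupport f := by
    refine closure_minimal (fun x hx => ?_) (isClosed_tsupport f)
    by_contra hn
    refine hx ?_
    simp [gradient_of_notMem_tsupport hn]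
  have hbs : ContDiff ℝ ∞ b :=
    contDiff_div_of_tsupport ((contDiff_gradient hf).inner ℝ (contDiff_gradient hρ))
      ((contDiff_gradient hρ).norm_sq ℝ) (hsub.trans hfU)
      fun x hx => pow_ne_zero _ (norm_ne_zero_iff.2 (hg0 x hx))
  have hbt : tsupport b ⊆ tsupport f := by
    refine closure_minimal (fun x hx => ?_) (isClosed_tsupport f)
    by_contra hn
    refine hx ?_
    simp [hb, gradient_of_notMem_tsupport hn]
  have hbc : HasCompactSupport b := hc.mono' ((subset_tsupport b).trans hbt)
  have hρd := hρ.differentiable (by simp)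
  have hgrad : ∀ k x, gradient (fun y => f y - layer k (ρ y) * b y) x = gradient f x -
      (layer k (ρ x) • gradient b x +
        (1 / (1 + (((k : ℝ) + 1) * ρ x) ^ 2)) • (b x • gradient ρ x)) := by
    intro k x
    have h1 := (hasDerivAt_layer k (ρ x)).comp_hasFDerivAt x (hρd x).hasFDerivAt
    have h2 := (hf.differentiable (by simp) x).hasFDerivAt.fun_sub
      (h1.fun_mul (hbs.differentiable (by simp) x).hasFDerivAt)
    have h3 := h2.fderiv
    simp only [Function.comp] at h3
    simp only [gradient_eq_riesz]
    rw [h3]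
    simp only [map_sub, map_add, map_smul, smul_smul]
    rw [mul_comm (b x)]
  have hmem : ∀ k, (fun y => f y - layer k (ρ y) * b y) ∈ TestFunctions (posSet w) := by
    intro k
    refine ⟨hf.sub (((contDiff_layer k).comp hρ).mul hbs), hc.sub hbc.mul_left,
      fun x hx η hη => ?_⟩
    rw [hgrad]
    by_cases hxU : x ∈ U
    · have hxS : x ∉ posSet w := fun h => hw.isOpen.inter_frontier_eq.subset ⟨h, hx⟩
      have hev : ∀ᶠ y in 𝓝 x, y ∈ posSet w ↔ ρ y < 0 :=
        eventually_of_mem (hU.mem_nhds hxU) hS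
      have h0 : ρ x = 0 := by
        refine le_antisymm ?_ (not_lt.1 fun h => hxS ((hS x hxU).2 h))
        by_contra hpos
        rw [not_le] at hpos
        have h1 : ∀ᶠ y in 𝓝 x, 0 < ρ y := hρ.continuous.continuousAt.eventually_const_lt hpos
        obtain ⟨y, hy, hyS⟩ := mem_closure_iff_nhds.1 (frontier_subset_closure hx) _
          (h1.and hev)
        exact absurd (hy.2.1 hyS) (not_lt.2 hy.1.le)
      rw [h0, real_inner_comm]
      have hl0 : layer k 0 = 0 := by simp [layer]
      rw [hl0]
      refine hη.inner_eq_zero_of_fderiv_eq_zero (hρd x) h0 (hne x hxU) hev ?_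
      rw [← inner_gradient]
      have hn0 := norm_ne_zero_iff.2 (hg0 x hxU)
      simp only [zero_smul, zero_add, mul_zero, ne_eq, OfNat.ofNat_ne_zero, not_false_eq_true,
        zero_pow, add_zero, div_one, one_smul]
      rw [inner_sub_right, inner_smul_right, real_inner_self_eq_norm_sq, hb]
      simp only
      rw [div_mul_cancel₀ _ (pow_ne_zero 2 hn0), real_inner_comm, sub_self]
    · have hxf : x ∉ tsupport f := fun h => hxU (hfU h)
      have hxb : x ∉ tsupport b := fun h => hxf (hbt h)
      simp [gradient_of_notMem_tsupport hxf, gradient_of_notMem_tsupport hxb,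
        image_eq_zero_of_notMem_tsupport hxb]
  obtain ⟨B₁, hB₁⟩ := hc.exists_bound_of_continuous hf.continuous
  obtain ⟨B₂, hB₂⟩ := hbc.exists_bound_of_continuous hbs.continuous
  obtain ⟨B₃, hB₃⟩ := (hasCompactSupport_gradient hc).exists_bound_of_continuous
    (contDiff_gradient hf).continuous
  obtain ⟨B₄, hB₄⟩ := (hasCompactSupport_gradient hbc).exists_bound_of_continuous
    (contDiff_gradient hbs).continuous
  obtain ⟨B₅, hB₅⟩ := (hbc.smul_right (f' := gradient ρ)).exists_bound_of_continuous
    (hbs.continuous.smul (contDiff_gradient hρ).continuous)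
  refine .of_tendsto_of_bounded hw (fun k => TestFunctions.memW12A hw (hmem k))
    (B := max (B₁ + 2 * B₂) (B₃ + (2 * B₄ + B₅))) (fun k x _ => ?_) (fun k x _ => ?_)
    (fun x _ => ?_) (fun x hx => ?_)
  · refine le_trans ((abs_sub _ _).trans (add_le_add (hB₁ x) ?_)) (le_max_left _ _)
    rw [abs_mul]
    exact mul_le_mul (abs_layer_le_two k _) (hB₂ x) (abs_nonneg _) two_pos.le
  · rw [hgrad]
    refine le_trans ((norm_sub_le _ _).trans (add_le_add (hB₃ x) ((norm_add_le _ _).trans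
      (add_le_add ?_ ?_)))) (le_max_right _ _)
    · rw [norm_smul]
      exact mul_le_mul (abs_layer_le_two k _) (hB₄ x) (norm_nonneg _) two_pos.le
    · rw [norm_smul, Real.norm_of_nonneg (by positivity)]
      refine (mul_le_of_le_one_left (norm_nonneg _) ?_).trans (hB₅ x)
      exact (div_le_one (by positivity)).2 (by linarith [sq_nonneg (((k : ℝ) + 1) * ρ x)])
  · have := ((tendsto_layer (ρ x)).mul_const (b x)).const_sub (f x)
    simpa using this
  · simp only [hgrad]
    have h2 : Tendsto (fun k : ℕ => (1 / (1 + (((k : ℝ) + 1) * ρ x) ^ 2)) • (b x • gradient ρ x))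
        atTop (𝓝 0) := by
      by_cases hxU : x ∈ U
      · have := (tendsto_deriv_layer ((hS x hxU).1 hx).ne).smul_const (b x • gradient ρ x)
        rwa [zero_smul] at this
      · have hxb : b x = 0 := image_eq_zero_of_notMem_tsupport fun h => hxU (hfU (hbt h))
        simp [hxb]
    have h1 := (tendsto_layer (ρ x)).smul_const (gradient b x)
    have := (h1.add h2).const_sub (gradient f x)
    simpa using this

/-- Away from the boundary there is no condition on the normal derivative; near it,
`memW12A_of_tsupport_subset` applies. -/
theorem HasSmoothBoundary.exists_nhds (hw : Star w) (hs : HasSmoothBoundary (posSet w)) (x : E n) :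
    ∃ U : Set (E n), IsOpen U ∧ x ∈ U ∧ ∀ f : E n → ℝ, ContDiff ℝ ∞ f → HasCompactSupport f →
      tsupport f ⊆ U → MemW12A w f (gradient f) := by
  by_cases hx : x ∈ frontier (posSet w)
  · obtain ⟨ρ, hρ, hne, hev⟩ := hs x hx
    have hρ' : ContDiff ℝ ∞ (fderiv ℝ ρ) := hρ.fderiv_right (by simp)
    have hev2 : ∀ᶠ y in 𝓝 x, fderiv ℝ ρ y ≠ 0 :=
      hρ'.continuous.continuousAt.eventually_ne hne
    obtain ⟨U, hU, hUo, hxU⟩ := eventually_nhds_iff.1 (hev.and hev2)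
    exact ⟨U, hUo, hxU, fun f hf hc hfU => memW12A_of_tsupport_subset hw hρ hUo
      (fun y hy => (hU y hy).2) (fun y hy => (hU y hy).1) hf hc hfU⟩
  · refine ⟨(frontier (posSet w))ᶜ, isClosed_frontier.isOpen_compl, hx, fun f hf hc hfU =>
      TestFunctions.memW12A hw ⟨hf, hc, fun y hy η _ => ?_⟩⟩
    rw [gradient_of_notMem_tsupport fun h => hfU h hy, inner_zero_left]

/-- If the boundary is smooth, every smooth compactly supported function lies in `W^{1,2}_A`,
whatever its normal derivative. -/
theorem HasSmoothBoundary.memW12A (hw : Star w) (hs : HasSmoothBoundary (posSet w))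
    {ψ : E n → ℝ} (hψ : ContDiff ℝ ∞ ψ) (hc : HasCompactSupport ψ) :
    MemW12A w ψ (gradient ψ) := by
  choose U hUo hxU hU using HasSmoothBoundary.exists_nhds hw hs
  obtain ⟨ζ, hζ⟩ := SmoothPartitionOfUnity.exists_isSubordinate (modelWithCornersSelf ℝ (E n))
    isClosed_univ U hUo fun x _ => Set.mem_iUnion.2 ⟨x, hxU x⟩
  have hζs : ∀ i, ContDiff ℝ ∞ (ζ i) := fun i => contMDiff_iff_contDiff.1 (ζ i).contMDiff
  have hprod : ∀ i, ContDiff ℝ ∞ fun x => ζ i x * ψ x := fun i => (hζs i).mul hψ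
  have hmem : ∀ i, MemW12A w (fun x => ζ i x * ψ x) (gradient fun x => ζ i x * ψ x) := fun i =>
    hU i _ (hprod i) hc.mul_left ((tsupport_mul_subset_left).trans (hζ i))
  have hfin := ζ.locallyFinite.finite_nonempty_inter_compact hc
  have hsum : ψ = fun x => ∑ i ∈ hfin.toFinset, ζ i x * ψ x := by
    funext x
    by_cases hx : x ∈ tsupport ψ
    · have h1 := ζ.sum_eq_one (Set.mem_univ x)
      rw [finsum_eq_sum_of_support_subset (s := hfin.toFinset) _ fun i hi => by
        simpa using ⟨x, hi, hx⟩] at h1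
      rw [← Finset.sum_mul, h1, one_mul]
    · simp [image_eq_zero_of_notMem_tsupport hx]
  have hgrad : gradient ψ = fun x => ∑ i ∈ hfin.toFinset, gradient (fun y => ζ i y * ψ y) x := by
    funext x
    conv_lhs => rw [hsum]
    simp only [gradient_eq_riesz]
    rw [fderiv_fun_sum fun i _ => (hprod i).differentiable (by simp) x, map_sum]
  rw [hgrad]
  nth_rewrite 1 [hsum]
  exact MemW12A.sum hw _ hmem

theorem memW12A_one_of_hasSmoothBoundary (hw : Star w) (hs : HasSmoothBoundary (posSet w)) :
    MemW12A w (fun _ => 1) (fun _ => 0) :=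
  memW12A_one_of_cutoff hw fun k => hs.memW12A hw (contDiff_cutoff k) (hasCompactSupport_cutoff k)

end SmoothBoundary

end WeightedGaussian

theorem theorem1p2 {n : ℕ} (hn : 0 < n) (w : WeightedGaussian.E n → ℝ)
    (hw : WeightedGaussian.Star w) (p : ℝ) (hp1 : 1 ≤ p) (hp2 : p < 2) :
    WeightedGaussian.BecknerInequality w p (1 / (1 + WeightedGaussian.curvature w)) ∧
    (WeightedGaussian.IsPartial w → 0 ≤ WeightedGaussian.curvature w →
      (WeightedGaussian.IsCone (WeightedGaussian.posSet w) ∨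
        WeightedGaussian.HasSmoothBoundary (WeightedGaussian.posSet w) ∨
        WeightedGaussian.MemW12A w (fun _ => 1) (fun _ => 0)) →
      IsLeast {C : ℝ | WeightedGaussian.BecknerInequality w p C}
        (1 / (1 + WeightedGaussian.curvature w))) := by
  obtain ⟨K₀, hK₀, hb⟩ := hw.bound
  have hgreat := WeightedGaussian.isGreatest_curvature hn hw.nonempty ⟨K₀, hb⟩
  have hineq := hw.becknerInequality hn (hK₀.trans_le (hgreat.2 hb)) hgreat.1 hp1 hp2
  refine ⟨hineq, fun ⟨i, hi⟩ h0 h => ⟨hineq, fun C hC => ?_⟩⟩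
  -- Along the distinguished coordinate the Hessian of `log w` vanishes.
  have hcurv := le_antisymm (WeightedGaussian.curvature_nonpos_of_isPartial hw hi hgreat.1) h0
  have h1 : WeightedGaussian.MemW12A w (fun _ => 1) (fun _ => 0) := by
    rcases h with h | h | h
    · exact WeightedGaussian.memW12A_one_of_isCone hw h
    · exact WeightedGaussian.memW12A_one_of_hasSmoothBoundary hw h
    · exact h
  rw [hcurv, add_zero, div_one]
  exact hC.one_le hw hi h1 hp1 hp2
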